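/- An instance of UFLP-MCC with one facility matroid and one uniform client matroid consists of: a finite universe $U$ with $n=|U|$; integers $k,\ell\ge 0$ and a coloring $\mathrm{col}\colon U\to\{1,\dots,\ell+k\}$; a partition $Z_1\uplus\dots\uplus Z_\ell=\{\ell+1,\dots,\ell+k\}$ into nonempty sets; profits $p_{uv}\in\mathbb N$ for $u,v\in U$ and costs $c_u\in\mathbb N$ for $u\in U$; a matroid $(U_1,\mathcal A)$ with $U_1\subseteq U$ (the facility matroid); and a set $V_1\subseteq U$ and $r\in\mathbb N$, which give the uniform client matroid $(V_1,\mathcal C)$, $\mathcal C=\{S\subseteq V_1: |S|\le r\}$. A feasible solution is a pair of disjoint sets $A,C\subseteq U$ such that $A$ contains exactly one element of each color in $\{1,\dots,\ell\}$, $C$ contains exactly one element of each color in $\{\ell+1,\dots,\ell+k\}$, $A\in\mathcal A$ and $C\in\mathcal C$. It is optimal if it maximizes $$\sum_{u\in A}\Bigl(-c_u+\sum_{v\in C\cap Z(u)}p_{uv}\Bigr),\qquad Z(u)=\{v\in U:\mathrm{col}(v)\in Z_{\mathrm{col}(u)}\},$$ over all feasible solutions, where $Z(u)=\emptyset$ if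 $\mathrm{col}(u)>\ell$. **Proposition.** (1) There is an algorithm that, on every such instance whose facility matroid is given by an independence oracle (which decides in one time step whether a given subset of $U$ belongs to $\mathcal A$), outputs an optimal solution, or correctly reports that there is no feasible solution, within $O(\ell n^2)$ time. Precisely, there are a program for a unit-cost random access machine over the integers (with addition, subtraction, comparison and indirect addressing) and a constant $K$, both independent of the instance, such that the program halts after at most $K(\ell n^2+1)$ steps; here the summand $1$ matters only if $n=0$. (2) The problem reduces to weighted matroid intersection as follows. Let $\mathcal B$ be the partition matroid on $\{u\in U_1:\mathrm{col}(u)\le\ell\}$ in which a set is independent if it has at most one element of each color, and let $w(u)=-c_u+\sum_{j\in Z_{\mathrm{col}(u)}}\max\{p_{uv}: v\in V_1,\ \mathrm{col}(v)=j\}$ (with $Z_{\mathrm{col}(u)}=\emptyset$ if $\mathrm{col}(u)>\ell$). A feasible solution exists if and only if $k\le r$, every color in $\{\ell+1,\dots,\ell+k\}$ occurs in $V_1$, and $(U_1,\mathcal A)$ and $\mathcal B$ have a common independent set of size $\ell$. If $k\le r$ and every color in $\{\ell+1,\dots,\ell+k\}$ occurs in $V_1$, then a set $A\subseteq U$ is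 a maximum-$w$-weight common independent set of size $\ell$ of $(U_1,\mathcal A)$ and $\mathcal B$ if and only if all elements of $A$ have colors in $\{1,\dots,\ell\}$ and there is a set $C$ such that $(A,C)$ is an optimal solution. -/

import Mathlib

/-! ### A unit-cost random access machine with an oracle

Programs are structured programs over finitely many integer registers and finitely many
integer-indexed integer arrays. The only arithmetic is addition, subtraction and comparison; every
node of an evaluated expression or test and every executed command costs one time step. -/

namespace RAM

/-- Memory: `reg x` is the content of register `x`, `arr a z` is cell `z` of array `a`. -/
structure State where
  reg : ℕ → ℤ
  arr : ℕ → ℤ → ℤ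

/-- Store `z` in register `x`. -/
def State.setReg (s : State) (x : ℕ) (z : ℤ) : State :=
  { s with reg := Function.update s.reg x z }

/-- Store `z` in cell `i` of array `a`. -/
def State.setArr (s : State) (a : ℕ) (i z : ℤ) : State :=
  { s with arr := Function.update s.arr a (Function.update (s.arr a) i z) }

/-- Integer expressions; `get a e` reads the cell of array `a` whose address is the value of
`e`. -/
inductive Expr where
  | lit (z : ℤ)
  | var (x : ℕ)
  | get (a : ℕ) (e : Expr)
  | add (e₁ e₂ : Expr)
  | sub (e₁ e₂ : Expr)

def Expr.eval (s : State) : Expr → ℤ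
  | .lit z => z
  | .var x => s.reg x
  | .get a e => s.arr a (e.eval s)
  | .add e₁ e₂ => e₁.eval s + e₂.eval s
  | .sub e₁ e₂ => e₁.eval s - e₂.eval s

/-- The number of time steps needed to evaluate an expression. -/
def Expr.cost : Expr → ℕ
  | .lit _ => 1
  | .var _ => 1
  | .get _ e => e.cost + 1
  | .add e₁ e₂ => e₁.cost + e₂.cost + 1
  | .sub e₁ e₂ => e₁.cost + e₂.cost + 1

/-- Boolean tests. -/
inductive Test where
  | lt (e₁ e₂ : Expr)
  | eq (e₁ e₂ : Expr)
  | not (t : Test)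
  | and (t₁ t₂ : Test)
  | or (t₁ t₂ : Test)

def Test.Holds (s : State) : Test → Prop
  | .lt e₁ e₂ => e₁.eval s < e₂.eval s
  | .eq e₁ e₂ => e₁.eval s = e₂.eval s
  | .not t => ¬ t.Holds s
  | .and t₁ t₂ => t₁.Holds s ∧ t₂.Holds s
  | .or t₁ t₂ => t₁.Holds s ∨ t₂.Holds s

/-- The number of time steps needed to evaluate a test. -/
def Test.cost : Test → ℕ
  | .lt e₁ e₂ => e₁.cost + e₂.cost + 1
  | .eq e₁ e₂ => e₁.cost + e₂.cost + 1
  | .not t => t.cost + 1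
  | .and t₁ t₂ => t₁.cost + t₂.cost + 1
  | .or t₁ t₂ => t₁.cost + t₂.cost + 1

/-- Programs. `store a e₁ e₂` writes the value of `e₂` to the cell of array `a` with address `e₁`;
`query x a` asks the oracle about the content of array `a` and puts the answer, `1` or `0`, into
register `x`. -/
inductive Prog where
  | skip
  | assign (x : ℕ) (e : Expr)
  | store (a : ℕ) (e₁ e₂ : Expr)
  | query (x a : ℕ)
  | seq (P Q : Prog)
  | ite (t : Test) (P Q : Prog)
  | while (t : Test) (P : Prog)

open Classical in
/-- `Exec O P s t s'`: with oracle `O`, the program `P` started in memory `s` halts after exactly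
`t` time steps in memory `s'`. An oracle call takes one time step. -/
inductive Exec (O : (ℤ → ℤ) → Prop) : Prog → State → ℕ → State → Prop where
  | skip (s : State) : Exec O .skip s 1 s
  | assign (x : ℕ) (e : Expr) (s : State) :
      Exec O (.assign x e) s (e.cost + 1) (s.setReg x (e.eval s))
  | store (a : ℕ) (e₁ e₂ : Expr) (s : State) :
      Exec O (.store a e₁ e₂) s (e₁.cost + e₂.cost + 1) (s.setArr a (e₁.eval s) (e₂.eval s))
  | query (x a : ℕ) (s : State) :
      Exec O (.query x a) s 1 (s.setReg x (if O (s.arr a) then 1 else 0))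
  | seq {P Q : Prog} {s₁ s₂ s₃ : State} {t₁ t₂ : ℕ} :
      Exec O P s₁ t₁ s₂ → Exec O Q s₂ t₂ s₃ → Exec O (.seq P Q) s₁ (t₁ + t₂) s₃
  | iteTrue {b : Test} {P Q : Prog} {s₁ s₂ : State} {t : ℕ} :
      b.Holds s₁ → Exec O P s₁ t s₂ → Exec O (.ite b P Q) s₁ (b.cost + 1 + t) s₂
  | iteFalse {b : Test} {P Q : Prog} {s₁ s₂ : State} {t : ℕ} :
      ¬ b.Holds s₁ → Exec O Q s₁ t s₂ → Exec O (.ite b P Q) s₁ (b.cost + 1 + t) s₂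
  | whileFalse {b : Test} {P : Prog} {s : State} :
      ¬ b.Holds s → Exec O (.while b P) s (b.cost + 1) s
  | whileTrue {b : Test} {P : Prog} {s₁ s₂ s₃ : State} {t₁ t₂ : ℕ} :
      b.Holds s₁ → Exec O P s₁ t₁ s₂ → Exec O (.while b P) s₂ t₂ s₃ →
      Exec O (.while b P) s₁ (b.cost + 1 + t₁ + t₂) s₃

/-- A program has at most one halting run from a given memory, so "the" running time and "the"
final memory make sense. -/
theorem Exec.deterministic {O : (ℤ → ℤ) → Prop} {P : Prog} {s : State} {t t' : ℕ}
    {s₁ s₂ : State} (h : Exec O P s t s₁) (h' : Exec O P s t' s₂) : t = t' ∧ s₁ = s₂ := by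
  induction h generalizing t' s₂ with
  | skip | assign | store | query => cases h'; exact ⟨rfl, rfl⟩
  | seq _ _ ih₁ ih₂ =>
    cases h' with
    | seq k₁ k₂ =>
      obtain ⟨rfl, rfl⟩ := ih₁ k₁
      obtain ⟨rfl, rfl⟩ := ih₂ k₂
      exact ⟨rfl, rfl⟩
  | iteTrue hb _ ih =>
    cases h' with
    | iteTrue _ k => obtain ⟨rfl, rfl⟩ := ih k; exact ⟨rfl, rfl⟩
    | iteFalse hn _ => exact absurd hb hn
  | iteFalse hb _ ih =>
    cases h' with
    | iteTrue hn _ => exact absurd hn hb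
    | iteFalse _ k => obtain ⟨rfl, rfl⟩ := ih k; exact ⟨rfl, rfl⟩
  | whileFalse hb =>
    cases h' with
    | whileFalse _ => exact ⟨rfl, rfl⟩
    | whileTrue hn _ _ => exact absurd hn hb
  | whileTrue hb _ _ ih₁ ih₂ =>
    cases h' with
    | whileFalse hn => exact absurd hb hn
    | whileTrue _ k₁ k₂ =>
      obtain ⟨rfl, rfl⟩ := ih₁ k₁
      obtain ⟨rfl, rfl⟩ := ih₂ k₂
      exact ⟨rfl, rfl⟩

/-- The subset of `Fin n` whose characteristic vector is stored in cells `0, …, n - 1` of an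
array. -/
def decode (n : ℕ) (f : ℤ → ℤ) : Finset (Fin n) :=
  Finset.univ.filter fun u => f (u : ℕ) = 1

/-- The independence oracle of a matroid on `Fin n`. Note that `M.Indep S` entails that `S` is
contained in the ground set of `M`. -/
def indepOracle {n : ℕ} (M : Matroid (Fin n)) (f : ℤ → ℤ) : Prop :=
  M.Indep (decode n f : Set (Fin n))

end RAM

/-! ### Uniform matroids -/

/-- The uniform matroid of rank `r` on the ground set `E`: the independent sets are the subsets of
`E` with at most `r` elements. -/
def uniformMatroid {α : Type*} [DecidableEq α] (E : Finset α) (r : ℕ) : Matroid α :=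
  (IndepMatroid.ofFinset (E : Set α) (fun S => S ⊆ E ∧ S.card ≤ r)
    ⟨Finset.empty_subset E, Nat.zero_le r⟩
    (fun _ _ hJ hIJ => ⟨hIJ.trans hJ.1, (Finset.card_le_card hIJ).trans hJ.2⟩)
    (fun I J hI hJ hlt => by
      obtain ⟨e, heJ, heI⟩ := Finset.exists_mem_notMem_of_card_lt_card hlt
      refine ⟨e, heJ, heI, Finset.insert_subset (hJ.1 heJ) hI.1, ?_⟩
      rw [Finset.card_insert_of_notMem heI]
      exact (Nat.succ_le_of_lt hlt).trans hJ.2)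
    (fun _ hI => Finset.coe_subset.2 hI.1)).matroid

theorem uniformMatroid_ground {α : Type*} [DecidableEq α] (E : Finset α) (r : ℕ) :
    (uniformMatroid E r).E = (E : Set α) := rfl

theorem uniformMatroid_indep_iff {α : Type*} [DecidableEq α] (E : Finset α) (r : ℕ)
    (S : Finset α) : (uniformMatroid E r).Indep (S : Set α) ↔ S ⊆ E ∧ S.card ≤ r := by
  rw [uniformMatroid, IndepMatroid.matroid_Indep, IndepMatroid.ofFinset_indep]

/-! ### Facility location with matroid and color constraints -/

/-- An instance with universe `Fin n`, one facility matroid and one uniform client matroid. The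
colors are `0, …, ℓ + k - 1`; the first `ℓ` of them are the facility colors `Fin.castAdd k i`, the
other `k` are the client colors `Fin.natAdd ℓ j`. -/
structure UFLPMCC (n k ℓ : ℕ) where
  /-- coloring of the universe -/
  col : Fin n → Fin (ℓ + k)
  /-- the parts of the partition of the set of client colors -/
  Z : Fin ℓ → Finset (Fin (ℓ + k))
  Z_nonempty : ∀ i, (Z i).Nonempty
  Z_disjoint : ∀ i i', i ≠ i' → Disjoint (Z i) (Z i')
  Z_union : Finset.univ.biUnion Z = Finset.univ.image (Fin.natAdd ℓ : Fin k → Fin (ℓ + k))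
  /-- `profit u v`: profit when a facility at `u` serves a client at `v` -/
  profit : Fin n → Fin n → ℕ
  /-- cost of opening a facility -/
  cost : Fin n → ℕ
  /-- the facility matroid; its ground set `facility.E` is a subset of the universe -/
  facility : Matroid (Fin n)
  /-- ground set of the client matroid -/
  V : Finset (Fin n)
  /-- rank bound of the client matroid -/
  r : ℕ

namespace UFLPMCC

variable {n k ℓ : ℕ} (I : UFLPMCC n k ℓ)

/-- The client matroid. -/
def client : Matroid (Fin n) := uniformMatroid I.V I.r

/-- `Z(u)`: the elements whose color lies in the part that belongs to the color of `u`. It is empty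
if the color of `u` is not a facility color. -/
def Zset (u : Fin n) : Finset (Fin n) :=
  Finset.univ.filter fun v => ∃ i : Fin ℓ, I.col u = Fin.castAdd k i ∧ I.col v ∈ I.Z i

/-- Feasible solutions. -/
structure Feasible (A C : Finset (Fin n)) : Prop where
  disjoint : Disjoint A C
  facility_colors : ∀ i : Fin ℓ, ∃! u, u ∈ A ∧ I.col u = Fin.castAdd k i
  client_colors : ∀ j : Fin k, ∃! v, v ∈ C ∧ I.col v = Fin.natAdd ℓ j
  facility_indep : I.facility.Indep (A : Set (Fin n))
  client_indep : I.client.Indep (C : Set (Fin n))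

/-- The goal function. -/
def value (A C : Finset (Fin n)) : ℤ :=
  ∑ u ∈ A, (-(I.cost u : ℤ) + ∑ v ∈ C ∩ I.Zset u, (I.profit u v : ℤ))

/-- Optimal solutions. -/
def Optimal (A C : Finset (Fin n)) : Prop :=
  I.Feasible A C ∧ ∀ A' C', I.Feasible A' C' → I.value A' C' ≤ I.value A C

open Classical in
/-- The index of the part of the partition that contains the client color `Fin.natAdd ℓ j`. -/
noncomputable def part (j : Fin k) : ℕ :=
  if h : ∃ i, Fin.natAdd ℓ j ∈ I.Z i then (h.choose : ℕ) else 0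

/-- The memory `s` contains the input: the numbers `n`, `k`, `ℓ`, `r` are in registers `0, …, 3`,
the profit matrix is in array `0` row by row, and arrays `1, …, 4` hold the costs, the colors, the
parts of the client colors, and the characteristic vector of the ground set of the client matroid.
The facility matroid is not part of the memory. All other registers and cells are arbitrary. -/
structure Loaded (s : RAM.State) : Prop where
  reg_n : s.reg 0 = n
  reg_k : s.reg 1 = k
  reg_ℓ : s.reg 2 = ℓ
  reg_r : s.reg 3 = I.r
  arr_profit : ∀ u v : Fin n, s.arr 0 (((u : ℕ) * n + (v : ℕ) : ℕ) : ℤ) = I.profit u v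
  arr_cost : ∀ u : Fin n, s.arr 1 ((u : ℕ) : ℤ) = I.cost u
  arr_col : ∀ u : Fin n, s.arr 2 ((u : ℕ) : ℤ) = ((I.col u : ℕ) : ℤ)
  arr_part : ∀ j : Fin k, s.arr 3 ((j : ℕ) : ℤ) = I.part j
  arr_V : ∀ v : Fin n, s.arr 4 ((v : ℕ) : ℤ) = if v ∈ I.V then 1 else 0

/-- The memory `s` contains a correct output: register `4` is `1` and arrays `5` and `6` hold the
characteristic vectors of an optimal solution, or register `4` is `0` and there is no feasible
solution. -/
def Solved (s : RAM.State) : Prop :=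
  (s.reg 4 = 1 ∧ I.Optimal (RAM.decode n (s.arr 5)) (RAM.decode n (s.arr 6))) ∨
  (s.reg 4 = 0 ∧ ∀ A C, ¬ I.Feasible A C)

/-! ### The reduction to weighted matroid intersection -/

/-- The elements of the ground set of the facility matroid with facility color `i`. -/
noncomputable def facilityClass (i : Fin ℓ) : Finset (Fin n) :=
  (Set.toFinite {u | u ∈ I.facility.E ∧ I.col u = Fin.castAdd k i}).toFinset

theorem facilityClass_disjoint :
    Pairwise (Function.onFun Disjoint fun i => (uniformMatroid (I.facilityClass i) 1).E) := by
  intro i i' h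
  simp only [Function.onFun, uniformMatroid_ground, facilityClass, Set.Finite.coe_toFinset]
  exact Set.disjoint_left.2 fun u hu hu' => h (Fin.castAdd_injective ℓ k (hu.2.symm.trans hu'.2))

/-- The partition matroid with at most one element of each facility color and no elements of other
colors: the direct sum of the uniform matroids of rank one on the facility color classes. -/
noncomputable def partitionMatroid : Matroid (Fin n) :=
  Matroid.disjointSigma (fun i : Fin ℓ => uniformMatroid (I.facilityClass i) 1)
    I.facilityClass_disjoint

/-- `w(u) = -c_u + ∑_{j ∈ Z_{col u}} max {p_{uv} | v ∈ V, col v = j}`. -/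
def weight (u : Fin n) : ℤ :=
  -(I.cost u : ℤ) +
    ∑ j : Fin (ℓ + k) with ∃ i : Fin ℓ, I.col u = Fin.castAdd k i ∧ j ∈ I.Z i,
      (((I.V.filter fun v => I.col v = j).sup (I.profit u) : ℕ) : ℤ)

/-- The uniform client matroid has rank bound at least `k` and an element of every client color. -/
def Servable : Prop :=
  k ≤ I.r ∧ ∀ j : Fin k, ∃ v ∈ I.V, I.col v = Fin.natAdd ℓ j

/-- Common independent sets of size `ℓ` of the facility matroid and the partition matroid. -/
def CommonIndep (A : Finset (Fin n)) : Prop :=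
  A.card = ℓ ∧ I.facility.Indep (A : Set (Fin n)) ∧ I.partitionMatroid.Indep (A : Set (Fin n))

/-- Maximum-weight common independent sets of size `ℓ`. -/
def MaxWeightCommonIndep (A : Finset (Fin n)) : Prop :=
  I.CommonIndep A ∧ ∀ B, I.CommonIndep B → ∑ u ∈ B, I.weight u ≤ ∑ u ∈ A, I.weight u

end UFLPMCC

/-! The uniform client matroid does not couple the choices of clients. A client color lies in
exactly one part, and a solution has exactly one facility of the color belonging to that part. Hence
each client color is served by a single facility, and its client can be taken best for that
facility, independently of all other choices, as soon as `k ≤ r`. The best value obtainable with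
facilities `A` is therefore the sum of `w` over `A`. A feasible `A` may also contain elements of
client colors, but these serve nobody and contribute only `-c_u ≤ 0`; `UFLPMCC.facilities` discards
them. The two inequalities are `Feasible.value_le` and `IsBestClients.value_eq`.

It remains to find a maximum-weight independent transversal of the `ℓ` facility colors. Phase `c`
extends an optimal transversal of the colors `1, …, c - 1` by the color `c`. Since one of the two
matroids is a partition matroid, the exchange graph can be contracted to the colors: its nodes are
`1, …, c` and a sink `0`, and there is an arc from `g` to `h` for each element of color `g` that can
replace the representative of `h` (or be added, if `h = 0`). Of parallel arcs only a heaviest one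
matters. All arcs are found with one oracle call at most for each pair of an element and a node, and
a Dijkstra-like search from `c` to `0` takes `O(c²)` steps, so a phase takes `O(n²)`.

Correctness is certified by node potentials `π`. The total potential is the same for all
transversals, so it suffices that the current transversal is optimal for the reduced weight `w(y) -
π(node y)` among independent sets. By `Matroid.Indep.sum_le_sum_of_locally_optimal` this follows
from one inequality for each arc, which is `IsDual`. The search shifts the potential of the reached
nodes until another node is reached by a tight arc. If it reaches the sink, the exchanges along the
tight path preserve independence, because the potentials and the choice of the earliest parent make
them triangular (`Matroid.Indep.indep_of_triangular_exchange`); the reduced weight is unchanged, and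
this yields the new dual inequalities (`Search.augment`). If the search gets stuck, the indicator of
the reached nodes, used as a weight, shows that no independent transversal of `1, …, c` exists
(`Search.no_transversal`).

The programs are verified with `wp`, which bounds the running time together with the result, a frame
rule read off the program text, and one rule for counting loops. The `O(n²)` preprocessing is
covered by `O(ℓ n²)` because a nonempty universe forces `ℓ ≥ 1`. -/

namespace RAM

/-! ### Total correctness with running times -/

/-- `P` halts on `s`, and `Q` holds of the running time and the final memory. -/
def wp (O : (ℤ → ℤ) → Prop) (P : Prog) (Q : ℕ → State → Prop) (s : State) : Prop :=
  ∃ t s', Exec O P s t s' ∧ Q t s'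

section wp

variable {O : (ℤ → ℤ) → Prop} {Q R : ℕ → State → Prop} {s : State}

theorem wp.mono {P : Prog} (h : wp O P Q s) (hQ : ∀ t s', Q t s' → R t s') : wp O P R s := by
  obtain ⟨t, s', h₁, h₂⟩ := h
  exact ⟨t, s', h₁, hQ _ _ h₂⟩

theorem wp_skip : wp O .skip Q s ↔ Q 1 s := by
  constructor
  · rintro ⟨t, s', h, hQ⟩
    cases h
    exact hQ
  · exact fun h => ⟨_, _, .skip s, h⟩

theorem wp_assign {x : ℕ} {e : Expr} :
    wp O (.assign x e) Q s ↔ Q (e.cost + 1) (s.setReg x (e.eval s)) := by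
  constructor
  · rintro ⟨t, s', h, hQ⟩
    cases h
    exact hQ
  · exact fun h => ⟨_, _, .assign x e s, h⟩

theorem wp_store {a : ℕ} {e₁ e₂ : Expr} :
    wp O (.store a e₁ e₂) Q s ↔
      Q (e₁.cost + e₂.cost + 1) (s.setArr a (e₁.eval s) (e₂.eval s)) := by
  constructor
  · rintro ⟨t, s', h, hQ⟩
    cases h
    exact hQ
  · exact fun h => ⟨_, _, .store a e₁ e₂ s, h⟩

open Classical in
theorem wp_query {x a : ℕ} :
    wp O (.query x a) Q s ↔ Q 1 (s.setReg x (if O (s.arr a) then 1 else 0)) := by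
  constructor
  · rintro ⟨t, s', h, hQ⟩
    cases h
    convert hQ
  · intro h
    refine ⟨_, _, .query x a s, ?_⟩
    convert h

theorem wp_seq {P P' : Prog} :
    wp O (.seq P P') Q s ↔ wp O P (fun t s' => wp O P' (fun t' s'' => Q (t + t') s'') s') s := by
  constructor
  · rintro ⟨t, s', h, hQ⟩
    cases h with
    | seq h₁ h₂ => exact ⟨_, _, h₁, _, _, h₂, hQ⟩
  · rintro ⟨t, s', h, t', s'', h', hQ⟩
    exact ⟨_, _, .seq h h', hQ⟩

theorem wp_ite {b : Test} {P P' : Prog} :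
    wp O (.ite b P P') Q s ↔
      (b.Holds s → wp O P (fun t s' => Q (b.cost + 1 + t) s') s) ∧
      (¬ b.Holds s → wp O P' (fun t s' => Q (b.cost + 1 + t) s') s) := by
  constructor
  · rintro ⟨t, s', h, hQ⟩
    cases h with
    | iteTrue hb h => exact ⟨fun _ => ⟨_, _, h, hQ⟩, fun hn => absurd hb hn⟩
    | iteFalse hb h => exact ⟨fun hn => absurd hn hb, fun _ => ⟨_, _, h, hQ⟩⟩
  · rintro ⟨h₁, h₂⟩
    by_cases hb : b.Holds s
    · obtain ⟨t, s', h, hQ⟩ := h₁ hb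
      exact ⟨_, _, .iteTrue hb h, hQ⟩
    · obtain ⟨t, s', h, hQ⟩ := h₂ hb
      exact ⟨_, _, .iteFalse hb h, hQ⟩

end wp

/-! ### Memory updates -/

section update

variable (s : State) (x y a b : ℕ) (i z : ℤ)

@[simp] theorem State.setReg_reg_same : (s.setReg x z).reg x = z := by simp [State.setReg]

@[simp] theorem State.setReg_reg_of_ne (h : y ≠ x) : (s.setReg x z).reg y = s.reg y := by
  simp [State.setReg, h]

@[simp] theorem State.setReg_arr : (s.setReg x z).arr = s.arr := rfl

@[simp] theorem State.setArr_reg : (s.setArr a i z).reg = s.reg := rfl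

@[simp] theorem State.setArr_arr_same :
    (s.setArr a i z).arr a = Function.update (s.arr a) i z := by
  simp [State.setArr]

@[simp] theorem State.setArr_arr_of_ne (h : b ≠ a) : (s.setArr a i z).arr b = s.arr b := by
  simp [State.setArr, h]

end update

attribute [simp] Expr.eval Expr.cost Test.Holds Test.cost

/-! ### Registers and arrays that a program leaves alone -/

/-- `P` contains an assignment to register `x`. -/
def Prog.writesReg (x : ℕ) : Prog → Bool
  | .skip => false
  | .assign y _ => x == y
  | .store _ _ _ => false
  | .query y _ => x == y
  | .seq P Q => P.writesReg x || Q.writesReg x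
  | .ite _ P Q => P.writesReg x || Q.writesReg x
  | .while _ P => P.writesReg x

/-- `P` contains an assignment to a cell of array `a`. -/
def Prog.writesArr (a : ℕ) : Prog → Bool
  | .skip => false
  | .assign _ _ => false
  | .store b _ _ => a == b
  | .query _ _ => false
  | .seq P Q => P.writesArr a || Q.writesArr a
  | .ite _ P Q => P.writesArr a || Q.writesArr a
  | .while _ P => P.writesArr a

/-- The memories differ at most in the registers and arrays that occur in assignments of `P`. -/
structure Agree (P : Prog) (s s' : State) : Prop where
  reg : ∀ x, P.writesReg x = false → s'.reg x = s.reg x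
  arr : ∀ a, P.writesArr a = false → s'.arr a = s.arr a

theorem Agree.refl (P : Prog) (s : State) : Agree P s s := ⟨fun _ _ => rfl, fun _ _ => rfl⟩

theorem Agree.trans {P : Prog} {s s' s'' : State} (h : Agree P s s') (h' : Agree P s' s'') :
    Agree P s s'' :=
  ⟨fun x hx => (h'.reg x hx).trans (h.reg x hx), fun a ha => (h'.arr a ha).trans (h.arr a ha)⟩

theorem Agree.of_le {P P' : Prog} {s s' : State} (h : Agree P s s')
    (hr : ∀ x, P'.writesReg x = false → P.writesReg x = false)
    (ha : ∀ a, P'.writesArr a = false → P.writesArr a = false) : Agree P' s s' :=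
  ⟨fun x hx => h.reg x (hr x hx), fun a hx => h.arr a (ha a hx)⟩

/-- This is the frame rule. The write sets are computed from the program text, so for a concrete
program each unchanged register or array is obtained by `rfl`. -/
theorem Exec.agree {O : (ℤ → ℤ) → Prop} {P : Prog} {s s' : State} {t : ℕ}
    (h : Exec O P s t s') : Agree P s s' := by
  induction h with
  | skip s => exact Agree.refl _ _
  | assign x e s =>
    exact ⟨fun y hy => State.setReg_reg_of_ne _ _ _ _ (by simpa [Prog.writesReg] using hy),
      fun _ _ => rfl⟩
  | store a e₁ e₂ s =>
    exact ⟨fun _ _ => rfl,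
      fun b hb => State.setArr_arr_of_ne _ _ _ _ _ (by simpa [Prog.writesArr] using hb)⟩
  | query x a s =>
    exact ⟨fun y hy => State.setReg_reg_of_ne _ _ _ _ (by simpa [Prog.writesReg] using hy),
      fun _ _ => rfl⟩
  | seq _ _ ih₁ ih₂ =>
    exact (ih₁.of_le (by simp +contextual [Prog.writesReg])
      (by simp +contextual [Prog.writesArr])).trans (ih₂.of_le
        (by simp +contextual [Prog.writesReg]) (by simp +contextual [Prog.writesArr]))
  | iteTrue _ _ ih =>
    exact ih.of_le (by simp +contextual [Prog.writesReg]) (by simp +contextual [Prog.writesArr])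
  | iteFalse _ _ ih =>
    exact ih.of_le (by simp +contextual [Prog.writesReg]) (by simp +contextual [Prog.writesArr])
  | whileFalse _ => exact Agree.refl _ _
  | whileTrue _ _ _ ih₁ ih₂ =>
    exact Agree.trans (P := .while _ _) (ih₁.of_le (fun _ h => h) (fun _ h => h)) ih₂

theorem wp.agree {O : (ℤ → ℤ) → Prop} {P : Prog} {Q : ℕ → State → Prop} {s : State}
    (h : wp O P Q s) : wp O P (fun t s' => Q t s' ∧ Agree P s s') s := by
  obtain ⟨t, s', h₁, h₂⟩ := h
  exact ⟨t, s', h₁, h₂, h₁.agree⟩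

/-! ### Counting loops -/

/-- `for x = e₁, …, e₂ - 1 do P`. -/
def Prog.forLoop (x : ℕ) (e₁ e₂ : Expr) (P : Prog) : Prog :=
  .seq (.assign x e₁)
    (.while (.lt (.var x) e₂) (.seq P (.assign x (.add (.var x) (.lit 1)))))

/-- Induction on the number `m` of remaining rounds. Besides the body, a round costs `e₂.cost + 3`
for the test and `4` for the increment, so `e₂.cost + 8` is enough. The start value `0` inside
`Agree` is a dummy: write sets do not depend on it. -/
theorem wp_while_of_invariant {O : (ℤ → ℤ) → Prop} {x : ℕ} {e₂ : Expr} {P : Prog}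
    (b : ℕ) (Inv : ℕ → State → Prop) (T : ℕ) (s₀ : State)
    (step : ∀ (i : ℕ) (s : State), i < b → s.reg x = i → e₂.eval s = b →
      Agree (.forLoop x (.lit 0) e₂ P) s₀ s → Inv i s →
      wp O P (fun t s' => t ≤ T ∧ s'.reg x = i ∧ e₂.eval (s'.setReg x (i + 1 : ℕ)) = b ∧
        Inv (i + 1) (s'.setReg x (i + 1 : ℕ))) s)
    (m : ℕ) : ∀ (a : ℕ) (s : State), a + m = b → s.reg x = a → e₂.eval s = b →
      Agree (.forLoop x (.lit 0) e₂ P) s₀ s → Inv a s →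
      wp O (.while (.lt (.var x) e₂) (.seq P (.assign x (.add (.var x) (.lit 1)))))
        (fun t s' => t ≤ m * (T + e₂.cost + 8) + e₂.cost + 3 ∧ s'.reg x = b ∧ Inv b s') s := by
  induction m with
  | zero =>
    intro a s hab ha hb _ hI
    obtain rfl : a = b := by omega
    refine ⟨_, _, .whileFalse ?_, ?_, ha, hI⟩
    · simp [ha, hb]
    · simp only [Test.cost, Expr.cost]; omega
  | succ m ih =>
    intro a s hab ha hb hag hI
    obtain ⟨t, s', hex, ht, hx, hb', hI'⟩ := step a s (by omega) ha hb hag hI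
    have hreg : (s'.setReg x ((Expr.var x).add (Expr.lit 1) |>.eval s')) =
        s'.setReg x (a + 1 : ℕ) := by simp [hx]
    have hstep := Exec.seq hex (Exec.assign x ((Expr.var x).add (Expr.lit 1)) s')
    rw [hreg] at hstep
    obtain ⟨t', s'', hex', ht', hx', hI''⟩ := ih (a + 1) (s'.setReg x (a + 1 : ℕ)) (by omega)
      (by simp) hb' (hag.trans (hstep.agree.of_le
        (by simp +contextual [Prog.writesReg, Prog.forLoop])
        (by simp +contextual [Prog.writesArr, Prog.forLoop]))) hI'
    refine ⟨_, _, .whileTrue ?_ hstep hex', ?_, hx', hI''⟩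
    · simp only [Test.Holds, Expr.eval, ha, hb]; omega
    · simp only [Test.cost, Expr.cost]
      have : (m + 1) * (T + e₂.cost + 8) = m * (T + e₂.cost + 8) + (T + e₂.cost + 8) := by ring
      omega

/-- The rule for counting loops whose body does not change the counter and the upper bound. -/
theorem wp_forLoop {O : (ℤ → ℤ) → Prop} {x : ℕ} {e₁ e₂ : Expr} {P : Prog} {s₀ : State}
    (a b : ℕ) (Inv : ℕ → State → Prop) (T : ℕ) (hx : P.writesReg x = false)
    (ha : e₁.eval s₀ = a) (hab : a ≤ b)
    (hb : ∀ s, Agree (.forLoop x e₁ e₂ P) s₀ s → e₂.eval s = b)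
    (init : Inv a (s₀.setReg x a))
    (step : ∀ (i : ℕ) (s : State), a ≤ i → i < b → s.reg x = i →
      Agree (.forLoop x e₁ e₂ P) s₀ s → Inv i s →
      wp O P (fun t s' => t ≤ T ∧ Inv (i + 1) (s'.setReg x (i + 1 : ℕ))) s) :
    wp O (.forLoop x e₁ e₂ P)
      (fun t s' => t ≤ (b - a) * (T + e₂.cost + 8) + e₁.cost + e₂.cost + 4 ∧ s'.reg x = b ∧
        Inv b s') s₀ := by
  have hassign : Agree (.forLoop x e₁ e₂ P) s₀ (s₀.setReg x a) := by
    have := (Exec.assign (O := O) x e₁ s₀).agree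
    rw [ha] at this
    exact this.of_le (by simp +contextual [Prog.writesReg, Prog.forLoop])
      (by simp +contextual [Prog.writesArr, Prog.forLoop])
  -- The frame statement is made part of the invariant, so that `e₂` keeps the value `b` in every
  -- round.
  have key := wp_while_of_invariant (O := O) (x := x) (e₂ := e₂) (P := P) b
    (fun i s => a ≤ i ∧ Agree (.forLoop x e₁ e₂ P) s₀ s ∧ Inv i s) T s₀ ?_ (b - a) a
    (s₀.setReg x a) (by omega) (by simp) (hb _ hassign)
    (hassign.of_le (fun _ h => h) (fun _ h => h)) ⟨le_rfl, hassign, init⟩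
  · rw [Prog.forLoop, wp_seq, wp_assign, ha]
    exact key.mono fun t s' h => ⟨by omega, h.2.1, h.2.2.2.2⟩
  · rintro i s hi hxi _ _ ⟨hai, hag, hI⟩
    refine (step i s hai hi hxi hag hI).agree.mono ?_
    rintro t s' ⟨⟨ht, hI'⟩, hag'⟩
    have h1 : Agree (.forLoop x e₁ e₂ P) s₀ (s'.setReg x (i + 1 : ℕ)) := by
      refine hag.trans (Agree.trans (s' := s') ?_ ?_)
      · exact hag'.of_le (by simp +contextual [Prog.writesReg, Prog.forLoop])
          (by simp +contextual [Prog.writesArr, Prog.forLoop])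
      · exact ⟨fun y hy => State.setReg_reg_of_ne _ _ _ _
          (by simp [Prog.writesReg, Prog.forLoop] at hy; exact hy.1), fun _ _ => rfl⟩
    exact ⟨ht, (hag'.reg x hx).trans hxi, hb _ h1, by omega, h1, hI'⟩

end RAM

/-! ### Exchange properties of matroids -/

namespace Matroid

variable {α : Type*} {M : Matroid α}

/-- If no element of `B` extended `A`, then `B` would lie in the closure of `A` and have rank at
most `|A|`. -/
theorem Indep.exists_indep_insert_of_card_lt [DecidableEq α] {A B : Finset α}
    (hA : M.Indep (A : Set α)) (hB : M.Indep (B : Set α)) (h : A.card < B.card) :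
    ∃ y ∈ B, y ∉ A ∧ M.Indep (insert y (A : Set α)) := by
  by_contra! hcon
  have hsub : (B : Set α) ⊆ M.closure A := by
    intro y hy
    rw [hA.mem_closure_iff']
    exact ⟨hB.subset_ground hy, fun hi => by_contra fun hyA => hcon y hy hyA hi⟩
  have h₁ := M.eRk_mono hsub
  rw [eRk_closure_eq, hA.eRk_eq_encard, hB.eRk_eq_encard, Set.encard_coe_eq_coe_finsetCard,
    Set.encard_coe_eq_coe_finsetCard] at h₁
  exact absurd (Nat.cast_le.1 h₁) (by omega)

/-- Symmetric exchange between independent sets of the same size. -/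
theorem Indep.exists_symmetric_exchange [DecidableEq α] {A B : Finset α}
    (hA : M.Indep (A : Set α)) (hB : M.Indep (B : Set α)) (h : A.card = B.card) {x : α}
    (hxA : x ∈ A) (hxB : x ∉ B) :
    ∃ y ∈ B, y ∉ A ∧ M.Indep (insert y ((A : Set α) \ {x})) ∧
      M.Indep (insert x ((B : Set α) \ {y})) := by
  have hAx : M.Indep ((A : Set α) \ {x}) := hA.sdiff _
  have hxE : x ∈ M.E := hA.subset_ground hxA
  by_cases hBx : x ∈ M.closure B
  -- If the rest of the fundamental circuit of `x` in `B` lay in the closure of `A \ {x}`, then so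
  -- would `x`, against the independence of `A`. A circuit element `y` outside that closure permits
  -- both exchanges.
  · have hC := hB.fundCircuit_isCircuit hBx hxB
    have hnot : ¬ M.fundCircuit x B \ {x} ⊆ M.closure ((A : Set α) \ {x}) := by
      intro hsub
      have h₁ : x ∈ M.closure (M.fundCircuit x B \ {x}) :=
        hC.mem_closure_sdiff_singleton_of_mem (M.mem_fundCircuit x B)
      have h₂ := M.closure_subset_closure_of_subset_closure hsub h₁
      exact hA.notMem_closure_sdiff_of_mem hxA h₂
    obtain ⟨y, ⟨hyC, hyx⟩, hycl⟩ := Set.not_subset.1 hnot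
    have hyB : y ∈ B := by
      have := M.fundCircuit_subset_insert x B hyC
      rcases this with h | h
      · exact absurd h hyx
      · exact h
    have hyE := hB.subset_ground hyB
    have hins := (hAx.notMem_closure_iff hyE).1 hycl
    refine ⟨y, hyB, fun hyA => hins.2 ⟨hyA, hyx⟩, hins.1, ?_⟩
    have := (hB.mem_fundCircuit_iff hBx hxB).1 hyC
    rwa [← Set.insert_sdiff_singleton_comm (Ne.symm hyx)] at this
  -- Here `x` extends `B`, so only the exchange in `A` restricts `y`.
  · have hBi := (hB.notMem_closure_iff hxE).1 hBx
    have hAx' : M.Indep ((A.erase x : Finset α) : Set α) := by simpa using hAx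
    obtain ⟨y, hyB, hyA, hi⟩ := hAx'.exists_indep_insert_of_card_lt hB
      (by rw [← h]; exact Finset.card_erase_lt_of_mem hxA)
    have hyx : y ≠ x := fun e => hxB (e ▸ hyB)
    refine ⟨y, hyB, fun hy => hyA (Finset.mem_erase.2 ⟨hyx, hy⟩), by simpa using hi, ?_⟩
    exact hBi.1.subset (Set.insert_subset_insert Set.sdiff_subset)

/-- An independent set that cannot be improved by inserting one element or by exchanging two
elements has maximum weight among the independent sets that are at least as large. -/
theorem Indep.sum_le_sum_of_locally_optimal [DecidableEq α] {A : Finset α}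
    (hA : M.Indep (A : Set α)) (f : α → ℤ) (N : ℕ) : ∀ B : Finset α, (B \ A).card = N →
    M.Indep (B : Set α) → A.card ≤ B.card →
    (∀ y ∈ B, y ∉ A → M.Indep (insert y (A : Set α)) → f y ≤ 0) →
    (∀ y ∈ B, y ∉ A → ∀ x ∈ A, M.Indep (insert y ((A : Set α) \ {x})) → f y ≤ f x) →
    ∑ u ∈ B, f u ≤ ∑ u ∈ A, f u := by
  induction N with
  | zero =>
    intro B hN hB hcard _ _
    have hsub : B ⊆ A := Finset.sdiff_eq_empty_iff_subset.1 (Finset.card_eq_zero.1 hN)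
    rw [Finset.eq_of_subset_of_card_le hsub hcard]
  | succ N ih =>
    intro B hN hB hcard h₀ h₁
    -- Move `B` towards `A`: drop an element that `A` could absorb, which is worth at most `0`, or
    -- trade `y` for `x` by a symmetric exchange, where `f y ≤ f x`. The hypotheses concern
    -- exchanges in `A` only, so they survive the change of `B`.
    rcases hcard.lt_or_eq with hlt | heq
    · obtain ⟨y, hyB, hyA, hi⟩ := hA.exists_indep_insert_of_card_lt hB hlt
      have hsd : (B.erase y \ A) = (B \ A).erase y := by
        ext; simp only [Finset.mem_sdiff, Finset.mem_erase]; tauto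
      have h₂ := ih (B.erase y)
        (by rw [hsd, Finset.card_erase_of_mem (Finset.mem_sdiff.2 ⟨hyB, hyA⟩), hN]; rfl)
        (hB.subset (by simp)) (by rw [Finset.card_erase_of_mem hyB]; omega)
        (fun z hz => h₀ z (Finset.mem_of_mem_erase hz))
        (fun z hz => h₁ z (Finset.mem_of_mem_erase hz))
      have h₃ := h₀ y hyB hyA hi
      have h₄ := Finset.add_sum_erase B f hyB
      linarith
    · have hne : (A \ B).Nonempty := by
        rw [Finset.sdiff_nonempty]
        intro hsub
        have := Finset.eq_of_subset_of_card_le hsub heq.ge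
        rw [this] at hN
        simp at hN
      obtain ⟨x, hx⟩ := hne
      rw [Finset.mem_sdiff] at hx
      obtain ⟨y, hyB, hyA, hi, hi'⟩ := hA.exists_symmetric_exchange hB heq hx.1 hx.2
      have hxe : x ∉ B.erase y := fun h => hx.2 (Finset.mem_of_mem_erase h)
      have hsd : (insert x (B.erase y) \ A) = (B \ A).erase y := by
        ext z
        simp only [Finset.mem_sdiff, Finset.mem_erase, Finset.mem_insert]
        constructor
        · rintro ⟨rfl | h, h'⟩
          · exact absurd hx.1 h'
          · exact ⟨h.1, h.2, h'⟩
        · tauto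
      have h₂ := ih (insert x (B.erase y))
        (by rw [hsd, Finset.card_erase_of_mem (Finset.mem_sdiff.2 ⟨hyB, hyA⟩), hN]; rfl)
        (by simpa using hi')
        (by rw [Finset.card_insert_of_notMem hxe, Finset.card_erase_of_mem hyB]; omega)
        (fun z hz hzA => by
          rcases Finset.mem_insert.1 hz with rfl | hz
          · exact absurd hx.1 hzA
          · exact h₀ z (Finset.mem_of_mem_erase hz) hzA)
        (fun z hz hzA => by
          rcases Finset.mem_insert.1 hz with rfl | hz
          · exact absurd hx.1 hzA
          · exact h₁ z (Finset.mem_of_mem_erase hz) hzA)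
      rw [Finset.sum_insert hxe] at h₂
      have h₃ := h₁ y hyB hyA x hx.1 hi
      have h₄ := Finset.add_sum_erase B f hyB
      linarith

/-- A triangular family of exchanges preserves independence. -/
theorem Indep.indep_of_triangular_exchange {ι κ : Type*} [DecidableEq ι] [LinearOrder κ]
    (key : ι → κ) (X : ι → Set α) (y : ι → α) (D : Finset ι) :
    Set.InjOn key D → ∀ A : Set α, M.Indep A →
    (∀ i ∈ D, y i ∉ A) → (∀ i ∈ D, ∀ j ∈ D, y i ∉ X j) →
    (∀ i ∈ D, M.Indep (insert (y i) (A \ X i))) →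
    (∀ i ∈ D, ∀ j ∈ D, key i < key j → y i ∈ M.closure (A \ X j)) →
    M.Indep ((A \ ⋃ i ∈ D, X i) ∪ y '' D) := by
  -- The exchange with the largest key is carried out first. All other inserted elements lie in the
  -- closure of `A \ X m`, and therefore it does not disturb them.
  induction D using Finset.induction_on_max_value key with
  | empty => intro _ A hA _ _ _ _; simpa using hA
  | insert m D hm hmax ih =>
    intro hinj A hA hyA hyX hi hcl
    have hlt : ∀ i ∈ D, key i < key m := fun i hiD =>
      lt_of_le_of_ne (hmax i hiD) fun e => hm (by
        have := hinj (by simp [hiD]) (by simp) e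
        rwa [← this])
    have hyE : ∀ i ∈ insert m D, y i ∈ M.E := fun i hiD =>
      (hi i hiD).subset_ground (Set.mem_insert _ _)
    have hncl : ∀ i ∈ insert m D, y i ∉ M.closure (A \ X i) := fun i hiD =>
      ((hA.sdiff _).notMem_closure_iff (hyE i hiD)).2
        ⟨hi i hiD, fun h => hyA i hiD h.1⟩
    have hmm : m ∈ insert m D := Finset.mem_insert_self _ _
    have hD : ∀ i ∈ D, i ∈ insert m D := fun i hiD => Finset.mem_insert_of_mem hiD
    have hym : ∀ i ∈ D, y i ∈ M.closure (A \ X m) := fun i hiD =>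
      hcl i (hD i hiD) m hmm (hlt i hiD)
    set A₁ : Set α := insert (y m) (A \ X m) with hA₁
    have hsub : ∀ Y : Set α, A₁ \ Y ⊆ insert (y m) ((A \ X m) \ Y) := by
      intro Y z hz
      rcases hz.1 with h | h
      · exact Or.inl h
      · exact Or.inr ⟨h, hz.2⟩
    have hncl₁ : ∀ i ∈ D, y i ∉ M.closure (A₁ \ X i) := by
      intro i hiD hcon
      have h₁ := M.closure_subset_closure (hsub (X i)) hcon
      have h₂ : y i ∉ M.closure ((A \ X m) \ X i) := fun h =>
        hncl i (hD i hiD) (M.closure_subset_closure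
          (show (A \ X m) \ X i ⊆ A \ X i from fun z hz => ⟨hz.1.1, hz.2⟩) h)
      -- By the exchange property of the closure, `y m` would depend on `y i` together with a part
      -- of `A \ X m`, hence on `A \ X m` alone, as `y i` lies in the closure of that set.
      have h₃ := M.mem_closure_insert h₂ h₁
      refine hncl m hmm (M.closure_subset_closure_of_subset_closure ?_ h₃)
      refine Set.insert_subset (hym i hiD) ?_
      exact (fun z hz => M.subset_closure _ ((hA.sdiff _).subset_ground) hz.1)
    have hmA₁ : M.Indep A₁ := hi m hmm
    have h := ih (hinj.mono (by simp)) A₁ hmA₁ ?_ (fun i hiD j hjD => hyX i (hD i hiD) j (hD j hjD)) ?_ ?_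
    · refine h.subset ?_
      rintro z (⟨hzA, hz⟩ | ⟨i, hiD, rfl⟩)
      · simp only [Set.mem_iUnion, not_exists] at hz
        refine Or.inl ⟨Or.inr ⟨hzA, hz m hmm⟩, ?_⟩
        simp only [Set.mem_iUnion, not_exists]
        exact fun i hiD => hz i (hD i hiD)
      · rcases Finset.mem_insert.1 hiD with rfl | hiD
        · refine Or.inl ⟨Set.mem_insert _ _, ?_⟩
          simp only [Set.mem_iUnion, not_exists]
          exact fun j hjD => hyX i hmm j (hD j hjD)
        · exact Or.inr ⟨i, hiD, rfl⟩
    · rintro i hiD (h | h)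
      · exact hncl m hmm (h ▸ hym i hiD)
      · exact hyA i (hD i hiD) h.1
    · intro i hiD
      exact ((hmA₁.sdiff _).notMem_closure_iff (hyE i (hD i hiD)) |>.1 (hncl₁ i hiD)).1
    · intro i hiD j hjD hij
      -- Closure commutes with intersection for subsets of an independent set; this carries the
      -- closure condition over from `A` to `A₁`.
      have h₁ : y i ∈ M.closure ((A \ X j) ∩ (A \ X m)) := by
        rw [Indep.closure_inter_eq_inter_closure
          (hA.subset (Set.union_subset Set.sdiff_subset Set.sdiff_subset))]
        exact ⟨hcl i (hD i hiD) j (hD j hjD) hij, hym i hiD⟩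
      exact M.closure_subset_closure
        (show (A \ X j) ∩ (A \ X m) ⊆ A₁ \ X j from fun z hz => ⟨Or.inr hz.2, hz.1.2⟩) h₁

end Matroid

/-! ### Extending an optimal partial transversal by one color -/

namespace Transversal

variable {n : ℕ}

/-- The set of elements that represent the nodes `1, …, c - 1`. -/
noncomputable def repSet (n c : ℕ) (rep : ℤ → ℤ) : Finset (Fin n) :=
  open Classical in
  Finset.univ.filter fun u => ∃ g : ℕ, 1 ≤ g ∧ g < c ∧ rep g = ((u : ℕ) : ℤ)

theorem mem_repSet {c : ℕ} {rep : ℤ → ℤ} {u : Fin n} :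
    u ∈ repSet n c rep ↔ ∃ g : ℕ, 1 ≤ g ∧ g < c ∧ rep g = ((u : ℕ) : ℤ) := by
  simp [repSet]

/-- The set that consists of the representative of `h`; it is empty if `rep h` is not an element. -/
def repOf (n : ℕ) (rep : ℤ → ℤ) (h : ℕ) : Set (Fin n) := {u | rep h = ((u : ℕ) : ℤ)}

/-- `y` can replace the representative of `h`, or can be inserted if `h` has no representative. -/
def Arc (M : Matroid (Fin n)) (c : ℕ) (rep : ℤ → ℤ) (y : Fin n) (h : ℕ) : Prop :=
  y ∉ repSet n c rep ∧
    M.Indep (insert y ((repSet n c rep : Set (Fin n)) \ repOf n rep h))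

/-- The nodes `1, …, c - 1` have representatives, and these form an independent set. The node `0`
has none. -/
structure IsTransversal (M : Matroid (Fin n)) (node : Fin n → ℕ) (c : ℕ) (rep : ℤ → ℤ) : Prop where
  rep_zero : rep 0 = -1
  exists_rep : ∀ g : ℕ, 1 ≤ g → g < c → ∃ u : Fin n, rep g = ((u : ℕ) : ℤ) ∧ node u = g
  indep : M.Indep (repSet n c rep : Set (Fin n))

/-- The potential `π` certifies that the transversal has maximum weight. -/
structure IsDual (M : Matroid (Fin n)) (node : Fin n → ℕ) (w : ℤ → ℤ) (c : ℕ) (rep π : ℤ → ℤ) :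
    Prop where
  zero : π 0 = 0
  le : ∀ (y : Fin n) (h : ℕ), node y < c → h < c → Arc M c rep y h →
    w (y : ℕ) - π (node y) ≤ w (rep h) - π h

section

variable {M : Matroid (Fin n)} {node : Fin n → ℕ} {w : ℤ → ℤ} {c : ℕ} {rep π : ℤ → ℤ}

namespace IsTransversal

theorem eq_of_rep (hT : IsTransversal M node c rep) {g : ℕ} {u : Fin n} (hg : g < c)
    (hu : rep g = ((u : ℕ) : ℤ)) : 1 ≤ g ∧ node u = g := by
  rcases Nat.eq_zero_or_pos g with rfl | hpos
  · have := hT.rep_zero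
    simp only [Nat.cast_zero] at hu
    omega
  · obtain ⟨v, hv, hn⟩ := hT.exists_rep g hpos hg
    have : (u : ℕ) = v := by omega
    rw [Fin.ext this]
    exact ⟨hpos, hn⟩

theorem mem_repSet_iff (hT : IsTransversal M node c rep) {u : Fin n} :
    u ∈ repSet n c rep ↔ 1 ≤ node u ∧ node u < c ∧ rep (node u) = ((u : ℕ) : ℤ) := by
  rw [mem_repSet]
  constructor
  · rintro ⟨g, h₁, h₂, h₃⟩
    have := (hT.eq_of_rep h₂ h₃).2
    exact ⟨by omega, by omega, by rw [this, h₃]⟩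
  · exact fun h => ⟨_, h⟩

theorem repOf_subset (hT : IsTransversal M node c rep) {h : ℕ} (hh : h < c) :
    repOf n rep h ⊆ repSet n c rep := by
  intro u hu
  exact mem_repSet.2 ⟨h, (hT.eq_of_rep hh hu).1, hh, hu⟩

theorem repOf_zero (hT : IsTransversal M node c rep) : repOf n rep 0 = ∅ := by
  ext u
  have := hT.rep_zero
  simp only [repOf, Set.mem_ofPred_eq, Nat.cast_zero, Set.mem_empty_iff_false, iff_false]
  omega

theorem sum_repSet (hT : IsTransversal M node c rep) (f : ℕ → ℤ → ℤ) :
    ∑ u ∈ repSet n c rep, f (node u) (u : ℕ) = ∑ g ∈ Finset.Ico 1 c, f g (rep g) := by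
  refine Finset.sum_bij (fun u _ => node u) ?_ ?_ ?_ ?_
  · intro u hu
    rw [hT.mem_repSet_iff] at hu
    exact Finset.mem_Ico.2 ⟨hu.1, hu.2.1⟩
  · intro u hu v hv huv
    rw [hT.mem_repSet_iff] at hu hv
    have : ((u : ℕ) : ℤ) = (v : ℕ) := by rw [← hu.2.2, ← hv.2.2, huv]
    exact Fin.ext (by omega)
  · intro g hg
    rw [Finset.mem_Ico] at hg
    obtain ⟨u, hu, hn⟩ := hT.exists_rep g hg.1 hg.2
    exact ⟨u, mem_repSet.2 ⟨g, hg.1, hg.2, hu⟩, hn⟩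
  · intro u hu
    rw [hT.mem_repSet_iff] at hu
    rw [hu.2.2]

theorem card_repSet (hT : IsTransversal M node c rep) : (repSet n c rep).card = c - 1 := by
  have := hT.sum_repSet (fun _ _ => 1)
  simp only [Finset.sum_const, Nat.card_Ico, nsmul_eq_mul, mul_one] at this
  exact_mod_cast this

/-- If no arc from `B` improves `f`, then `B` has at most the weight of the transversal. -/
theorem sum_le_of_arcs (hT : IsTransversal M node c rep) (f : Fin n → ℤ) {B : Finset (Fin n)}
    (hB : M.Indep (B : Set (Fin n))) (hcard : c - 1 ≤ B.card)
    (h₀ : ∀ y ∈ B, Arc M c rep y 0 → f y ≤ 0)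
    (h₁ : ∀ y ∈ B, ∀ x : Fin n, 1 ≤ node x → node x < c → rep (node x) = ((x : ℕ) : ℤ) →
      Arc M c rep y (node x) → f y ≤ f x) :
    ∑ u ∈ B, f u ≤ ∑ u ∈ repSet n c rep, f u := by
  classical
  refine hT.indep.sum_le_sum_of_locally_optimal f _ B rfl hB (by rwa [hT.card_repSet]) ?_ ?_
  · intro y hy hyA hi
    exact h₀ y hy ⟨hyA, by rwa [hT.repOf_zero, Set.sdiff_empty]⟩
  · intro y hy hyA x hx hi
    rw [hT.mem_repSet_iff] at hx
    refine h₁ y hy x hx.1 hx.2.1 hx.2.2 ⟨hyA, ?_⟩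
    convert hi using 3
    ext u
    simp only [repOf, hx.2.2, Set.mem_ofPred_eq, Set.mem_singleton_iff, Nat.cast_inj]
    exact ⟨fun h => (Fin.ext h).symm, fun h => by rw [h]⟩

end IsTransversal

/-- The arc inequalities are local optimality for the reduced weight. The conventions `w (-1) = 0`
and `π 0 = 0` turn the inequality for an arc into the sink into the condition for inserting an
element. -/
theorem IsDual.sum_le (hD : IsDual M node w c rep π) (hT : IsTransversal M node c rep)
    (hw : w (-1) = 0) (hc : 1 ≤ c) {B : Finset (Fin n)} (hB : M.Indep (B : Set (Fin n)))
    (hcard : c - 1 ≤ B.card) (hnode : ∀ u ∈ B, node u < c) :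
    ∑ u ∈ B, (w (u : ℕ) - π (node u)) ≤ ∑ u ∈ repSet n c rep, (w (u : ℕ) - π (node u)) := by
  refine hT.sum_le_of_arcs _ hB hcard ?_ ?_
  · intro y hy hA
    have := hD.le y 0 (hnode y hy) (by omega) hA
    simpa [hT.rep_zero, hw, hD.zero] using this
  · intro y hy x _ hx hr hA
    have := hD.le y _ (hnode y hy) hx hA
    rwa [hr] at this

/-- At the end, `π` certifies optimality among all independent transversals. -/
theorem IsDual.isMax (hD : IsDual M node w c rep π) (hT : IsTransversal M node c rep)
    (hw : w (-1) = 0) (hc : 1 ≤ c) {B : Finset (Fin n)} (hB : M.Indep (B : Set (Fin n)))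
    (hbij : Set.BijOn node B (Finset.Ico 1 c)) :
    ∑ u ∈ B, w (u : ℕ) ≤ ∑ u ∈ repSet n c rep, w (u : ℕ) := by
  have himg : B.image node = Finset.Ico 1 c := by
    have := hbij.image_eq
    rw [← Finset.coe_image] at this
    exact_mod_cast this
  have hcard : B.card = c - 1 := by
    rw [← Finset.card_image_of_injOn hbij.injOn, himg, Nat.card_Ico]
  have h₁ := hD.sum_le hT hw hc hB hcard.ge
    (fun u hu => (Finset.mem_Ico.1 (by simpa using hbij.mapsTo hu)).2)
  -- All transversals carry the same total potential, so comparing reduced weights is comparing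
  -- weights.
  have h₂ : ∑ u ∈ B, π (node u) = ∑ g ∈ Finset.Ico 1 c, π g := by
    rw [← himg, Finset.sum_image hbij.injOn]
  have h₃ := hT.sum_repSet (fun g _ => π g)
  simp only [Finset.sum_sub_distrib] at h₁
  linarith

end

/-! ### The search for an augmenting path -/

/-- `Y g h` is an element of maximum weight among the elements of node `g` that can replace the
representative of `h`, or `-1` if there are none. -/
def IsBestArc (M : Matroid (Fin n)) (node : Fin n → ℕ) (w : ℤ → ℤ) (c : ℕ) (rep : ℤ → ℤ)
    (Y : ℕ → ℕ → ℤ) : Prop :=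
  ∀ g h : ℕ, 1 ≤ g → g ≤ c → h < c →
    (Y g h = -1 ∧ ∀ y : Fin n, node y = g → ¬ Arc M c rep y h) ∨
    ∃ y : Fin n, Y g h = ((y : ℕ) : ℤ) ∧ node y = g ∧ Arc M c rep y h ∧
      ∀ y' : Fin n, node y' = g → Arc M c rep y' h → w (y' : ℕ) ≤ w (y : ℕ)

/-- `mv` is the minimum slack of the arcs that enter `h` from nodes with positive label smaller
than `m`, and `pr` is the node with the smallest label from which an arc of this slack starts; `pr`
is `-1` if there are no such arcs. -/
def Labelled (M : Matroid (Fin n)) (node : Fin n → ℕ) (w : ℤ → ℤ) (c : ℕ) (rep : ℤ → ℤ)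
    (Y : ℕ → ℕ → ℤ) (π ord : ℤ → ℤ) (m : ℤ) (h : ℕ) (mv pr : ℤ) : Prop :=
  (pr = -1 ∧ ∀ y : Fin n, node y ≤ c → 0 < ord (node y) → ord (node y) < m →
    ¬ Arc M c rep y h) ∨
  ∃ y : Fin n, pr = node y ∧ node y ≤ c ∧ 0 < ord (node y) ∧ ord (node y) < m ∧
    Y (node y) h = ((y : ℕ) : ℤ) ∧ Arc M c rep y h ∧
    mv = (w (rep h) - π h) - (w (y : ℕ) - π (node y)) ∧
    ∀ y' : Fin n, node y' ≤ c → 0 < ord (node y') → ord (node y') < m → Arc M c rep y' h →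
      mv ≤ (w (rep h) - π h) - (w (y' : ℕ) - π (node y')) ∧
      (ord (node y') < ord (node y) → mv < (w (rep h) - π h) - (w (y' : ℕ) - π (node y')))

/-- The state of the search after `τ` nodes have been reached. The label `ord g` is the time at
which `g` has been reached, or `0`; `cur` is the node that has been reached last. -/
structure Search (M : Matroid (Fin n)) (node : Fin n → ℕ) (w : ℤ → ℤ) (c : ℕ) (rep : ℤ → ℤ)
    (Y : ℕ → ℕ → ℤ) (τ cur : ℕ) (π ord minv par : ℤ → ℤ) : Prop where
  cur_le : cur ≤ c
  ord_cur : ord cur = τ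
  ord_source : ord c = 1
  ord_nonneg : ∀ g : ℕ, g ≤ c → 0 ≤ ord g
  ord_le : ∀ g : ℕ, g ≤ c → ord g ≤ τ
  eq_cur : ∀ g : ℕ, g ≤ c → ord g = τ → g = cur
  ord_zero : cur ≠ 0 → ord 0 = 0
  pot_zero : π 0 = 0
  card : ((Finset.range (c + 1)).filter fun g : ℕ => ord g ≠ 0).card = τ
  le_of_lt : ∀ (y : Fin n) (h : ℕ), node y < c → h < c → Arc M c rep y h →
    w (y : ℕ) - π (node y) ≤ w (rep h) - π h
  le_of_source : ∀ (y : Fin n) (h : ℕ), node y = c → h < c → Arc M c rep y h →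
    τ ≠ 1 → w (y : ℕ) - π (node y) ≤ w (rep h) - π h
  unreached : ∀ h : ℕ, h < c → ord h = 0 →
    Labelled M node w c rep Y π ord τ h (minv h) (par h)
  reached : ∀ h : ℕ, h < c → ord h ≠ 0 → ∃ y : Fin n, par h = node y ∧ node y ≤ c ∧
    0 < ord (node y) ∧ ord (node y) < ord h ∧ Y (node y) h = ((y : ℕ) : ℤ) ∧ Arc M c rep y h ∧
    w (y : ℕ) - π (node y) = w (rep h) - π h ∧
    ∀ y' : Fin n, node y' ≤ c → 0 < ord (node y') → ord (node y') < ord (node y) →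
      Arc M c rep y' h → w (y' : ℕ) - π (node y') < w (rep h) - π h

section

variable {M : Matroid (Fin n)} {node : Fin n → ℕ} {w : ℤ → ℤ} {c : ℕ} {rep π : ℤ → ℤ}
  {Y : ℕ → ℕ → ℤ} {τ cur : ℕ} {ord minv par : ℤ → ℤ}

/-- The potential of the source `c` may be arbitrary, because arcs leaving `c` are subject to the
dual inequality only after the first step. The initial slacks are arbitrary too: `par h = -1` says
that there is none. -/
theorem search_init (hc : 1 ≤ c) (hD : IsDual M node w c rep π) (ho : ord c = 1)
    (h₀ : ∀ h : ℕ, h < c → ord h = 0) (hp : ∀ h : ℕ, h < c → par h = -1) :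
    Search M node w c rep Y 1 c π ord minv par where
  cur_le := le_rfl
  ord_cur := by simpa using ho
  ord_source := ho
  ord_nonneg g hg := by
    rcases hg.lt_or_eq with h | rfl
    · rw [h₀ g h]
    · rw [ho]; norm_num
  ord_le g hg := by
    rcases hg.lt_or_eq with h | rfl
    · rw [h₀ g h]; norm_num
    · rw [ho]; norm_num
  eq_cur g hg h1 := by
    rcases hg.lt_or_eq with h | rfl
    · rw [h₀ g h] at h1; norm_num at h1
    · rfl
  ord_zero _ := by simpa using h₀ 0 (by omega)
  pot_zero := hD.zero
  card := by
    rw [Finset.card_eq_one]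
    refine ⟨c, ?_⟩
    ext g
    simp only [Finset.mem_filter, Finset.mem_range, Finset.mem_singleton]
    constructor
    · rintro ⟨h1, h2⟩
      by_contra hne
      exact h2 (h₀ g (by omega))
    · rintro rfl
      exact ⟨by omega, by rw [ho]; norm_num⟩
  le_of_lt := hD.le
  le_of_source _ _ _ _ _ h := absurd rfl h
  unreached h hh _ := by
    refine Or.inl ⟨hp h hh, fun y _ h1 h2 _ => ?_⟩
    norm_num at h2
    omega
  reached h hh h1 := absurd (h₀ h hh) h1

/-- Raising the bound from `m` to `m + 1` admits only arcs from `g`, and none of them enters `h`. -/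
theorem Labelled.relax_none {m : ℤ} {h : ℕ} {mv pr : ℤ} {g : ℕ}
    (hL : Labelled M node w c rep Y π ord m h mv pr)
    (hg : ∀ g' : ℕ, g' ≤ c → ord g' = m → g' = g)
    (hno : ∀ y : Fin n, node y = g → ¬ Arc M c rep y h) :
    Labelled M node w c rep Y π ord (m + 1) h mv pr := by
  rcases hL with ⟨h1, h2⟩ | ⟨y, h1, h2, h3, h4, h5, h6, h7, h8⟩
  · refine Or.inl ⟨h1, fun y hy hp hlt hA => ?_⟩
    rcases (Int.lt_add_one_iff.1 hlt).lt_or_eq with hlt | heq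
    · exact h2 y hy hp hlt hA
    · exact hno y (hg _ hy heq) hA
  · refine Or.inr ⟨y, h1, h2, h3, by omega, h5, h6, h7, fun y' hy hp hlt hA => ?_⟩
    rcases (Int.lt_add_one_iff.1 hlt).lt_or_eq with hlt | heq
    · exact h8 y' hy hp hlt hA
    · exact absurd hA (hno y' (hg _ hy heq))

/-- The effect on the label of `h` of considering the arcs that start at the node `g` of label
`m`. -/
theorem Labelled.relax {m : ℤ} {h : ℕ} {mv pr : ℤ} {g : ℕ}
    (hL : Labelled M node w c rep Y π ord m h mv pr) (hY : IsBestArc M node w c rep Y)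
    (hgc : g ≤ c) (hg1 : 1 ≤ g) (hh : h < c) (hm : 0 < m) (hgm : ord g = m)
    (hg : ∀ g' : ℕ, g' ≤ c → ord g' = m → g' = g) :
    (0 ≤ Y g h ∧ (pr < 0 ∨ π g - π h + w (rep h) - w (Y g h) < mv) →
      Labelled M node w c rep Y π ord (m + 1) h (π g - π h + w (rep h) - w (Y g h)) g) ∧
    (¬ (0 ≤ Y g h ∧ (pr < 0 ∨ π g - π h + w (rep h) - w (Y g h) < mv)) →
      Labelled M node w c rep Y π ord (m + 1) h mv pr) := by
  rcases hY g h hg1 hgc hh with ⟨hY, hno⟩ | ⟨y, hY, hyg, hyA, hmax⟩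
  · refine ⟨fun hcon => ?_, fun _ => hL.relax_none hg hno⟩
    rw [hY] at hcon
    omega
  · subst hyg
    rw [hY]
    constructor
    · rintro ⟨-, hcase⟩
      refine Or.inr ⟨y, rfl, hgc, by omega, by omega, hY, hyA, by ring, ?_⟩
      intro y' hy' hp hlt hA
      -- A label is overwritten only by a strictly smaller slack. Hence every older node has
      -- strictly larger slack than the new parent; this is the tie-breaking on which the
      -- triangularity of the exchanges depends.
      have hstrict : ord (node y') < ord (node y) → π (node y) - π h + w (rep h) - w (y : ℕ) <
          w (rep h) - π h - (w (y' : ℕ) - π (node y')) := by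
        intro hlt'
        rcases hL with ⟨_, h2⟩ | ⟨z, h1, h2, h3, h4, h5, h6, h7, h8⟩
        · exact absurd hA (h2 y' hy' hp (by omega))
        · have := (h8 y' hy' hp (by omega) hA).1
          rcases hcase with hneg | hlt''
          · omega
          · omega
      refine ⟨?_, hstrict⟩
      rcases (Int.lt_add_one_iff.1 hlt).lt_or_eq with hlt | heq
      · exact (hstrict (by omega)).le
      · have hn := hg _ hy' heq
        have := hmax y' hn hA
        rw [hn]
        omega
    · intro hcase
      have hcase' : 0 ≤ pr ∧ mv ≤ π (node y) - π h + w (rep h) - w (y : ℕ) := by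
        constructor
        · by_contra hcon
          exact hcase ⟨by omega, Or.inl (by omega)⟩
        · by_contra hcon
          exact hcase ⟨by omega, Or.inr (by omega)⟩
      rcases hL with ⟨h1, h2⟩ | ⟨z, h1, h2, h3, h4, h5, h6, h7, h8⟩
      · omega
      · refine Or.inr ⟨z, h1, h2, h3, by omega, h5, h6, h7, fun y' hy hp hlt hA => ?_⟩
        rcases (Int.lt_add_one_iff.1 hlt).lt_or_eq with hlt | heq
        · exact h8 y' hy hp hlt hA
        · have hn := hg _ hy heq
          have := hmax y' hn hA
          refine ⟨?_, fun hcon => ?_⟩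
          · rw [hn]; omega
          · omega

/-- If no arc leaves the set of nodes that have been reached, there is no independent
transversal. -/
theorem Search.no_transversal (hT : IsTransversal M node c rep)
    (hS : Search M node w c rep Y τ cur π ord minv par) (hcur : cur ≠ 0) (hc : 1 ≤ c)
    (hno : ∀ h : ℕ, h < c → ord h = 0 → ∀ y : Fin n, node y ≤ c → 0 < ord (node y) →
      ¬ Arc M c rep y h) (B : Finset (Fin n)) (hB : M.Indep (B : Set (Fin n)))
    (hbij : Set.BijOn node B (Finset.Ico 1 (c + 1))) : False := by
  have himg : B.image node = Finset.Ico 1 (c + 1) := by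
    have := hbij.image_eq
    rw [← Finset.coe_image] at this
    exact_mod_cast this
  have hnode : ∀ u ∈ B, 1 ≤ node u ∧ node u < c + 1 := fun u hu =>
    Finset.mem_Ico.1 (by simpa using hbij.mapsTo hu)
  have hcard : B.card = c := by
    rw [← Finset.card_image_of_injOn hbij.injOn, himg, Nat.card_Ico]; omega
  -- Take the indicator of the reached nodes as a weight. No arc leads from a reached to an
  -- unreached node, so the current transversal is locally optimal for `φ`; but `B` also covers `c`,
  -- where `φ` is `1`, and would be heavier.
  set φ : ℕ → ℤ := fun g => if 0 < ord g then 1 else 0 with hφ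
  have hφ0 : ∀ g, 0 ≤ φ g := fun g => by simp only [hφ]; split_ifs <;> norm_num
  have key := hT.sum_le_of_arcs (fun u => φ (node u)) hB (by omega) ?_ ?_
  · have h₁ : ∑ u ∈ B, φ (node u) = ∑ g ∈ Finset.Ico 1 (c + 1), φ g := by
      rw [← himg, Finset.sum_image hbij.injOn]
    have h₂ := hT.sum_repSet (fun g _ => φ g)
    rw [h₁, h₂, Finset.sum_Ico_succ_top hc] at key
    have h₃ : φ c = 1 := by simp [hφ, hS.ord_source]
    omega
  · intro y hy hA
    have : ¬ 0 < ord (node y) := fun hp =>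
      hno 0 (by omega) (by simpa using hS.ord_zero hcur) y (by have := hnode y hy; omega) hp hA
    simp [hφ, this]
  · intro y hy x hx1 hx2 _ hA
    by_cases hp : 0 < ord (node y)
    · have : ord (node x) ≠ 0 := fun h0 =>
        hno _ hx2 h0 y (by have := hnode y hy; omega) hp hA
      have h0 := hS.ord_nonneg (node x) (by omega)
      simp only [hφ, hp, if_true]
      rw [if_pos (by omega)]
    · simp only [hφ, hp, if_false]
      exact hφ0 _

/-- One step of the search: the node `b` of minimum slack is reached. -/
theorem Search.step (hS : Search M node w c rep Y τ cur π ord minv par) (hcur : cur ≠ 0)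
    {minv' par' π' ord' minv'' : ℤ → ℤ} {b : ℕ}
    (hL : ∀ h : ℕ, h < c → ord h = 0 →
      Labelled M node w c rep Y π ord (τ + 1) h (minv' h) (par' h))
    (hpar : ∀ h : ℕ, h < c → ord h ≠ 0 → par' h = par h)
    (hb : b < c) (hb0 : ord b = 0) (hbp : 0 ≤ par' b)
    (hmin : ∀ h : ℕ, h < c → ord h = 0 → 0 ≤ par' h → minv' b ≤ minv' h)
    (hπ0 : ∀ h : ℕ, h ≤ c → ord h = 0 → π' h = π h)
    (hπ1 : ∀ h : ℕ, h ≤ c → ord h ≠ 0 → π' h = π h - minv' b)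
    (hmv : ∀ h : ℕ, h < c → ord h = 0 → minv'' h = minv' h - minv' b)
    (hob : ord' b = τ + 1) (ho : ∀ h : ℕ, h ≤ c → h ≠ b → ord' h = ord h) :
    Search M node w c rep Y (τ + 1) b π' ord' minv'' par' := by
  have hτ : 1 ≤ τ := by
    have h1 := hS.ord_source
    have h2 := hS.ord_le c le_rfl
    omega
  have hbc : b ≠ c := hb.ne
  have hpos : ∀ g : ℕ, g ≤ c → ord g ≠ 0 → 0 < ord g := fun g hg h =>
    lt_of_le_of_ne (hS.ord_nonneg g hg) (Ne.symm h)
  have hslack : ∀ (y : Fin n) (h : ℕ), node y ≤ c → h < c → ord (node y) ≠ 0 → ord h = 0 →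
      Arc M c rep y h → minv' b ≤ (w (rep h) - π h) - (w (y : ℕ) - π (node y)) := by
    intro y h hy hh h1 h2 hA
    have hlt : ord (node y) < τ + 1 := by have := hS.ord_le _ hy; omega
    rcases hL h hh h2 with ⟨_, h4⟩ | ⟨z, g1, g2, g3, g4, g5, g6, g7, g8⟩
    · exact absurd hA (h4 y hy (hpos _ hy h1) hlt)
    · exact (hmin h hh h2 (by omega)).trans (g8 y hy (hpos _ hy h1) hlt hA).1
  -- At time `1` only the source has been reached. This is the only step in which the shift can be
  -- negative, since the potential of `c` was arbitrary; no arc into `c` is considered, so nothing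
  -- is violated.
  have hone : ∀ h : ℕ, h < c → ord h ≠ 0 → τ ≠ 1 := by
    rintro h hh h1 rfl
    have h2 := hS.ord_le h hh.le
    have h3 := hpos h hh.le h1
    have h4 := hS.eq_cur h hh.le (by push_cast at h2 ⊢; omega)
    have h5 := hS.eq_cur c le_rfl (by simpa using hS.ord_source)
    omega
  have hdual : ∀ (y : Fin n) (h : ℕ), node y ≤ c → h < c → Arc M c rep y h → τ ≠ 1 →
      w (y : ℕ) - π (node y) ≤ w (rep h) - π h := by
    intro y h hy hh hA h1
    rcases hy.lt_or_eq with hy | hy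
    · exact hS.le_of_lt y h hy hh hA
    · exact hS.le_of_source y h hy hh hA h1
  obtain ⟨z, z1, z2, z3, z4, z5, z6, z7, z8⟩ :
      ∃ y : Fin n, par' b = node y ∧ node y ≤ c ∧ 0 < ord (node y) ∧ ord (node y) < (τ : ℤ) + 1 ∧
        Y (node y) b = ((y : ℕ) : ℤ) ∧ Arc M c rep y b ∧
        minv' b = (w (rep b) - π b) - (w (y : ℕ) - π (node y)) ∧
        ∀ y' : Fin n, node y' ≤ c → 0 < ord (node y') → ord (node y') < (τ : ℤ) + 1 →
          Arc M c rep y' b →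
          minv' b ≤ (w (rep b) - π b) - (w (y' : ℕ) - π (node y')) ∧
          (ord (node y') < ord (node y) →
            minv' b < (w (rep b) - π b) - (w (y' : ℕ) - π (node y'))) := by
    rcases hL b hb hb0 with ⟨h1, _⟩ | h
    · omega
    · exact h
  have hδ : τ ≠ 1 → 0 ≤ minv' b := by
    intro h1
    have := hdual z b z2 hb z6 h1
    omega
  -- Shifting the reached nodes by `δ = minv' b` affects only arcs between reached and unreached
  -- nodes. Arcs from reached to unreached nodes lose `δ` of their slack, and `δ` is the least such
  -- slack; arcs in the other direction gain `δ`.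
  have hall : ∀ (y : Fin n) (h : ℕ), node y ≤ c → (node y = c ∨ node y < c) → h < c →
      Arc M c rep y h → w (y : ℕ) - π' (node y) ≤ w (rep h) - π' h := by
    intro y h hy hy' hh hA
    by_cases h1 : ord (node y) = 0
    · rw [hπ0 _ hy h1]
      have hlt : node y < c := by
        rcases hy' with h2 | h2
        · rw [h2, hS.ord_source] at h1
          omega
        · exact h2
      have hle := hS.le_of_lt y h hlt hh hA
      by_cases h2 : ord h = 0
      · rw [hπ0 _ hh.le h2]
        exact hle
      · rw [hπ1 _ hh.le h2]
        have := hδ (hone h hh h2)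
        omega
    · rw [hπ1 _ hy h1]
      by_cases h2 : ord h = 0
      · rw [hπ0 _ hh.le h2]
        have := hslack y h hy hh h1 h2 hA
        omega
      · rw [hπ1 _ hh.le h2]
        have := hdual y h hy hh hA (hone h hh h2)
        omega
  have hord : ∀ g : ℕ, g ≤ c → 0 < ord' g → ord' g < (τ : ℤ) + 1 → ord' g = ord g ∧ ord g ≠ 0 := by
    intro g hg h1 h2
    by_cases hgb : g = b
    · subst hgb
      omega
    · have := ho g hg hgb
      exact ⟨this, by omega⟩
  have hzb : node z ≠ b := by
    intro e
    rw [e] at z3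
    omega
  have hoz : ord' (node z) = ord (node z) := ho _ z2 hzb
  constructor
  · exact hb.le
  · rw [hob]; push_cast; ring
  · rw [ho c le_rfl hbc.symm, hS.ord_source]
  · intro g hg
    by_cases hgb : g = b
    · subst hgb; rw [hob]; omega
    · rw [ho g hg hgb]; exact hS.ord_nonneg g hg
  · intro g hg
    by_cases hgb : g = b
    · subst hgb; rw [hob]; push_cast; omega
    · rw [ho g hg hgb]; have := hS.ord_le g hg; push_cast; omega
  · intro g hg h
    by_contra hgb
    rw [ho g hg hgb] at h
    have := hS.ord_le g hg
    push_cast at h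
    omega
  · intro hb0'
    have := ho 0 (by omega) (Ne.symm hb0')
    simp only [Nat.cast_zero] at this
    rw [this, hS.ord_zero hcur]
  · have h0 := hS.ord_zero hcur
    have := hπ0 0 (by omega) (by simpa using h0)
    simp only [Nat.cast_zero] at this
    rw [this, hS.pot_zero]
  · have : (Finset.range (c + 1)).filter (fun g : ℕ => ord' g ≠ 0) =
        insert b ((Finset.range (c + 1)).filter fun g : ℕ => ord g ≠ 0) := by
      ext g
      simp only [Finset.mem_filter, Finset.mem_range, Finset.mem_insert]
      by_cases hgb : g = b
      · subst hgb
        simp only [true_or, iff_true]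
        exact ⟨by omega, by omega⟩
      · constructor
        · rintro ⟨h1, h2⟩
          rw [ho g (by omega) hgb] at h2
          exact Or.inr ⟨h1, h2⟩
        · rintro (h | ⟨h1, h2⟩)
          · exact absurd h hgb
          · rw [← ho g (by omega) hgb] at h2
            exact ⟨h1, h2⟩
    rw [this, Finset.card_insert_of_notMem (by simp [hb0]), hS.card]
  · exact fun y h hy hh hA => hall y h hy.le (Or.inr hy) hh hA
  · exact fun y h hy hh hA _ => hall y h hy.le (Or.inl hy) hh hA
  · intro h hh h0
    have hhb : h ≠ b := by
      rintro rfl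
      omega
    rw [ho h hh.le hhb] at h0
    push_cast
    rcases hL h hh h0 with ⟨h1, h2⟩ | ⟨y, h1, h2, h3, h4, h5, h6, h7, h8⟩
    · refine Or.inl ⟨h1, fun y' hy' hp hlt => ?_⟩
      obtain ⟨e, _⟩ := hord _ hy' hp hlt
      rw [e] at hp hlt
      exact h2 y' hy' hp hlt
    · have hyb : node y ≠ b := by
        intro e
        rw [e] at h3
        omega
      have hoy := ho _ h2 hyb
      refine Or.inr ⟨y, h1, h2, by omega, by omega, h5, h6, ?_, ?_⟩
      · rw [hmv h hh h0, hπ0 h hh.le h0, hπ1 _ h2 (by omega)]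
        omega
      · intro y' hy' hp hlt hA
        obtain ⟨e, e'⟩ := hord _ hy' hp hlt
        rw [e] at hp hlt
        have := h8 y' hy' hp hlt hA
        rw [hmv h hh h0, hπ0 h hh.le h0, hπ1 _ hy' e', hoy, e]
        refine ⟨by omega, fun hlt' => ?_⟩
        have := this.2 hlt'
        omega
  · intro h hh h0
    by_cases hhb : h = b
    · subst hhb
      -- The arc that attains the minimum becomes tight. As `z` belongs to the earliest node
      -- attaining it, arcs into `h` from earlier nodes keep positive slack.
      refine ⟨z, z1, z2, by omega, by omega, z5, z6, ?_, ?_⟩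
      · rw [hπ0 h hh.le hb0, hπ1 _ z2 (by omega)]
        omega
      · intro y' hy' hp hlt hA
        obtain ⟨e, e'⟩ := hord _ hy' hp (by omega)
        rw [hπ0 h hh.le hb0, hπ1 _ hy' e']
        have := (z8 y' hy' (by omega) (by omega) hA).2 (by omega)
        omega
    · have hoh := ho h hh.le hhb
      rw [hoh] at h0
      obtain ⟨y, h1, h2, h3, h4, h5, h6, h7, h8⟩ := hS.reached h hh h0
      have hyb : node y ≠ b := by
        intro e
        rw [e] at h3
        omega
      have hoy := ho _ h2 hyb
      have hle := hS.ord_le _ h2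
      refine ⟨y, by rw [hpar h hh h0, h1], h2, by omega, by omega, h5, h6, ?_, ?_⟩
      · rw [hπ1 _ h2 (by omega), hπ1 _ hh.le h0]
        omega
      · intro y' hy' hp hlt hA
        obtain ⟨e, e'⟩ := hord _ hy' hp (by omega)
        rw [hπ1 _ hy' e', hπ1 _ hh.le h0]
        have := h8 y' hy' (by omega) (by omega) hA
        omega

end

end Transversal

/-! ### Augmentation -/

namespace Transversal

variable {n : ℕ}

/-- The state of the walk back from the sink `0` along `par`. The nodes of `D` have been left, `h`
is the current node, and `rep'` results from `rep` by the exchanges along the path. -/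
structure Walk (c : ℕ) (rep : ℤ → ℤ) (Y : ℕ → ℕ → ℤ) (ord par : ℤ → ℤ) (h : ℕ) (D : Finset ℕ)
    (rep' : ℤ → ℤ) : Prop where
  le : h ≤ c
  ord_ne : ord h ≠ 0
  lt_of_mem : ∀ d ∈ D, d < c
  ord_ne_of_mem : ∀ d ∈ D, ord d ≠ 0
  ord_lt : ∀ d ∈ D, ord h < ord d
  injOn : Set.InjOn (fun d : ℕ => ord d) D
  insert_eq : insert h D = insert 0 (D.image fun d : ℕ => (par d).toNat)
  par_injOn : Set.InjOn (fun d : ℕ => (par d).toNat) D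
  ord_le_par : ∀ d ∈ D, ord h ≤ ord (par d)
  chain : ∀ d ∈ D, ∀ d' ∈ D, ord d < ord d' → ord d ≤ ord (par d')
  rep_par : ∀ d ∈ D, rep' (par d) = Y (par d).toNat d
  rep_eq : ∀ g : ℕ, g ∉ D.image (fun d : ℕ => (par d).toNat) → rep' g = rep g

section

variable {M : Matroid (Fin n)} {node : Fin n → ℕ} {w : ℤ → ℤ} {c : ℕ} {rep π : ℤ → ℤ}
  {Y : ℕ → ℕ → ℤ} {τ cur : ℕ} {ord minv par : ℤ → ℤ}

theorem Search.walk_init (hS : Search M node w c rep Y τ 0 π ord minv par) (hc : 1 ≤ c) :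
    Walk c rep Y ord par 0 ∅ rep where
  le := by omega
  ord_ne := by
    have h1 := hS.ord_cur
    have h2 := hS.ord_le c le_rfl
    have h3 := hS.ord_source
    omega
  lt_of_mem := by simp
  ord_ne_of_mem := by simp
  ord_lt := by simp
  injOn := by simp
  insert_eq := by simp
  par_injOn := by simp
  ord_le_par := by simp
  chain := by simp
  rep_par := by simp
  rep_eq := by simp

/-- Labels decrease strictly along `par`, so the walk meets no node twice. It can stop only at `c`,
the one reached node that has no parent. -/
theorem Search.walk_step (hS : Search M node w c rep Y τ 0 π ord minv par)
    (hnode : ∀ u, 1 ≤ node u) {h : ℕ} {D : Finset ℕ} {rep' : ℤ → ℤ}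
    (hW : Walk c rep Y ord par h D rep') (hne : h ≠ c) :
    ∃ g : ℕ, par h = g ∧ 1 ≤ g ∧ g ≤ c ∧ 0 < ord g ∧ ord g < ord h ∧
      Walk c rep Y ord par g (insert h D) (Function.update rep' g (Y g h)) := by
  have hhc : h < c := lt_of_le_of_ne hW.le hne
  obtain ⟨y, h1, h2, h3, h4, -⟩ := hS.reached h hhc hW.ord_ne
  have hg : (par h).toNat = node y := by rw [h1]; rfl
  have hhD : h ∉ D := fun hm => lt_irrefl _ (hW.ord_lt h hm)
  have hnot : node y ∉ D.image fun d : ℕ => (par d).toNat := by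
    intro hm
    obtain ⟨d, hd, he⟩ := Finset.mem_image.1 hm
    obtain ⟨z, z1, -⟩ := hS.reached d (hW.lt_of_mem d hd) (hW.ord_ne_of_mem d hd)
    have h5 := hW.ord_le_par d hd
    rw [z1] at he h5
    simp only [Int.toNat_natCast] at he
    rw [he] at h5
    omega
  refine ⟨node y, h1, hnode y, h2, h3, h4, ?_⟩
  constructor
  · exact h2
  · omega
  · exact fun d hd => (Finset.mem_insert.1 hd).elim (fun e => e ▸ hhc) (hW.lt_of_mem d)
  · exact fun d hd => (Finset.mem_insert.1 hd).elim (fun e => e ▸ hW.ord_ne) (hW.ord_ne_of_mem d)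
  · intro d hd
    rcases Finset.mem_insert.1 hd with rfl | hd
    · exact h4
    · exact h4.trans (hW.ord_lt d hd)
  · rw [Finset.coe_insert, Set.injOn_insert (by simpa using hhD)]
    refine ⟨hW.injOn, ?_⟩
    rintro ⟨d, hd, he⟩
    have := hW.ord_lt d hd
    simp only at he
    omega
  · rw [Finset.image_insert, hg, hW.insert_eq, Finset.insert_comm]
  · rw [Finset.coe_insert, Set.injOn_insert (by simpa using hhD)]
    refine ⟨hW.par_injOn, ?_⟩
    simp only [hg]
    intro hm
    apply hnot
    simpa using hm
  · intro d hd
    rcases Finset.mem_insert.1 hd with rfl | hd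
    · rw [h1]
    · exact h4.le.trans (hW.ord_le_par d hd)
  · intro d hd d' hd' hlt
    rcases Finset.mem_insert.1 hd with rfl | hdD
    · rcases Finset.mem_insert.1 hd' with rfl | hdD'
      · exact absurd hlt (lt_irrefl _)
      · exact hW.ord_le_par d' hdD'
    · rcases Finset.mem_insert.1 hd' with rfl | hdD'
      · exact absurd hlt (by have := hW.ord_lt d hdD; omega)
      · exact hW.chain d hdD d' hdD' hlt
  · intro d hd
    rcases Finset.mem_insert.1 hd with rfl | hd
    · rw [h1]; simp
    · obtain ⟨z, z1, -⟩ := hS.reached d (hW.lt_of_mem d hd) (hW.ord_ne_of_mem d hd)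
      have hzy : node z ≠ node y := by
        intro e
        exact hnot (Finset.mem_image.2 ⟨d, hd, by rw [z1]; simpa using e⟩)
      rw [← hW.rep_par d hd, z1, Function.update_of_ne (by exact_mod_cast hzy)]
  · intro g hg'
    rw [Finset.image_insert, hg, Finset.mem_insert, not_or] at hg'
    rw [Function.update_of_ne (by exact_mod_cast hg'.1), hW.rep_eq g hg'.2]

/-- The exchanges along the path produce an optimal transversal for one more color. -/
theorem Search.augment (hT : IsTransversal M node c rep)
    (hS : Search M node w c rep Y τ 0 π ord minv par) (hw : w (-1) = 0) (hc : 1 ≤ c)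
    (hnode : ∀ u, 1 ≤ node u) {D : Finset ℕ} {rep' : ℤ → ℤ}
    (hW : Walk c rep Y ord par c D rep') :
    IsTransversal M node (c + 1) rep' ∧ IsDual M node w (c + 1) rep' π := by
  classical
  -- The sink is not the source, so at least one step has been made and the arcs leaving `c` satisfy
  -- the dual inequality as well.
  have hτ : τ ≠ 1 := by
    rintro rfl
    have := hS.eq_cur c le_rfl (by simpa using hS.ord_source)
    omega
  have hD : ∀ d ∈ D, ∃ y : Fin n, par d = node y ∧ node y ≤ c ∧
    0 < ord (node y) ∧ ord (node y) < ord d ∧ Y (node y) d = ((y : ℕ) : ℤ) ∧ Arc M c rep y d ∧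
    w (y : ℕ) - π (node y) = w (rep d) - π d ∧
    ∀ y' : Fin n, node y' ≤ c → 0 < ord (node y') → ord (node y') < ord (node y) →
      Arc M c rep y' d → w (y' : ℕ) - π (node y') < w (rep d) - π d :=
    fun d hd => hS.reached d (hW.lt_of_mem d hd) (hW.ord_ne_of_mem d hd)
  have hdual : ∀ (y : Fin n) (h : ℕ), node y ≤ c → h < c → Arc M c rep y h →
      w (y : ℕ) - π (node y) ≤ w (rep h) - π h := by
    intro y h hy hh hA
    rcases hy.lt_or_eq with hy | hy
    · exact hS.le_of_lt y h hy hh hA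
    · exact hS.le_of_source y h hy hh hA hτ
  have hn : Nonempty (Fin n) := by
    have h0 : 0 ∈ insert c D := by rw [hW.insert_eq]; exact Finset.mem_insert_self _ _
    rcases Finset.mem_insert.1 h0 with h | h
    · omega
    · exact ⟨(hD 0 h).choose⟩
  choose! y hy using hD
  set p : ℕ → ℕ := fun d => (par d).toNat with hp
  have hpy : ∀ d ∈ D, p d = node (y d) := fun d hd => by simp [hp, (hy d hd).1]
  have hrepD : ∀ d ∈ D, rep' (p d) = ((y d : ℕ) : ℤ) := by
    intro d hd
    have h1 := hW.rep_par d hd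
    have h2 := (hy d hd).2.2.2.2.1
    rw [(hy d hd).1, Int.toNat_natCast, h2] at h1
    rw [hpy d hd, h1]
  have hcimg : c ∈ D.image p := by
    have h0 : c ∈ insert c D := Finset.mem_insert_self _ _
    rw [hW.insert_eq] at h0
    rcases Finset.mem_insert.1 h0 with h | h
    · omega
    · exact h
  have hzero : 0 ∉ D.image p := by
    intro h
    obtain ⟨d, hd, he⟩ := Finset.mem_image.1 h
    have := hnode (y d)
    rw [hpy d hd] at he
    omega
  have hyA : ∀ d ∈ D, y d ∉ repSet n c rep := fun d hd => (hy d hd).2.2.2.2.2.1.1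
  have hT' : IsTransversal M node (c + 1) rep' := by
    have hrep : ∀ g : ℕ, 1 ≤ g → g < c + 1 →
        ∃ u : Fin n, rep' g = ((u : ℕ) : ℤ) ∧ node u = g := by
      intro g h1 h2
      by_cases hg : g ∈ D.image p
      · obtain ⟨d, hd, rfl⟩ := Finset.mem_image.1 hg
        exact ⟨y d, hrepD d hd, (hpy d hd).symm⟩
      · rw [hW.rep_eq g hg]
        have : g ≠ c := fun e => hg (e ▸ hcimg)
        exact hT.exists_rep g h1 (by omega)
    refine ⟨?_, hrep, ?_⟩
    · have := hW.rep_eq 0 hzero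
      simp only [Nat.cast_zero] at this
      rw [this, hT.rep_zero]
    -- The exchanges are ordered by decreasing reduced value of the replaced representative, ties by
    -- increasing label. An arc from `y i` to a later `j` violates the dual inequality if the value
    -- drops; if the values agree, it is a tight arc into `j` from a node with a smaller label than
    -- the parent of `j`, which the choice of the parent excludes.
    · have htri := Matroid.Indep.indep_of_triangular_exchange (M := M)
        (fun d : ℕ => toLex (-(w (rep d) - π d), ord d)) (fun d => repOf n rep d) y D ?_
        (repSet n c rep) hT.indep ?_ ?_ ?_ ?_
      · refine htri.subset ?_
        intro u hu
        obtain ⟨g, h1, h2, h3⟩ := mem_repSet.1 hu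
        by_cases hg : g ∈ D.image p
        · obtain ⟨d, hd, rfl⟩ := Finset.mem_image.1 hg
          rw [hrepD d hd] at h3
          exact Or.inr ⟨d, hd, Fin.ext (by exact_mod_cast h3)⟩
        · rw [hW.rep_eq g hg] at h3
          have hgc : g ≠ c := fun e => hg (e ▸ hcimg)
          refine Or.inl ⟨mem_repSet.2 ⟨g, h1, by omega, h3⟩, ?_⟩
          simp only [Set.mem_iUnion, not_exists]
          intro d hd hud
          have hd1 := hT.eq_of_rep (hW.lt_of_mem d hd) hud
          have hg1 := hT.eq_of_rep (by omega : g < c) h3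
          have hdg : d = g := by omega
          have h4 : d ∈ insert c D := Finset.mem_insert_of_mem hd
          rw [hW.insert_eq, hdg] at h4
          rcases Finset.mem_insert.1 h4 with h | h
          · omega
          · exact hg h
      · intro d hd d' hd' he
        have := congrArg (fun x => (ofLex x).2) he
        exact hW.injOn hd hd' this
      · exact hyA
      · exact fun i hi j hj h => hyA i hi (hT.repOf_subset (hW.lt_of_mem j hj) h)
      · exact fun i hi => (hy i hi).2.2.2.2.2.1.2
      · intro i hi j hj hlt
        obtain ⟨a1, a2, a3, a4, a5, a6, a7, a8⟩ := hy i hi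
        obtain ⟨b1, b2, b3, b4, b5, b6, b7, b8⟩ := hy j hj
        by_contra hcl
        have hE : y i ∈ M.E := a6.2.subset_ground (Set.mem_insert _ _)
        have hA : Arc M c rep (y i) j :=
          ⟨a6.1, ((hT.indep.sdiff _).notMem_closure_iff hE).1 hcl |>.1⟩
        have h1 := hdual _ _ a2 (hW.lt_of_mem j hj) hA
        rw [Prod.Lex.toLex_lt_toLex] at hlt
        simp only at hlt
        rcases hlt with hlt | ⟨heq, hlt⟩
        · omega
        · have h2 := hW.chain i hi j hj hlt
          rw [b1] at h2
          have h3 := b8 (y i) a2 a3 (by omega) hA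
          omega
  refine ⟨hT', hS.pot_zero, ?_⟩
  -- All arcs of the path are tight, its heads and tails differ only in `0` and `c`, and the sink
  -- has reduced value `0`. Hence the reduced weight does not change although the set has grown.
  have hval : ∑ u ∈ repSet n (c + 1) rep', (w (u : ℕ) - π (node u)) =
      ∑ u ∈ repSet n c rep, (w (u : ℕ) - π (node u)) := by
    rw [hT'.sum_repSet (fun g z => w z - π g), hT.sum_repSet (fun g z => w z - π g)]
    have hsub : D.image p ⊆ Finset.Ico 1 (c + 1) := by
      intro g hg
      obtain ⟨d, hd, rfl⟩ := Finset.mem_image.1 hg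
      have h1 := hnode (y d)
      have h2 := (hy d hd).2.1
      rw [hpy d hd, Finset.mem_Ico]
      omega
    have hDsub : D ⊆ Finset.range c := fun d hd => Finset.mem_range.2 (hW.lt_of_mem d hd)
    have hr : ∑ g ∈ Finset.range c, (w (rep g) - π g) =
        ∑ g ∈ Finset.Ico 1 c, (w (rep g) - π g) := by
      rw [Finset.range_eq_Ico, Finset.sum_eq_sum_Ico_succ_bot (by omega)]
      simp [hT.rep_zero, hw, hS.pot_zero]
    have hdiff : Finset.Ico 1 (c + 1) \ D.image p = Finset.range c \ D := by
      have hcD : c ∉ D := fun h => lt_irrefl _ (hW.lt_of_mem c h)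
      ext g
      have hins : g ∈ insert c D ↔ g ∈ insert 0 (D.image p) := by rw [hW.insert_eq]
      simp only [Finset.mem_insert] at hins
      simp only [Finset.mem_sdiff, Finset.mem_Ico, Finset.mem_range]
      constructor
      · rintro ⟨h1, h2⟩
        have : g ≠ c := fun e => h2 (e ▸ hcimg)
        exact ⟨by omega, fun h => (hins.1 (Or.inr h)).elim (by omega) h2⟩
      · rintro ⟨h1, h2⟩
        refine ⟨⟨?_, by omega⟩, fun h => (hins.2 (Or.inr h)).elim (by omega) h2⟩
        by_contra h0
        exact (hins.2 (Or.inl (by omega))).elim (by omega) h2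
    rw [← hr, ← Finset.sum_sdiff hsub, ← Finset.sum_sdiff hDsub, hdiff]
    congr 1
    · refine Finset.sum_congr rfl fun g hg => ?_
      rw [← hdiff, Finset.mem_sdiff] at hg
      rw [hW.rep_eq g hg.2]
    · rw [Finset.sum_image hW.par_injOn]
      refine Finset.sum_congr rfl fun d hd => ?_
      have h1 := hrepD d hd
      have h2 := (hy d hd).2.2.2.2.2.2.1
      have h3 := hpy d hd
      simp only [hp] at h1 h3
      rw [h1, h3, h2]
  -- The old transversal is optimal for the reduced weight even against sets that use node `c`,
  -- provided they have at least `c - 1` elements. The new one has the same reduced weight, so it is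
  -- optimal too, and each new dual inequality results from comparing it with the set after a single
  -- exchange.
  have hmax : ∀ B : Finset (Fin n), M.Indep (B : Set (Fin n)) → c - 1 ≤ B.card →
      (∀ u ∈ B, node u < c + 1) → ∑ u ∈ B, (w (u : ℕ) - π (node u)) ≤
        ∑ u ∈ repSet n (c + 1) rep', (w (u : ℕ) - π (node u)) := by
    intro B hB hcard hnB
    rw [hval]
    refine hT.sum_le_of_arcs _ hB hcard ?_ ?_
    · intro z hz hA
      have := hdual z 0 (by have := hnB z hz; omega) (by omega) hA
      simpa [hT.rep_zero, hw, hS.pot_zero] using this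
    · intro z hz x _ hx hr hA
      have := hdual z _ (by have := hnB z hz; omega) hx hA
      rwa [hr] at this
  intro z h hz hh hA
  have hcard := hT'.card_repSet
  rcases Nat.eq_zero_or_pos h with rfl | hpos
  · have h1 := hmax (insert z (repSet n (c + 1) rep')) ?_ ?_ ?_
    · rw [Finset.sum_insert hA.1] at h1
      have h0 := hT'.rep_zero
      simp only [Nat.cast_zero, h0, hw, hS.pot_zero]
      omega
    · have := hA.2
      rw [hT'.repOf_zero, Set.sdiff_empty] at this
      simpa using this
    · rw [Finset.card_insert_of_notMem hA.1]; omega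
    · intro u hu
      rcases Finset.mem_insert.1 hu with rfl | hu
      · exact hz
      · exact (hT'.mem_repSet_iff.1 hu).2.1
  · obtain ⟨x, hx, hxn⟩ := hT'.exists_rep h hpos hh
    have hxA : x ∈ repSet n (c + 1) rep' := mem_repSet.2 ⟨h, hpos, hh, hx⟩
    have hzx : z ∉ (repSet n (c + 1) rep').erase x := fun hm => hA.1 (Finset.mem_of_mem_erase hm)
    have h1 := hmax (insert z ((repSet n (c + 1) rep').erase x)) ?_ ?_ ?_
    · rw [Finset.sum_insert hzx] at h1
      have h2 := Finset.add_sum_erase _ (fun u : Fin n => w (u : ℕ) - π (node u)) hxA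
      simp only [hxn] at h2
      rw [hx]
      omega
    · have := hA.2
      refine this.subset ?_
      rw [Finset.coe_insert, Finset.coe_erase]
      refine Set.insert_subset_insert fun u hu => ⟨hu.1, fun hux => hu.2 ?_⟩
      simp only [repOf, hx, Set.mem_ofPred_eq, Nat.cast_inj] at hux
      exact (Fin.ext hux).symm
    · rw [Finset.card_insert_of_notMem hzx, Finset.card_erase_of_mem hxA]; omega
    · intro u hu
      rcases Finset.mem_insert.1 hu with rfl | hu
      · exact hz
      · exact (hT'.mem_repSet_iff.1 (Finset.mem_of_mem_erase hu)).2.1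

end

end Transversal

/-! ### Programs for the search -/

namespace Transversal

open RAM

/-- `z` is an element that maximizes `F` among those that satisfy `P`, or `-1` if there are none. -/
def IsArgmax {n : ℕ} (P : Fin n → Prop) (F : ℤ → ℤ) (z : ℤ) : Prop :=
  (z = -1 ∧ ∀ y, ¬ P y) ∨ ∃ y : Fin n, z = ((y : ℕ) : ℤ) ∧ P y ∧
    ∀ y' : Fin n, P y' → F (y' : ℕ) ≤ F (y : ℕ)

section IsArgmax

variable {n : ℕ} {P Q : Fin n → Prop} {F : ℤ → ℤ} {z : ℤ}

theorem isArgmax_neg_one (h : ∀ y, ¬ P y) : IsArgmax P F (-1) := Or.inl ⟨rfl, h⟩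

theorem IsArgmax.congr (h : IsArgmax P F z) (hPQ : ∀ y, P y ↔ Q y) : IsArgmax Q F z := by
  obtain rfl : P = Q := funext fun y => propext (hPQ y)
  exact h

theorem IsArgmax.insert_new (h : IsArgmax P F z) {m : Fin n} (hQ : ∀ y, Q y ↔ P y ∨ y = m)
    (hz : z < 0 ∨ F z < F (m : ℕ)) : IsArgmax Q F ((m : ℕ) : ℤ) := by
  refine Or.inr ⟨m, rfl, (hQ m).2 (Or.inr rfl), fun y' hy' => ?_⟩
  rcases (hQ y').1 hy' with hP | rfl
  · rcases h with ⟨_, h⟩ | ⟨y, rfl, hy, h⟩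
    · exact absurd hP (h y')
    · have := h y' hP
      omega
  · exact le_rfl

theorem IsArgmax.insert_old (h : IsArgmax P F z) {m : Fin n} (hQ : ∀ y, Q y ↔ P y ∨ y = m)
    (hz : ¬ (z < 0 ∨ F z < F (m : ℕ))) : IsArgmax Q F z := by
  rcases h with ⟨rfl, h⟩ | ⟨y, rfl, hy, h⟩
  · exact absurd (Or.inl (by norm_num)) hz
  · refine Or.inr ⟨y, rfl, (hQ y).2 (Or.inl hy), fun y' hy' => ?_⟩
    rcases (hQ y').1 hy' with hP | rfl
    · exact h y' hP
    · omega

end IsArgmax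

/-- Matrices are stored in rows of length `n`, so a column index below `n` makes the address unique.
Row indices need no bound; row `n` occurs as well. -/
theorem row_ne {n g g' h h' : ℕ} (hh : h < n) (hh' : h' < n) (hne : ¬ (g = g' ∧ h = h')) :
    ((g * n : ℕ) : ℤ) + (h : ℤ) ≠ ((g' * n : ℕ) : ℤ) + (h' : ℤ) := by
  intro e
  have e' : g * n + h = g' * n + h' := by exact_mod_cast e
  rcases lt_trichotomy g g' with hlt | heq | hlt
  · have := Nat.mul_le_mul_right n (Nat.succ_le_of_lt hlt)
    rw [Nat.succ_mul] at this
    omega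
  · subst heq
    exact hne ⟨rfl, by omega⟩
  · have := Nat.mul_le_mul_right n (Nat.succ_le_of_lt hlt)
    rw [Nat.succ_mul] at this
    omega

/-- Array `11` contains the multiples of `n`. -/
def offsets : Prog :=
  .seq (.store 11 (.lit 0) (.lit 0))
    (.forLoop 6 (.lit 0) (.var 0) (.store 11 (.add (.var 6) (.lit 1))
      (.add (.get 11 (.var 6)) (.var 0))))

/-- The machine cannot multiply, so row addresses are taken from a table built by repeated addition.
-/
theorem offsets_spec {O : (ℤ → ℤ) → Prop} {n : ℕ} {s : State} (hn : s.reg 0 = n) :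
    wp O offsets (fun t s' => t ≤ 50 * (n + 1) ∧
      ∀ i : ℕ, i ≤ n → s'.arr 11 (i : ℤ) = ((i * n : ℕ) : ℤ)) s := by
  rw [offsets, wp_seq, wp_store]
  refine (wp_forLoop 0 n (fun m s => ∀ i : ℕ, i ≤ m → s.arr 11 (i : ℤ) = ((i * n : ℕ) : ℤ)) 10 rfl
    (by simp) (by omega) (fun s' h => ?_) ?_ ?_).mono ?_
  · simpa [hn] using h.reg 0 rfl
  · intro i hi
    obtain rfl : i = 0 := by omega
    simp
  · intro i s' _ hi hx hag hI
    rw [wp_store]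
    refine ⟨by simp, fun i' hi' => ?_⟩
    have hr0 : s'.reg 0 = n := by simpa [hn] using hag.reg 0 rfl
    simp only [Expr.eval, State.setReg_arr, State.setArr_arr_same, hx, hr0]
    rcases hi'.lt_or_eq with h | rfl
    · rw [Function.update_of_ne (by omega), hI i' (by omega)]
    · rw [hI i le_rfl]
      push_cast
      rw [Function.update_self]
      ring
  · rintro t s' ⟨ht, -, hI⟩
    refine ⟨?_, hI⟩
    simp only [Expr.cost] at ht ⊢
    omega

/-- Array `5` becomes the characteristic vector of the set of representatives. -/
def buildInd : Prog :=
  .seq (.forLoop 6 (.lit 0) (.var 0) (.store 5 (.var 6) (.lit 0)))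
    (.forLoop 6 (.lit 1) (.var 5) (.store 5 (.get 8 (.var 6)) (.lit 1)))

open Classical in
theorem buildInd_spec {O : (ℤ → ℤ) → Prop} {n c : ℕ} {M : Matroid (Fin n)} {node : Fin n → ℕ}
    {s : State} (hn : s.reg 0 = n) (hc : s.reg 5 = c) (hc1 : 1 ≤ c)
    (hT : IsTransversal M node c (s.arr 8)) :
    wp O buildInd (fun t s' => t ≤ 50 * (n + c + 1) ∧
      ∀ u : Fin n, s'.arr 5 ((u : ℕ) : ℤ) = if u ∈ repSet n c (s.arr 8) then 1 else 0) s := by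
  rw [buildInd, wp_seq]
  refine (wp_forLoop 0 n (fun m s => ∀ i : ℕ, i < m → s.arr 5 (i : ℤ) = 0) 10 rfl
    (by simp) (by omega) (fun s' h => ?_) ?_ ?_).agree.mono ?_
  · simpa [hn] using h.reg 0 rfl
  · intro i hi
    omega
  · intro i s' _ hi hx hag hI
    rw [wp_store]
    refine ⟨by simp, fun i' hi' => ?_⟩
    simp only [Expr.eval, State.setReg_arr, State.setArr_arr_same, hx]
    by_cases h : i' = i
    · rw [h, Function.update_self]
    · rw [Function.update_of_ne (by omega), hI i' (by omega)]
  · rintro t s₁ ⟨⟨ht, -, hI⟩, hag⟩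
    refine (wp_forLoop 1 c (fun m s' => ∀ u : Fin n, s'.arr 5 ((u : ℕ) : ℤ) =
      if u ∈ repSet n m (s.arr 8) then 1 else 0) 10 rfl
      (by simp) (by omega) (fun s' h => ?_) ?_ ?_).mono ?_
    · rw [Expr.eval, h.reg 5 rfl, hag.reg 5 rfl, hc]
    · intro u
      have : u ∉ repSet n 1 (s.arr 8) := by
        rw [mem_repSet]
        rintro ⟨g, h1, h2, -⟩
        omega
      simp [this, hI u u.2]
    · intro i s' hi1 hi hx hag' hI'
      rw [wp_store]
      refine ⟨by simp, fun u => ?_⟩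
      obtain ⟨v, hv, -⟩ := hT.exists_rep i hi1 hi
      have h8 : s'.arr 8 = s.arr 8 := by rw [hag'.arr 8 rfl, hag.arr 8 rfl]
      simp only [Expr.eval, State.setReg_arr, State.setArr_arr_same, hx, h8, hv]
      have hmem : u ∈ repSet n (i + 1) (s.arr 8) ↔ u ∈ repSet n i (s.arr 8) ∨ u = v := by
        simp only [mem_repSet]
        constructor
        · rintro ⟨g, h1, h2, h3⟩
          rcases (Nat.lt_succ_iff.1 h2).lt_or_eq with h | rfl
          · exact Or.inl ⟨g, h1, h, h3⟩
          · exact Or.inr (Fin.ext (by omega))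
        · rintro (⟨g, h1, h2, h3⟩ | rfl)
          · exact ⟨g, h1, by omega, h3⟩
          · exact ⟨i, hi1, by omega, hv⟩
      by_cases h : u = v
      · rw [h, Function.update_self, if_pos]
        exact (h ▸ hmem).2 (Or.inr rfl)
      · rw [Function.update_of_ne (fun e => h (Fin.ext (by exact_mod_cast e))), hI' u]
        simp [hmem, h]
    · rintro t' s' ⟨ht', -, hI'⟩
      refine ⟨?_, hI'⟩
      simp only [Expr.cost] at ht ht' ⊢
      omega

/-- The memory describes the colors and weights of the elements. The weight of the address `-1` is
`0`. -/
structure Ready {n : ℕ} (node : Fin n → ℕ) (s : State) : Prop where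
  reg_n : s.reg 0 = n
  off : ∀ i : ℕ, i ≤ n → s.arr 11 (i : ℤ) = ((i * n : ℕ) : ℤ)
  col : ∀ u : Fin n, s.arr 2 ((u : ℕ) : ℤ) + 1 = node u
  weight : s.arr 7 (-1) = 0

theorem Ready.of_eq {n : ℕ} {node : Fin n → ℕ} {s s' : State} (h : Ready node s)
    (h0 : s'.reg 0 = s.reg 0) (h11 : s'.arr 11 = s.arr 11) (h2 : s'.arr 2 = s.arr 2)
    (h7 : s'.arr 7 = s.arr 7) : Ready node s' :=
  ⟨by rw [h0, h.reg_n], by rw [h11]; exact h.off, by rw [h2]; exact h.col,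
    by rw [h7]; exact h.weight⟩

/-- Compare the element `y` in register `6` with the best arc found so far into the node `h` in
register `7`. -/
def tryArc : Prog :=
  .ite (.and (.eq (.get 5 (.var 6)) (.lit 0))
      (.and (.not (.eq (.var 6) (.get 8 (.var 7)))) (.lt (.get 2 (.var 6)) (.var 5))))
    (.seq (.store 5 (.var 6) (.lit 1))
    (.seq (.query 13 5)
    (.seq (.store 5 (.var 6) (.lit 0))
    (.ite (.eq (.var 13) (.lit 1))
      (.seq (.assign 14 (.add (.get 11 (.add (.get 2 (.var 6)) (.lit 1))) (.var 7)))
      (.ite (.or (.lt (.get 10 (.var 14)) (.lit 0))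
          (.lt (.get 7 (.get 10 (.var 14))) (.get 7 (.var 6))))
        (.store 10 (.var 14) (.var 6)) .skip))
      .skip))))
    .skip

/-- The best arcs into the node `h` in register `7`. -/
def fillColumn : Prog :=
  .seq (.forLoop 8 (.lit 1) (.add (.var 5) (.lit 1))
    (.store 10 (.add (.get 11 (.var 8)) (.var 7)) (.lit (-1))))
  (.seq (.store 5 (.get 8 (.var 7)) (.lit 0))
  (.seq (.forLoop 6 (.lit 0) (.var 0) tryArc)
  (.store 5 (.get 8 (.var 7)) (.lit 1))))

open Classical in
/-- Array `5` is the characteristic vector of the set of representatives without that of `h`. -/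
def IndWithout (n c : ℕ) (h : ℕ) (s : State) : Prop :=
  ∀ u : Fin n, s.arr 5 ((u : ℕ) : ℤ) =
    if u ∈ repSet n c (s.arr 8) ∧ u ∉ repOf n (s.arr 8) h then 1 else 0

/-- The element is put into the stored set only for the oracle call and then removed again. Thus the
oracle sees exactly the set in the definition of `Arc`, and the array is ready for the next element.
-/
theorem tryArc_spec {n c h i : ℕ} {M : Matroid (Fin n)} {node : Fin n → ℕ} {s : State}
    (hs : Ready node s) (hc : s.reg 5 = c) (hcn : c ≤ n) (hh : s.reg 7 = h) (hhc : h < c)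
    (hi : i < n) (hi6 : s.reg 6 = i) (hT : IsTransversal M node c (s.arr 8))
    (hnode : ∀ u, 1 ≤ node u)
    (hind : IndWithout n c h s)
    (hmax : ∀ g : ℕ, 1 ≤ g → g ≤ c → IsArgmax
      (fun y : Fin n => (y : ℕ) < i ∧ node y = g ∧ Arc M c (s.arr 8) y h) (s.arr 7)
      (s.arr 10 (((g * n : ℕ) : ℤ) + h))) :
    wp (indepOracle M) tryArc (fun t s' => t ≤ 80 ∧ IndWithout n c h s' ∧
      (∀ g : ℕ, 1 ≤ g → g ≤ c → IsArgmax
        (fun y : Fin n => (y : ℕ) < i + 1 ∧ node y = g ∧ Arc M c (s.arr 8) y h) (s.arr 7)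
        (s'.arr 10 (((g * n : ℕ) : ℤ) + h))) ∧
      ∀ g h' : ℕ, h' ≠ h → h' < n →
        s'.arr 10 (((g * n : ℕ) : ℤ) + h') = s.arr 10 (((g * n : ℕ) : ℤ) + h')) s := by
  classical
  set y : Fin n := ⟨i, hi⟩ with hy
  have hyi : ((y : ℕ) : ℤ) = i := rfl
  have hcol : s.arr 2 (i : ℤ) + 1 = node y := hs.col y
  have hlt : ∀ z : Fin n, (z : ℕ) < i + 1 ↔ (z : ℕ) < i ∨ z = y := by
    intro z
    rw [Fin.ext_iff]
    simp only [hy]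
    omega
  have hskip : ¬ (node y ≤ c ∧ Arc M c (s.arr 8) y h) →
      ∀ g : ℕ, 1 ≤ g → g ≤ c → IsArgmax
        (fun y : Fin n => (y : ℕ) < i + 1 ∧ node y = g ∧ Arc M c (s.arr 8) y h) (s.arr 7)
        (s.arr 10 (((g * n : ℕ) : ℤ) + h)) := by
    intro hno g h1 h2
    refine (hmax g h1 h2).congr fun z => ?_
    rw [hlt]
    constructor
    · exact fun hz => ⟨Or.inl hz.1, hz.2⟩
    · rintro ⟨hz | rfl, hz'⟩
      · exact ⟨hz, hz'⟩
      · exact absurd ⟨by omega, hz'.2⟩ hno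
  rw [tryArc, wp_ite]
  constructor
  · intro hb
    simp only [Test.Holds, Expr.eval, hi6, hh, hc] at hb
    -- Stored colors start at `0` and nodes at `1`, so the strict comparison in `hb3` says `node y ≤
    -- c`: the new color is included.
    obtain ⟨hb1, hb2, hb3⟩ := hb
    have hynot : ¬ (y ∈ repSet n c (s.arr 8) ∧ y ∉ repOf n (s.arr 8) h) := by
      intro hcon
      have := hind y
      rw [if_pos hcon, hyi, hb1] at this
      omega
    have hyX : y ∉ repOf n (s.arr 8) h := fun hm => hb2 (Eq.symm hm)
    have hyA : y ∉ repSet n c (s.arr 8) := fun hm => hynot ⟨hm, hyX⟩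
    have hdec : (decode n (Function.update (s.arr 5) (i : ℤ) 1) : Set (Fin n)) =
        insert y ((repSet n c (s.arr 8) : Set (Fin n)) \ repOf n (s.arr 8) h) := by
      ext u
      simp only [decode, Finset.coe_filter, Finset.mem_univ, true_and, Set.mem_ofPred_eq,
        Set.mem_insert_iff, Set.mem_sdiff, Finset.mem_coe]
      by_cases hu : u = y
      · rw [hu, hyi]
        simp
      · have hne : ((u : ℕ) : ℤ) ≠ (i : ℤ) := fun e => hu (Fin.ext (by simp only [hy]; omega))
        rw [Function.update_of_ne hne, hind u]
        simp only [ite_eq_left_iff, hu, false_or]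
        norm_num
    have hindf : ∀ s' : State, s'.arr 8 = s.arr 8 →
        s'.arr 5 = Function.update (Function.update (s.arr 5) i 1) i 0 →
        IndWithout n c h s' := by
      intro s' h8 h5 u
      rw [h8, h5, Function.update_idem]
      by_cases hu : u = y
      · rw [hu, hyi, Function.update_self, if_neg hynot]
      · have hne : ((u : ℕ) : ℤ) ≠ (i : ℤ) := fun e => hu (Fin.ext (by simp only [hy]; omega))
        rw [Function.update_of_ne hne, hind u]
    rw [wp_seq, wp_store, wp_seq, wp_query, wp_seq, wp_store, wp_ite]
    simp only [Expr.eval, State.setArr_arr_same, hi6, indepOracle, hdec, Test.Holds,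
      State.setArr_reg, State.setReg_reg_same]
    constructor
    · intro hq
      have hA : Arc M c (s.arr 8) y h := by
        refine ⟨hyA, ?_⟩
        by_contra hno
        rw [if_neg hno] at hq
        omega
      have hnc : node y ≤ c := by omega
      have haddr : s.arr 11 (s.arr 2 (i : ℤ) + 1) + h = ((node y * n : ℕ) : ℤ) + h := by
        rw [hcol, hs.off _ (by omega)]
      have hnew : ∀ z : Fin n, ((z : ℕ) < i + 1 ∧ node z = node y ∧ Arc M c (s.arr 8) z h) ↔
          ((z : ℕ) < i ∧ node z = node y ∧ Arc M c (s.arr 8) z h) ∨ z = y := by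
        intro z
        rw [hlt]
        constructor
        · rintro ⟨h1 | h1, h2⟩
          · exact Or.inl ⟨h1, h2⟩
          · exact Or.inr h1
        · rintro (h1 | rfl)
          · exact ⟨Or.inl h1.1, h1.2⟩
          · exact ⟨Or.inr rfl, rfl, hA⟩
      have hother : ∀ g : ℕ, g ≠ node y → 1 ≤ g → g ≤ c → IsArgmax
          (fun y : Fin n => (y : ℕ) < i + 1 ∧ node y = g ∧ Arc M c (s.arr 8) y h) (s.arr 7)
          (s.arr 10 (((g * n : ℕ) : ℤ) + h)) := by
        intro g hg h1 h2
        refine (hmax g h1 h2).congr fun z => ?_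
        rw [hlt]
        constructor
        · exact fun hz => ⟨Or.inl hz.1, hz.2⟩
        · rintro ⟨hz | rfl, hz'⟩
          · exact ⟨hz, hz'⟩
          · exact absurd hz'.1.symm hg
      rw [wp_seq, wp_assign, wp_ite]
      simp only [Expr.eval, State.setReg_reg_same, State.setReg_arr,
        State.setArr_reg, Test.Holds, ne_eq, Nat.reduceEqDiff,
        not_false_eq_true, State.setArr_arr_of_ne, State.setReg_reg_of_ne, hh, hi6, haddr]
      constructor
      · intro hb
        rw [wp_store]
        refine ⟨by simp, hindf _ (by simp) (by simp [hi6]), ?_, ?_⟩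
        · intro g h1 h2
          simp only [Expr.eval, State.setReg_reg_same, State.setReg_arr, State.setArr_arr_same,
            State.setArr_reg, ne_eq, Nat.reduceEqDiff,
            not_false_eq_true, State.setArr_arr_of_ne, State.setReg_reg_of_ne, hi6]
          by_cases hg : g = node y
          · rw [hg, Function.update_self]
            exact (hmax _ (hnode y) hnc).insert_new hnew hb
          · rw [Function.update_of_ne (row_ne (by omega) (by omega) (fun e => hg e.1))]
            exact hother g hg h1 h2
        · intro g h' hne hlt'
          simp only [Expr.eval, State.setReg_reg_same, State.setReg_arr, State.setArr_arr_same,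
            State.setArr_reg, ne_eq, Nat.reduceEqDiff,
            not_false_eq_true, State.setArr_arr_of_ne, State.setReg_reg_of_ne]
          rw [Function.update_of_ne (row_ne (by omega) (by omega) (fun e => hne e.2))]
      · intro hb
        rw [wp_skip]
        refine ⟨by simp, hindf _ (by simp) (by simp), ?_, ?_⟩
        · intro g h1 h2
          simp only [State.setReg_arr, State.setArr_arr_of_ne, ne_eq,
            Nat.reduceEqDiff, not_false_eq_true]
          by_cases hg : g = node y
          · rw [hg]
            exact (hmax _ (hnode y) hnc).insert_old hnew hb
          · exact hother g hg h1 h2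
        · intro g h' hne hlt'
          simp
    · intro hq
      rw [wp_skip]
      refine ⟨by simp, hindf _ (by simp) (by simp [hi6]), ?_, ?_⟩
      · intro g h1 h2
        simp only [State.setReg_arr, State.setArr_arr_of_ne, ne_eq,
            Nat.reduceEqDiff, not_false_eq_true]
        refine hskip (fun hcon => hq ?_) g h1 h2
        rw [if_pos hcon.2.2]
      · intro g h' _ _
        simp
  · intro hb
    rw [wp_skip]
    refine ⟨by simp, hind, hskip ?_, fun _ _ _ _ => rfl⟩
    rintro ⟨hc', hA⟩
    apply hb
    simp only [Test.Holds, Expr.eval, hi6, hh, hc]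
    refine ⟨?_, fun e => ?_, by omega⟩
    · have := hind y
      rw [hyi, if_neg (fun h => hA.1 h.1)] at this
      exact this
    · exact hA.1 (hT.repOf_subset hhc (Eq.symm e))

end Transversal

/-! ### The matrix of best exchange arcs -/

namespace Transversal

open RAM

open Classical in
/-- Array `5` is the characteristic vector of the set of representatives. -/
def IndFull (n c : ℕ) (s : State) : Prop :=
  ∀ u : Fin n, s.arr 5 ((u : ℕ) : ℤ) = if u ∈ repSet n c (s.arr 8) then 1 else 0

/-- For the sink the representative is `-1`, so removing and restoring it writes to cell `-1`, which
`decode` does not read. This avoids a case distinction between insertion and replacement. -/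
theorem fillColumn_spec {n c h : ℕ} {M : Matroid (Fin n)} {node : Fin n → ℕ} {s : State}
    (hs : Ready node s) (hc : s.reg 5 = c) (hcn : c ≤ n) (hh : s.reg 7 = h) (hhc : h < c)
    (hT : IsTransversal M node c (s.arr 8)) (hnode : ∀ u, 1 ≤ node u) (hind : IndFull n c s) :
    wp (indepOracle M) fillColumn (fun t s' => t ≤ 200 * (n + 1) ∧ IndFull n c s' ∧
      (∀ g : ℕ, 1 ≤ g → g ≤ c → IsArgmax
        (fun y : Fin n => node y = g ∧ Arc M c (s.arr 8) y h) (s.arr 7)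
        (s'.arr 10 (((g * n : ℕ) : ℤ) + h))) ∧
      ∀ g h' : ℕ, h' ≠ h → h' < n →
        s'.arr 10 (((g * n : ℕ) : ℤ) + h') = s.arr 10 (((g * n : ℕ) : ℤ) + h')) s := by
  classical
  rw [fillColumn, wp_seq]
  refine (wp_forLoop 1 (c + 1) (fun m s' =>
    (∀ g : ℕ, 1 ≤ g → g < m → s'.arr 10 (((g * n : ℕ) : ℤ) + h) = -1) ∧
      ∀ g h' : ℕ, h' ≠ h → h' < n →
        s'.arr 10 (((g * n : ℕ) : ℤ) + h') = s.arr 10 (((g * n : ℕ) : ℤ) + h')) 10 rfl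
    (by simp) (by omega) (fun s' h' => ?_) ?_ ?_).agree.mono ?_
  · simp [h'.reg 5 rfl, hc]
  · exact ⟨fun g h1 h2 => by omega, fun g h' _ _ => by simp⟩
  · rintro i s' hi1 hi hx hag ⟨hI1, hI2⟩
    rw [wp_store]
    have h7 : s'.reg 7 = h := by rw [hag.reg 7 rfl, hh]
    have h11 : s'.arr 11 (i : ℤ) = ((i * n : ℕ) : ℤ) := by
      rw [hag.arr 11 rfl, hs.off i (by omega)]
    simp only [Expr.eval, State.setReg_arr, State.setArr_arr_same, hx, h7, h11]
    refine ⟨by simp, fun g h1 h2 => ?_, fun g h' h1 h2 => ?_⟩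
    · by_cases hg : g = i
      · rw [hg, Function.update_self]
      · rw [Function.update_of_ne (row_ne (by omega) (by omega) (fun e => hg e.1)),
          hI1 g h1 (by omega)]
    · rw [Function.update_of_ne (row_ne (by omega) (by omega) (fun e => h1 e.2)), hI2 g h' h1 h2]
  rintro t₁ s₁ ⟨⟨ht₁, -, hI1, hI2⟩, hag⟩
  rw [wp_seq, wp_store, wp_seq]
  have e7 : s₁.reg 7 = h := by rw [hag.reg 7 rfl, hh]
  have e5 : s₁.reg 5 = c := by rw [hag.reg 5 rfl, hc]
  have a8 : s₁.arr 8 = s.arr 8 := hag.arr 8 rfl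
  have a7 : s₁.arr 7 = s.arr 7 := hag.arr 7 rfl
  have a5 : s₁.arr 5 = s.arr 5 := hag.arr 5 rfl
  have hs₁ : Ready node s₁ := hs.of_eq (hag.reg 0 rfl) (hag.arr 11 rfl) (hag.arr 2 rfl) a7
  simp only [Expr.eval, e7, a8]
  refine (wp_forLoop 0 n (fun i s' => IndWithout n c h s' ∧
      (∀ g : ℕ, 1 ≤ g → g ≤ c → IsArgmax
        (fun y : Fin n => (y : ℕ) < i ∧ node y = g ∧ Arc M c (s.arr 8) y h) (s.arr 7)
        (s'.arr 10 (((g * n : ℕ) : ℤ) + h))) ∧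
      ∀ g h' : ℕ, h' ≠ h → h' < n →
        s'.arr 10 (((g * n : ℕ) : ℤ) + h') = s.arr 10 (((g * n : ℕ) : ℤ) + h')) 80 rfl
    (by simp) (by omega) (fun s' h' => ?_) ?_ ?_).agree.mono ?_
  · rw [Expr.eval, h'.reg 0 rfl]; exact hs₁.reg_n
  · refine ⟨fun u => ?_, fun g h1 h2 => ?_, fun g h' h1 h2 => ?_⟩
    · simp only [State.setReg_arr, State.setArr_arr_same, ne_eq, Nat.reduceEqDiff,
        not_false_eq_true, State.setArr_arr_of_ne, a8, a5]
      by_cases hu : s.arr 8 (h : ℤ) = ((u : ℕ) : ℤ)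
      · rw [hu, Function.update_self, if_neg]
        exact fun hcon => hcon.2 hu
      · rw [Function.update_of_ne (Ne.symm hu), hind u]
        have : u ∉ repOf n (s.arr 8) h := hu
        simp [this]
    · simp only [State.setReg_arr, ne_eq, Nat.reduceEqDiff,
        not_false_eq_true, State.setArr_arr_of_ne]
      rw [hI1 g h1 (by omega)]
      exact isArgmax_neg_one fun y hy => by omega
    · simp only [State.setReg_arr, ne_eq, Nat.reduceEqDiff,
        not_false_eq_true, State.setArr_arr_of_ne]
      exact hI2 g h' h1 h2
  · rintro i s' _ hi hx hag' ⟨hJ1, hJ2, hJ3⟩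
    have b8 : s'.arr 8 = s.arr 8 := by rw [hag'.arr 8 rfl]; simp [a8]
    have b7 : s'.arr 7 = s.arr 7 := by rw [hag'.arr 7 rfl]; simp [a7]
    refine (tryArc_spec (M := M) (n := n) (c := c) (h := h) (i := i) (node := node)
      (hs₁.of_eq (hag'.reg 0 rfl) ?_ ?_ ?_) ?_ hcn ?_ hhc hi hx ?_ hnode hJ1 ?_).mono ?_
    · rw [hag'.arr 11 rfl]; simp
    · rw [hag'.arr 2 rfl]; simp
    · rw [b7, a7]
    · rw [hag'.reg 5 rfl]; exact e5
    · rw [hag'.reg 7 rfl]; exact e7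
    · rw [b8]; exact hT
    · rw [b8, b7]; exact hJ2
    · rintro t s'' ⟨ht, hK1, hK2, hK3⟩
      rw [b8, b7] at hK2
      exact ⟨ht, hK1, hK2, fun g h' h1 h2 => (hK3 g h' h1 h2).trans (hJ3 g h' h1 h2)⟩
  rintro t₂ s₂ ⟨⟨ht₂, -, hJ1, hJ2, hJ3⟩, hag₂⟩
  rw [wp_store]
  have f7 : s₂.reg 7 = h := by rw [hag₂.reg 7 rfl]; exact e7
  have f8 : s₂.arr 8 = s.arr 8 := by rw [hag₂.arr 8 rfl]; simp [a8]
  refine ⟨?_, fun u => ?_, fun g h1 h2 => ?_, fun g h' h1 h2 => ?_⟩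
  · simp only [Expr.cost] at ht₁ ht₂ ⊢
    omega
  · simp only [Expr.eval, State.setArr_arr_same, f7, f8, ne_eq, Nat.reduceEqDiff,
        not_false_eq_true, State.setArr_arr_of_ne]
    by_cases hu : s.arr 8 (h : ℤ) = ((u : ℕ) : ℤ)
    · rw [hu, Function.update_self, if_pos]
      exact hT.repOf_subset hhc hu
    · have hu' : u ∉ repOf n (s.arr 8) h := hu
      rw [Function.update_of_ne (Ne.symm hu), hJ1 u, f8]
      simp [hu']
  · simp only [ne_eq, Nat.reduceEqDiff, not_false_eq_true, State.setArr_arr_of_ne]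
    exact (hJ2 g h1 h2).congr fun y => ⟨fun hy => hy.2, fun hy => ⟨y.2, hy⟩⟩
  · simp only [ne_eq, Nat.reduceEqDiff, not_false_eq_true, State.setArr_arr_of_ne]
    exact hJ3 g h' h1 h2

/-- All best arcs. -/
def fillMatrix : Prog := .forLoop 7 (.lit 0) (.var 5) fillColumn

/-- There are `c` columns with `O(n)` work and oracle calls each, and filling one column leaves the
others alone. -/
theorem fillMatrix_spec {n c : ℕ} {M : Matroid (Fin n)} {node : Fin n → ℕ} {s : State}
    (hs : Ready node s) (hc : s.reg 5 = c) (hcn : c ≤ n)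
    (hT : IsTransversal M node c (s.arr 8)) (hnode : ∀ u, 1 ≤ node u) (hind : IndFull n c s) :
    wp (indepOracle M) fillMatrix (fun t s' => t ≤ c * (200 * (n + 1) + 9) + 6 ∧
      IsBestArc M node (s.arr 7) c (s.arr 8)
        (fun g h => s'.arr 10 (((g * n : ℕ) : ℤ) + h))) s := by
  rw [fillMatrix]
  refine (wp_forLoop 0 c (fun m s' => IndFull n c s' ∧
      ∀ g h : ℕ, 1 ≤ g → g ≤ c → h < m → IsArgmax
        (fun y : Fin n => node y = g ∧ Arc M c (s.arr 8) y h) (s.arr 7)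
        (s'.arr 10 (((g * n : ℕ) : ℤ) + h))) (200 * (n + 1)) rfl
    (by simp) (by omega) (fun s' h' => ?_) ?_ ?_).mono ?_
  · rw [Expr.eval, h'.reg 5 rfl, hc]
  · exact ⟨hind, fun g h _ _ h1 => by omega⟩
  · rintro i s' _ hi hx hag ⟨hI1, hI2⟩
    have b8 : s'.arr 8 = s.arr 8 := hag.arr 8 rfl
    have b7 : s'.arr 7 = s.arr 7 := hag.arr 7 rfl
    refine (fillColumn_spec (M := M) (n := n) (c := c) (h := i) (node := node)
      (hs.of_eq (hag.reg 0 rfl) (hag.arr 11 rfl) (hag.arr 2 rfl) b7) ?_ hcn hx hi ?_ hnode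
      hI1).mono ?_
    · rw [hag.reg 5 rfl, hc]
    · rw [b8]; exact hT
    · rintro t s'' ⟨ht, hK1, hK2, hK3⟩
      rw [b8, b7] at hK2
      refine ⟨ht, hK1, fun g h h1 h2 h3 => ?_⟩
      by_cases hh : h = i
      · rw [hh]; exact hK2 g h1 h2
      · simp only [State.setReg_arr]
        rw [hK3 g h hh (by omega)]
        exact hI2 g h h1 h2 (by omega)
  · rintro t s' ⟨ht, -, hI1, hI2⟩
    refine ⟨?_, fun g h h1 h2 h3 => ?_⟩
    · simp only [Expr.cost, Nat.sub_zero] at ht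
      omega
    · rcases hI2 g h h1 h2 h3 with ⟨h4, h5⟩ | ⟨y, h4, h5, h6⟩
      · exact Or.inl ⟨h4, fun y h6 h7 => h5 y ⟨h6, h7⟩⟩
      · exact Or.inr ⟨y, h4, h5.1, h5.2, fun y' h7 h8 => h6 y' ⟨h7, h8⟩⟩

end Transversal

/-! ### One step of the search for an augmenting path -/

namespace Transversal

open RAM

/-- The search of phase `c` in the memory `s`. -/
def SearchAt {n : ℕ} (M : Matroid (Fin n)) (node : Fin n → ℕ) (c τ cur : ℕ) (s : State) : Prop :=
  Search M node (s.arr 7) c (s.arr 8) (fun g h => s.arr 10 (((g * n : ℕ) : ℤ) + h)) τ cur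
    (s.arr 9) (s.arr 13) (s.arr 14) (s.arr 15)

/-- There is no independent set with exactly one element for each of the nodes `1, …, c`. -/
def NoTransversal {n : ℕ} (M : Matroid (Fin n)) (node : Fin n → ℕ) (c : ℕ) : Prop :=
  ∀ B : Finset (Fin n), M.Indep (B : Set (Fin n)) →
    Set.BijOn node B (Finset.Ico 1 (c + 1)) → False

/-- Consider the best arc from the current node to the node in register `7`. -/
def relaxArc : Prog :=
  .seq (.assign 13 (.get 10 (.add (.get 11 (.var 9)) (.var 7))))
  (.seq (.assign 14 (.sub (.add (.sub (.get 9 (.var 9)) (.get 9 (.var 7)))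
      (.get 7 (.get 8 (.var 7)))) (.get 7 (.var 13))))
  (.ite (.and (.not (.lt (.var 13) (.lit 0)))
      (.or (.lt (.get 15 (.var 7)) (.lit 0)) (.lt (.var 14) (.get 14 (.var 7)))))
    (.seq (.store 14 (.var 7) (.var 14)) (.store 15 (.var 7) (.var 9)))
    .skip))

/-- Compare the node in register `7` with the best node found so far. -/
def pickBest : Prog :=
  .ite (.and (.not (.lt (.get 15 (.var 7)) (.lit 0)))
      (.or (.lt (.var 10) (.lit 0)) (.lt (.get 14 (.var 7)) (.get 14 (.var 10)))))
    (.assign 10 (.var 7)) .skip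

/-- Update the labels of all nodes that have not been reached and find the one of least slack. -/
def scan : Prog :=
  .seq (.assign 10 (.lit (-1)))
    (.forLoop 7 (.lit 0) (.var 5)
      (.ite (.eq (.get 13 (.var 7)) (.lit 0)) (.seq relaxArc pickBest) .skip))

/-- Shift the potential of the nodes that have been reached by the slack in register `11`. -/
def shift : Prog :=
  .forLoop 7 (.lit 0) (.add (.var 5) (.lit 1))
    (.ite (.eq (.get 13 (.var 7)) (.lit 0))
      (.store 14 (.var 7) (.sub (.get 14 (.var 7)) (.var 11)))
      (.store 9 (.var 7) (.sub (.get 9 (.var 7)) (.var 11))))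

/-- One step of the search. -/
def searchStep : Prog :=
  .seq scan
    (.ite (.lt (.var 10) (.lit 0)) (.assign 4 (.lit 0))
      (.seq (.assign 11 (.get 14 (.var 10)))
      (.seq shift
      (.seq (.store 13 (.var 10) (.add (.var 12) (.lit 1)))
      (.assign 9 (.var 10))))))

/-- The search for an augmenting path. -/
def search : Prog :=
  .seq (.forLoop 7 (.lit 0) (.add (.var 5) (.lit 1))
    (.seq (.store 13 (.var 7) (.lit 0)) (.store 15 (.var 7) (.lit (-1)))))
  (.seq (.store 13 (.var 5) (.lit 1))
  (.seq (.assign 9 (.var 5))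
  (.forLoop 12 (.lit 1) (.add (.var 5) (.lit 1))
    (.ite (.and (.not (.eq (.var 9) (.lit 0))) (.eq (.var 4) (.lit 1))) searchStep .skip))))

/-- Exchange along the augmenting path. -/
def walk : Prog :=
  .seq (.assign 7 (.lit 0))
    (.forLoop 6 (.lit 0) (.var 5)
      (.ite (.not (.eq (.var 7) (.var 5)))
        (.seq (.assign 8 (.get 15 (.var 7)))
        (.seq (.store 8 (.var 8) (.get 10 (.add (.get 11 (.var 8)) (.var 7))))
        (.assign 7 (.var 8))))
        .skip))

/-- Extend the transversal to one more node. -/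
def phase : Prog :=
  .seq buildInd (.seq fillMatrix (.seq search (.ite (.eq (.var 4) (.lit 1)) walk .skip)))

section

variable {O : (ℤ → ℤ) → Prop} {n c τ cur : ℕ} {M : Matroid (Fin n)} {node : Fin n → ℕ} {s : State}

/-- The predicate `P` on the new label is left open, so that the two cases of `Labelled.relax` can
be used directly as `hyes` and `hno`. -/
theorem relaxArc_spec {P : ℤ → ℤ → Prop} {h : ℕ} {y z : ℤ} (h7 : s.reg 7 = h) (h9 : s.reg 9 = cur)
    (hy : s.arr 10 (s.arr 11 cur + h) = y)
    (hz : s.arr 9 cur - s.arr 9 h + s.arr 7 (s.arr 8 h) - s.arr 7 y = z)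
    (hyes : 0 ≤ y ∧ (s.arr 15 h < 0 ∨ z < s.arr 14 h) → P z cur)
    (hno : ¬ (0 ≤ y ∧ (s.arr 15 h < 0 ∨ z < s.arr 14 h)) → P (s.arr 14 h) (s.arr 15 h)) :
    wp O relaxArc (fun t s' => t ≤ 80 ∧ P (s'.arr 14 h) (s'.arr 15 h) ∧
      (∀ i : ℕ, i ≠ h → s'.arr 14 i = s.arr 14 i) ∧
      (∀ i : ℕ, i ≠ h → s'.arr 15 i = s.arr 15 i)) s := by
  rw [relaxArc, wp_seq, wp_assign, wp_seq, wp_assign, wp_ite]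
  simp only [Test.Holds, Expr.eval, State.setReg_reg_same, State.setReg_arr, ne_eq,
    Nat.reduceEqDiff, not_false_eq_true, State.setReg_reg_of_ne, h9, h7, hy, hz, not_lt]
  constructor
  · intro hb
    rw [wp_seq, wp_store, wp_store]
    simp only [Expr.eval, State.setReg_reg_same, State.setReg_arr, State.setArr_arr_same,
      State.setArr_reg, ne_eq, Nat.reduceEqDiff, not_false_eq_true, State.setArr_arr_of_ne,
      State.setReg_reg_of_ne, h7, h9, Function.update_self]
    refine ⟨by simp, hyes hb, fun i hi => ?_, fun i hi => ?_⟩ <;>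
    rw [Function.update_of_ne (by exact_mod_cast hi)]
  · intro hb
    rw [wp_skip]
    exact ⟨by simp, hno hb, fun i _ => rfl, fun i _ => rfl⟩

/-- Register `10` contains a node of least slack among the nodes smaller than `m` that have not been
reached and that have a label, or `-1` if there are none. -/
def IsBestNode (m : ℕ) (s : State) : Prop :=
  (s.reg 10 = -1 ∧ ∀ h : ℕ, h < m → s.arr 13 h = 0 → s.arr 15 h < 0) ∨
  ∃ b : ℕ, s.reg 10 = b ∧ b < m ∧ s.arr 13 b = 0 ∧ 0 ≤ s.arr 15 b ∧
    ∀ h : ℕ, h < m → s.arr 13 h = 0 → 0 ≤ s.arr 15 h → s.arr 14 b ≤ s.arr 14 h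

theorem IsBestNode.congr {m : ℕ} {s s' : State} (h : IsBestNode m s) (h10 : s'.reg 10 = s.reg 10)
    (h13 : s'.arr 13 = s.arr 13) (h14 : ∀ i : ℕ, i < m → s'.arr 14 i = s.arr 14 i)
    (h15 : ∀ i : ℕ, i < m → s'.arr 15 i = s.arr 15 i) : IsBestNode m s' := by
  rcases h with ⟨h1, h2⟩ | ⟨b, h1, h2, h3, h4, h5⟩
  · exact Or.inl ⟨by rw [h10, h1], fun i hi hi0 => by rw [h15 i hi]; exact h2 i hi (h13 ▸ hi0)⟩
  · refine Or.inr ⟨b, by rw [h10, h1], h2, by rw [h13, h3], by rw [h15 b h2]; exact h4, ?_⟩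
    intro i hi hi0 hi1
    rw [h14 b h2, h14 i hi]
    rw [h15 i hi] at hi1
    exact h5 i hi (h13 ▸ hi0) hi1

theorem pickBest_spec {h : ℕ} (h7 : s.reg 7 = h) (h0 : s.arr 13 h = 0) (hB : IsBestNode h s) :
    wp O pickBest (fun t s' => t ≤ 40 ∧ IsBestNode (h + 1) s') s := by
  rw [pickBest, wp_ite]
  simp only [Test.Holds, Expr.eval, h7, not_lt]
  constructor
  · rintro ⟨hb1, hb2⟩
    rw [wp_assign]
    refine ⟨by simp, Or.inr ⟨h, by simp [h7], by omega, by simpa using h0, by simpa using hb1, ?_⟩⟩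
    intro i hi hi0 hi1
    simp only [State.setReg_arr] at hi0 hi1 ⊢
    by_cases hih : i = h
    · rw [hih]
    · rcases hB with ⟨h1, h2⟩ | ⟨b, h1, h2, h3, h4, h5⟩
      · have := h2 i (by omega) hi0
        omega
      · have := h5 i (by omega) hi0 hi1
        rw [h1] at hb2
        omega
  · intro hb
    rw [wp_skip]
    refine ⟨by simp, ?_⟩
    rcases hB with ⟨h1, h2⟩ | ⟨b, h1, h2, h3, h4, h5⟩
    · refine Or.inl ⟨h1, fun i hi hi0 => ?_⟩
      by_cases hih : i = h
      · subst hih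
        by_contra hcon
        exact hb ⟨by omega, Or.inl (by omega)⟩
      · exact h2 i (by omega) hi0
    · refine Or.inr ⟨b, h1, by omega, h3, h4, fun i hi hi0 hi1 => ?_⟩
      by_cases hih : i = h
      · subst hih
        by_contra hcon
        exact hb ⟨hi1, Or.inr (by rw [h1]; omega)⟩
      · exact h5 i (by omega) hi0 hi1

/-- The invariant splits the nodes at the loop counter: below it, labels of unreached nodes already
account for the arcs from `cur`; from it on, they are still the old ones. Labels and the minimum are
thus obtained in one pass of `O(c)` steps. -/
theorem scan_spec (hs : Ready node s) (hc : s.reg 5 = c) (hcn : c ≤ n) (h9 : s.reg 9 = cur)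
    (hcur : cur ≠ 0) (hS : SearchAt M node c τ cur s)
    (hY : IsBestArc M node (s.arr 7) c (s.arr 8) (fun g h => s.arr 10 (((g * n : ℕ) : ℤ) + h))) :
    wp O scan (fun t s' => t ≤ 200 * (c + 1) ∧
      (∀ h : ℕ, h < c → s.arr 13 h = 0 →
        Labelled M node (s.arr 7) c (s.arr 8) (fun g h => s.arr 10 (((g * n : ℕ) : ℤ) + h))
          (s.arr 9) (s.arr 13) (τ + 1) h (s'.arr 14 h) (s'.arr 15 h)) ∧
      (∀ h : ℕ, h < c → s.arr 13 h ≠ 0 → s'.arr 15 h = s.arr 15 h) ∧ IsBestNode c s') s := by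
  rw [scan, wp_seq, wp_assign]
  refine (wp_forLoop 0 c (fun m s' =>
      (∀ h : ℕ, h < m → s.arr 13 h = 0 →
        Labelled M node (s.arr 7) c (s.arr 8) (fun g h => s.arr 10 (((g * n : ℕ) : ℤ) + h))
          (s.arr 9) (s.arr 13) (τ + 1) h (s'.arr 14 h) (s'.arr 15 h)) ∧
      (∀ h : ℕ, h < m → s.arr 13 h ≠ 0 → s'.arr 15 h = s.arr 15 h) ∧
      (∀ h : ℕ, m ≤ h → s'.arr 14 h = s.arr 14 h ∧ s'.arr 15 h = s.arr 15 h) ∧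
      IsBestNode m s') 140 rfl (by simp) (by omega) (fun s' h' => ?_) ?_ ?_).mono ?_
  · rw [Expr.eval, h'.reg 5 rfl]; simpa using hc
  · refine ⟨fun _ h => by omega, fun _ h => by omega, fun h _ => by simp, Or.inl ⟨by simp, ?_⟩⟩
    exact fun _ h => by omega
  · rintro i s' _ hi hx hag ⟨hI1, hI2, hI3, hI4⟩
    have b7 : s'.arr 7 = s.arr 7 := hag.arr 7 rfl
    have b8 : s'.arr 8 = s.arr 8 := hag.arr 8 rfl
    have b9 : s'.arr 9 = s.arr 9 := hag.arr 9 rfl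
    have b10 : s'.arr 10 = s.arr 10 := hag.arr 10 rfl
    have b13 : s'.arr 13 = s.arr 13 := hag.arr 13 rfl
    have b11 : s'.arr 11 = s.arr 11 := hag.arr 11 rfl
    have r9 : s'.reg 9 = s.reg 9 := by rw [hag.reg 9 rfl]; simp
    have r5 : s'.reg 5 = s.reg 5 := by rw [hag.reg 5 rfl]; simp
    have hs' : Ready node s' :=
      hs.of_eq (by rw [hag.reg 0 rfl]; simp) b11 (hag.arr 2 rfl) b7
    rw [wp_ite]
    simp only [Test.Holds, Expr.eval, hx, b13]
    constructor
    · intro h0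
      have hL := hS.unreached i hi h0
      rw [← (hI3 i le_rfl).1, ← (hI3 i le_rfl).2] at hL
      have hoff : s.arr 11 (cur : ℤ) = ((cur * n : ℕ) : ℤ) :=
        hs.off _ (by have := hS.cur_le; omega)
      rw [wp_seq]
      have hτ : 0 < (τ : ℤ) := by
        have h1 := hS.ord_le c le_rfl
        have h2 := hS.ord_source
        omega
      obtain ⟨hyes, hno⟩ := hL.relax hY hS.cur_le (by omega) hi hτ hS.ord_cur hS.eq_cur
      refine (relaxArc_spec hx (by rw [r9, h9]) (by rw [b10, b11, hoff])
        (by rw [b9, b7, b8]) hyes hno).agree.mono ?_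
      · rintro t s₁ ⟨⟨ht, hA, hB, hC⟩, hag₁⟩
        have c13 : s₁.arr 13 = s.arr 13 := by rw [hag₁.arr 13 rfl, b13]
        refine wp.mono (wp.agree (pickBest_spec (h := i) (by rw [hag₁.reg 7 rfl, hx])
          (by rw [c13, h0]) ?_)) ?_
        · exact hI4.congr (hag₁.reg 10 rfl) (hag₁.arr 13 rfl) (fun j hj => hB j (by omega))
            (fun j hj => hC j (by omega))
        · rintro t' s₂ ⟨⟨ht', hbest⟩, hag₂⟩
          have d14 : s₂.arr 14 = s₁.arr 14 := hag₂.arr 14 rfl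
          have d15 : s₂.arr 15 = s₁.arr 15 := hag₂.arr 15 rfl
          refine ⟨?_, fun h hh hh0 => ?_, fun h hh hh0 => ?_, fun h hh => ?_, ?_⟩
          · simp only [Test.cost, Expr.cost]
            omega
          · simp only [State.setReg_arr, d14, d15]
            by_cases hhi : h = i
            · rw [hhi]; exact hA
            · rw [hB h hhi, hC h hhi]
              exact hI1 h (by omega) hh0
          · simp only [State.setReg_arr, d15]
            have hhi : h ≠ i := fun e => hh0 (e ▸ h0)
            rw [hC h hhi]
            exact hI2 h (by omega) hh0
          · simp only [State.setReg_arr, d14, d15]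
            rw [hB h (by omega), hC h (by omega)]
            exact hI3 h (by omega)
          · exact hbest.congr (by simp) (by simp) (by simp) (by simp)
    · intro h0
      rw [wp_skip]
      refine ⟨by simp, fun h hh hh0 => ?_, fun h hh hh0 => ?_, fun h hh => hI3 h (by omega), ?_⟩
      · have hhi : h ≠ i := fun e => h0 (e ▸ hh0)
        exact hI1 h (by omega) hh0
      · by_cases hhi : h = i
        · rw [hhi]; exact (hI3 i le_rfl).2
        · exact hI2 h (by omega) hh0
      · have hnb : IsBestNode (i + 1) s' := by
          rcases hI4 with ⟨h1, h2⟩ | ⟨b, h1, h2, h3, h4, h5⟩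
          · refine Or.inl ⟨h1, fun j hj hj0 => h2 j ?_ hj0⟩
            have : j ≠ i := fun e => h0 (by rw [← e, ← b13]; exact hj0)
            omega
          · refine Or.inr ⟨b, h1, by omega, h3, h4, fun j hj hj0 => h5 j ?_ hj0⟩
            have : j ≠ i := fun e => h0 (by rw [← e, ← b13]; exact hj0)
            omega
        exact hnb.congr (by simp) (by simp) (by simp) (by simp)
  · rintro t s' ⟨ht, -, hI1, hI2, -, hI4⟩
    refine ⟨?_, hI1, hI2, hI4⟩
    simp only [Expr.cost] at ht ⊢
    omega

/-- The slacks of the unreached nodes drop by the same amount as the potentials of the reached ones,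
so labels need not be recomputed. -/
theorem shift_spec (hc : s.reg 5 = c) :
    wp O shift (fun t s' => t ≤ 60 * (c + 1) ∧
      (∀ h : ℕ, h ≤ c → s.arr 13 h = 0 →
        s'.arr 9 h = s.arr 9 h ∧ s'.arr 14 h = s.arr 14 h - s.reg 11) ∧
      (∀ h : ℕ, h ≤ c → s.arr 13 h ≠ 0 → s'.arr 9 h = s.arr 9 h - s.reg 11)) s := by
  rw [shift]
  refine (wp_forLoop 0 (c + 1) (fun m s' =>
      (∀ h : ℕ, h < m → s.arr 13 h = 0 →
        s'.arr 9 h = s.arr 9 h ∧ s'.arr 14 h = s.arr 14 h - s.reg 11) ∧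
      (∀ h : ℕ, h < m → s.arr 13 h ≠ 0 → s'.arr 9 h = s.arr 9 h - s.reg 11) ∧
      (∀ h : ℕ, m ≤ h → s'.arr 9 h = s.arr 9 h ∧ s'.arr 14 h = s.arr 14 h)) 20 rfl (by simp)
    (by omega) (fun s' h' => ?_) ?_ ?_).mono ?_
  · simp [h'.reg 5 rfl, hc]
  · exact ⟨fun _ h => by omega, fun _ h => by omega, fun h _ => by simp⟩
  · rintro i s' _ hi hx hag ⟨hI1, hI2, hI3⟩
    have b13 : s'.arr 13 = s.arr 13 := hag.arr 13 rfl
    have r11 : s'.reg 11 = s.reg 11 := hag.reg 11 rfl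
    rw [wp_ite]
    simp only [Test.Holds, Expr.eval, hx, b13]
    constructor
    · intro h0
      rw [wp_store]
      simp only [Expr.eval, hx, r11, State.setReg_arr, State.setArr_arr_same, ne_eq,
        Nat.reduceEqDiff, not_false_eq_true, State.setArr_arr_of_ne]
      refine ⟨by simp, fun h hh hh0 => ?_, fun h hh hh0 => ?_, fun h hh => ?_⟩
      · by_cases hhi : h = i
        · rw [hhi, Function.update_self, (hI3 i le_rfl).1, (hI3 i le_rfl).2]
          exact ⟨rfl, rfl⟩
        · rw [Function.update_of_ne (by omega)]
          exact hI1 h (by omega) hh0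
      · have hhi : h ≠ i := fun e => hh0 (e ▸ h0)
        exact hI2 h (by omega) hh0
      · rw [Function.update_of_ne (by omega)]
        exact hI3 h (by omega)
    · intro h0
      rw [wp_store]
      simp only [Expr.eval, hx, r11, State.setReg_arr, State.setArr_arr_same, ne_eq,
        Nat.reduceEqDiff, not_false_eq_true, State.setArr_arr_of_ne]
      refine ⟨by simp, fun h hh hh0 => ?_, fun h hh hh0 => ?_, fun h hh => ?_⟩
      · have hhi : h ≠ i := fun e => h0 (e ▸ hh0)
        rw [Function.update_of_ne (by omega)]
        exact hI1 h (by omega) hh0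
      · by_cases hhi : h = i
        · rw [hhi, Function.update_self, (hI3 i le_rfl).1]
        · rw [Function.update_of_ne (by omega)]
          exact hI2 h (by omega) hh0
      · rw [Function.update_of_ne (by omega)]
        exact hI3 h (by omega)
  · rintro t s' ⟨ht, -, hI1, hI2, -⟩
    refine ⟨?_, fun h hh => hI1 h (by omega), fun h hh => hI2 h (by omega)⟩
    simp only [Expr.cost] at ht ⊢
    omega

theorem searchStep_spec (hs : Ready node s) (hc : s.reg 5 = c) (hc1 : 1 ≤ c) (hcn : c ≤ n)
    (h4 : s.reg 4 = 1)
    (h9 : s.reg 9 = cur) (h12 : s.reg 12 = τ) (hcur : cur ≠ 0)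
    (hT : IsTransversal M node c (s.arr 8)) (hS : SearchAt M node c τ cur s)
    (hY : IsBestArc M node (s.arr 7) c (s.arr 8) (fun g h => s.arr 10 (((g * n : ℕ) : ℤ) + h))) :
    wp O searchStep (fun t s' => t ≤ 300 * (c + 1) ∧
      ((s'.reg 4 = 1 ∧ ∃ b : ℕ, s'.reg 9 = b ∧ SearchAt M node c (τ + 1) b s') ∨
        (s'.reg 4 = 0 ∧ NoTransversal M node c))) s := by
  rw [searchStep, wp_seq]
  refine (scan_spec hs hc hcn h9 hcur hS hY).agree.mono ?_
  rintro t₁ s₁ ⟨⟨ht₁, hL, hpar, hbest⟩, hag⟩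
  have b13 : s₁.arr 13 = s.arr 13 := hag.arr 13 rfl
  rw [wp_ite]
  simp only [Test.Holds, Expr.eval]
  constructor
  · intro hb
    rw [wp_assign]
    refine ⟨by simp only [Test.cost, Expr.cost]; omega, Or.inr ⟨by simp, ?_⟩⟩
    -- If register `10` is negative, no unreached node has a label, so no arc leaves the set of
    -- reached nodes.
    rcases hbest with ⟨h1, h2⟩ | ⟨b, h1, -⟩
    · refine fun B hB hbij => hS.no_transversal hT hcur hc1 (fun h hh h0 y hy hp hA => ?_) B hB hbij
      have hneg := h2 h hh (by rw [b13]; exact h0)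
      rcases hL h hh h0 with ⟨-, hno⟩ | ⟨z, hz, -⟩
      · exact hno y hy hp (by have := hS.ord_le _ hy; omega) hA
      · omega
    · omega
  · intro hb
    obtain ⟨b, h1, h2, h3, h4', h5⟩ : ∃ b : ℕ, s₁.reg 10 = b ∧ b < c ∧ s₁.arr 13 b = 0 ∧
        0 ≤ s₁.arr 15 b ∧ ∀ h : ℕ, h < c → s₁.arr 13 h = 0 → 0 ≤ s₁.arr 15 h →
          s₁.arr 14 b ≤ s₁.arr 14 h := by
      rcases hbest with ⟨h1, h2⟩ | h
      · omega
      · exact h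
    rw [wp_seq, wp_assign, wp_seq]
    refine (shift_spec (c := c) (by simp [hag.reg 5 rfl, hc])).agree.mono ?_
    rintro t₂ s₂ ⟨⟨ht₂, hI1, hI2⟩, hag₂⟩
    have r10 : s₂.reg 10 = b := by rw [hag₂.reg 10 rfl]; simpa using h1
    have r12 : s₂.reg 12 = τ := by rw [hag₂.reg 12 rfl]; simp [hag.reg 12 rfl, h12]
    have r4 : s₂.reg 4 = 1 := by rw [hag₂.reg 4 rfl]; simp [hag.reg 4 rfl, h4]
    have d7 : s₂.arr 7 = s.arr 7 := by rw [hag₂.arr 7 rfl]; simp [hag.arr 7 rfl]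
    have d8 : s₂.arr 8 = s.arr 8 := by rw [hag₂.arr 8 rfl]; simp [hag.arr 8 rfl]
    have d10 : s₂.arr 10 = s.arr 10 := by rw [hag₂.arr 10 rfl]; simp [hag.arr 10 rfl]
    have d13 : s₂.arr 13 = s.arr 13 := by rw [hag₂.arr 13 rfl]; simp [hag.arr 13 rfl]
    have d15 : s₂.arr 15 = s₁.arr 15 := by rw [hag₂.arr 15 rfl]; simp
    have b9 : s₁.arr 9 = s.arr 9 := hag.arr 9 rfl
    simp only [Expr.eval, State.setReg_arr, State.setReg_reg_same, h1, b13, b9] at hI1 hI2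
    rw [b13] at h3 h5
    rw [wp_seq, wp_store, wp_assign]
    refine ⟨by simp only [Test.cost, Expr.cost]; omega, Or.inl ⟨by simp [r4], b, by simp [r10], ?_⟩⟩
    simp only [SearchAt, Expr.eval, State.setReg_arr, State.setArr_arr_same, ne_eq,
        Nat.reduceEqDiff, not_false_eq_true, State.setArr_arr_of_ne, d7, d8, d10, d13, d15, r10,
        r12]
    refine Search.step hS hcur hL hpar h2 h3 h4' h5 (fun h hh hh0 => (hI1 h hh hh0).1)
      (fun h hh hh0 => hI2 h hh hh0) (fun h hh hh0 => (hI1 h hh.le hh0).2) ?_ ?_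
    · rw [Function.update_self]
    · intro h _ hne
      rw [Function.update_of_ne (by exact_mod_cast hne)]

end

end Transversal

/-! ### The complete search, the augmentation and the running time of a phase -/

namespace Transversal

open RAM

section

variable {O : (ℤ → ℤ) → Prop} {n c τ cur : ℕ} {M : Matroid (Fin n)} {node : Fin n → ℕ} {s : State}

/-- Once `c + 1` nodes have been reached, the sink is among them; but the sink has label `0` unless
it was reached last. -/
theorem Search.cur_eq_zero {w rep π ord minv par : ℤ → ℤ} {Y : ℕ → ℕ → ℤ}
    (hS : Search M node w c rep Y (c + 1) cur π ord minv par) : cur = 0 := by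
  by_contra hcur
  have h0 := hS.ord_zero hcur
  have hall := (Finset.card_filter_eq_iff (s := Finset.range (c + 1))
    (p := fun g : ℕ => ord g ≠ 0)).1 (by rw [hS.card, Finset.card_range])
  exact hall 0 (by simp) (by simpa using h0)

theorem search_spec (hs : Ready node s) (hc : s.reg 5 = c) (hc1 : 1 ≤ c) (hcn : c ≤ n)
    (h4 : s.reg 4 = 1) (hT : IsTransversal M node c (s.arr 8))
    (hD : IsDual M node (s.arr 7) c (s.arr 8) (s.arr 9))
    (hY : IsBestArc M node (s.arr 7) c (s.arr 8) (fun g h => s.arr 10 (((g * n : ℕ) : ℤ) + h))) :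
    wp O search (fun t s' => t ≤ (c + 1) * (300 * (c + 1) + 100) ∧
      ((s'.reg 4 = 1 ∧ ∃ τ, SearchAt M node c τ 0 s') ∨
        (s'.reg 4 = 0 ∧ NoTransversal M node c))) s := by
  rw [search, wp_seq]
  refine (wp_forLoop 0 (c + 1) (fun m s' => ∀ h : ℕ, h < m → s'.arr 13 h = 0 ∧ s'.arr 15 h = -1)
    20 rfl (by simp) (by omega) (fun s' h' => ?_) ?_ ?_).agree.mono ?_
  · simp [h'.reg 5 rfl, hc]
  · exact fun _ h => by omega
  · rintro i s' _ hi hx hag hI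
    rw [wp_seq, wp_store, wp_store]
    refine ⟨by simp, fun h hh => ?_⟩
    simp only [Expr.eval, hx, State.setReg_arr, State.setArr_reg, State.setArr_arr_same, ne_eq,
      Nat.reduceEqDiff, not_false_eq_true, State.setArr_arr_of_ne]
    by_cases hhi : h = i
    · rw [hhi, Function.update_self, Function.update_self]
      exact ⟨rfl, rfl⟩
    · rw [Function.update_of_ne (by omega), Function.update_of_ne (by omega)]
      exact hI h (by omega)
  rintro t₁ s₁ ⟨⟨ht₁, -, hI⟩, hag⟩
  have r5 : s₁.reg 5 = c := by rw [hag.reg 5 rfl, hc]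
  rw [wp_seq, wp_store, wp_seq, wp_assign]
  -- The loop counter is the number of reached nodes until the sink is reached or the search fails;
  -- the remaining rounds do nothing.
  refine (wp_forLoop 1 (c + 1) (fun m s' =>
      (s'.reg 4 = 1 ∧ ∃ cur τ : ℕ, s'.reg 9 = cur ∧ SearchAt M node c τ cur s' ∧
        (cur = 0 ∨ τ = m)) ∨
      (s'.reg 4 = 0 ∧ NoTransversal M node c)) (300 * (c + 1) + 20) rfl (by simp) (by omega)
      (fun s' h' => ?_) ?_ ?_).mono ?_
  · simp [h'.reg 5 rfl, r5]
  · refine Or.inl ⟨by simp [hag.reg 4 rfl, h4], c, 1, by simp [r5], ?_, Or.inr rfl⟩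
    simp only [SearchAt, Expr.eval, State.setReg_arr, State.setArr_arr_same, ne_eq,
      Nat.reduceEqDiff, not_false_eq_true, State.setArr_arr_of_ne, r5, hag.arr 7 rfl,
      hag.arr 8 rfl, hag.arr 9 rfl, hag.arr 10 rfl]
    refine search_init hc1 hD (Function.update_self _ _ _) (fun h hh => ?_) (fun h hh => ?_)
    · rw [Function.update_of_ne (by omega)]
      exact (hI h (by omega)).1
    · exact (hI h (by omega)).2
  · rintro i s' hi1 hi hx hag' hJ
    have d7 : s'.arr 7 = s.arr 7 := by rw [hag'.arr 7 rfl]; simp [hag.arr 7 rfl]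
    have d8 : s'.arr 8 = s.arr 8 := by rw [hag'.arr 8 rfl]; simp [hag.arr 8 rfl]
    have d10 : s'.arr 10 = s.arr 10 := by rw [hag'.arr 10 rfl]; simp [hag.arr 10 rfl]
    have d11 : s'.arr 11 = s.arr 11 := by rw [hag'.arr 11 rfl]; simp [hag.arr 11 rfl]
    have d2 : s'.arr 2 = s.arr 2 := by rw [hag'.arr 2 rfl]; simp [hag.arr 2 rfl]
    have d0 : s'.reg 0 = s.reg 0 := by rw [hag'.reg 0 rfl]; simp [hag.reg 0 rfl]
    have d5 : s'.reg 5 = c := by rw [hag'.reg 5 rfl]; simp [r5]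
    rw [wp_ite]
    simp only [Test.Holds, Expr.eval]
    constructor
    · rintro ⟨hb1, hb2⟩
      obtain ⟨-, cur, τ, h9, hS, hτ⟩ : s'.reg 4 = 1 ∧ ∃ cur τ : ℕ, s'.reg 9 = cur ∧
          SearchAt M node c τ cur s' ∧ (cur = 0 ∨ τ = i) := by
        rcases hJ with h | ⟨h, -⟩
        · exact h
        · omega
      obtain rfl : τ = i := by
        rcases hτ with h | h
        · subst h; exact absurd h9 (by simpa using hb1)
        · exact h
      refine (searchStep_spec (M := M) (node := node) (n := n) (hs.of_eq d0 d11 d2 d7) d5 hc1 hcn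
        hb2 h9 hx (fun e => hb1 (by simp [h9, e])) (by rw [d8]; exact hT) hS
        (by rw [d7, d8, d10]; exact hY)).mono ?_
      rintro t s'' ⟨ht, hK⟩
      refine ⟨by simp only [Test.cost, Expr.cost]; omega, ?_⟩
      rcases hK with ⟨k4, b, k9, kS⟩ | ⟨k4, kN⟩
      · exact Or.inl ⟨by simpa using k4, b, τ + 1, by simpa using k9, kS, Or.inr rfl⟩
      · exact Or.inr ⟨by simpa using k4, kN⟩
    · intro hb
      rw [wp_skip]
      refine ⟨by simp, ?_⟩
      rcases hJ with ⟨k4, cur, τ, k9, kS, -⟩ | ⟨k4, kN⟩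
      · refine Or.inl ⟨by simpa using k4, cur, τ, by simpa using k9, kS, Or.inl ?_⟩
        by_contra hcur
        exact hb ⟨by rw [k9]; exact_mod_cast hcur, k4⟩
      · exact Or.inr ⟨by simpa using k4, kN⟩
  · rintro t₂ s₂ ⟨ht₂, -, hJ⟩
    refine ⟨?_, ?_⟩
    · simp only [Expr.cost, Nat.sub_zero, Nat.add_sub_cancel] at ht₁ ht₂ ⊢
      have h1 : (c + 1) * (300 * (c + 1) + 100) =
        c * (300 * (c + 1) + 20 + (1 + 1 + 1) + 8) + 69 * c + 300 * (c + 1) + 100 := by ring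
      have h2 : (c + 1) * (20 + (1 + 1 + 1) + 8) = 31 * c + 31 := by ring
      omega
    · rcases hJ with ⟨k4, cur, τ, k9, kS, hτ⟩ | h
      · refine Or.inl ⟨k4, τ, ?_⟩
        rcases hτ with rfl | rfl
        · exact kS
        · have := kS.cur_eq_zero
          rwa [this] at kS
      · exact Or.inr h

theorem walk_spec (hs : Ready node s) (hc : s.reg 5 = c) (hc1 : 1 ≤ c) (hcn : c ≤ n)
    (hnode : ∀ u, 1 ≤ node u) (hT : IsTransversal M node c (s.arr 8))
    (hS : SearchAt M node c τ 0 s) :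
    wp O walk (fun t s' => t ≤ 60 * (c + 1) ∧ IsTransversal M node (c + 1) (s'.arr 8) ∧
      IsDual M node (s.arr 7) (c + 1) (s'.arr 8) (s.arr 9)) s := by
  rw [walk, wp_seq, wp_assign]
  -- The sink has label at most `c + 1`, and each move lowers the label. So `c` rounds suffice to
  -- arrive at `c`.
  refine (wp_forLoop 0 c (fun m s' => ∃ (h : ℕ) (D : Finset ℕ), s'.reg 7 = h ∧
    Walk c (s.arr 8) (fun g h => s.arr 10 (((g * n : ℕ) : ℤ) + h)) (s.arr 13) (s.arr 15) h D
      (s'.arr 8) ∧ (h = c ∨ s.arr 13 h + m ≤ c + 1)) 40 rfl (by simp) (by omega)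
      (fun s' h' => ?_) ?_ ?_).mono ?_
  · rw [Expr.eval, h'.reg 5 rfl]; simpa using hc
  · refine ⟨0, ∅, by simp, Search.walk_init hS hc1, Or.inr ?_⟩
    have h1 : (τ : ℤ) ≤ c + 1 := by
      have := Finset.card_filter_le (Finset.range (c + 1)) fun g : ℕ => s.arr 13 g ≠ 0
      rw [hS.card, Finset.card_range] at this
      exact_mod_cast this
    have h2 := hS.ord_cur
    push_cast at h2 ⊢
    omega
  · rintro i s' _ hi hx hag ⟨h, D, h7, hW, hor⟩
    have d10 : s'.arr 10 = s.arr 10 := hag.arr 10 rfl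
    have d11 : s'.arr 11 = s.arr 11 := hag.arr 11 rfl
    have d15 : s'.arr 15 = s.arr 15 := hag.arr 15 rfl
    have d5 : s'.reg 5 = c := by rw [hag.reg 5 rfl]; simpa using hc
    rw [wp_ite]
    simp only [Test.Holds, Expr.eval, h7, d5, Nat.cast_inj]
    constructor
    · intro hne
      obtain ⟨g, g1, g2, g3, g4, g5, hW'⟩ := hS.walk_step hnode hW hne
      rw [wp_seq, wp_assign, wp_seq, wp_store, wp_assign]
      have hoff : s.arr 11 (g : ℤ) = ((g * n : ℕ) : ℤ) := hs.off g (by omega)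
      refine ⟨by simp, g, insert h D, by simp [h7, d15, g1], ?_, Or.inr ?_⟩
      · simp only [Expr.eval, State.setReg_reg_same, State.setReg_arr, State.setArr_arr_same,
          ne_eq, Nat.reduceEqDiff, not_false_eq_true, State.setReg_reg_of_ne, h7, d10, d11, d15,
          g1, hoff]
        exact hW'
      · rcases hor with h' | h'
        · exact absurd h' hne
        · push_cast
          omega
    · intro heq
      rw [wp_skip]
      exact ⟨by simp, h, D, by simpa using h7, hW, Or.inl (by simpa using heq)⟩
  · rintro t s' ⟨ht, -, h, D, h7, hW, hor⟩
    have hhc : h = c := by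
      rcases hor with h' | h'
      · exact h'
      · by_contra hne
        obtain ⟨g, -, -, -, g4, g5, -⟩ := hS.walk_step hnode hW hne
        omega
    subst hhc
    refine ⟨?_, Search.augment hT hS hs.weight hc1 hnode hW⟩
    simp only [Expr.cost] at ht ⊢
    omega

theorem phase_spec (hs : Ready node s) (hc : s.reg 5 = c) (hc1 : 1 ≤ c) (hcn : c ≤ n)
    (h4 : s.reg 4 = 1) (hnode : ∀ u, 1 ≤ node u) (hT : IsTransversal M node c (s.arr 8))
    (hD : IsDual M node (s.arr 7) c (s.arr 8) (s.arr 9)) :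
    wp (indepOracle M) phase (fun t s' => t ≤ 3000 * n ^ 2 ∧
      ((s'.reg 4 = 1 ∧ IsTransversal M node (c + 1) (s'.arr 8) ∧
        IsDual M node (s.arr 7) (c + 1) (s'.arr 8) (s'.arr 9)) ∨
      (s'.reg 4 = 0 ∧ NoTransversal M node c))) s := by
  rw [phase, wp_seq]
  refine (buildInd_spec (M := M) (node := node) hs.reg_n hc hc1 hT).agree.mono ?_
  rintro t₁ s₁ ⟨⟨ht₁, hind⟩, hag₁⟩
  have a7 : s₁.arr 7 = s.arr 7 := hag₁.arr 7 rfl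
  have a8 : s₁.arr 8 = s.arr 8 := hag₁.arr 8 rfl
  have a9 : s₁.arr 9 = s.arr 9 := hag₁.arr 9 rfl
  have hs₁ : Ready node s₁ := hs.of_eq (hag₁.reg 0 rfl) (hag₁.arr 11 rfl) (hag₁.arr 2 rfl) a7
  have r5 : s₁.reg 5 = c := by rw [hag₁.reg 5 rfl, hc]
  rw [wp_seq]
  refine (fillMatrix_spec (M := M) hs₁ r5 hcn (by rw [a8]; exact hT) hnode
    (fun u => by rw [a8]; exact hind u)).agree.mono ?_
  rintro t₂ s₂ ⟨⟨ht₂, hY⟩, hag₂⟩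
  have b7 : s₂.arr 7 = s.arr 7 := by rw [hag₂.arr 7 rfl, a7]
  have b8 : s₂.arr 8 = s.arr 8 := by rw [hag₂.arr 8 rfl, a8]
  have b9 : s₂.arr 9 = s.arr 9 := by rw [hag₂.arr 9 rfl, a9]
  have hs₂ : Ready node s₂ := hs₁.of_eq (hag₂.reg 0 rfl) (hag₂.arr 11 rfl) (hag₂.arr 2 rfl)
    (hag₂.arr 7 rfl)
  have q5 : s₂.reg 5 = c := by rw [hag₂.reg 5 rfl, r5]
  have q4 : s₂.reg 4 = 1 := by rw [hag₂.reg 4 rfl, hag₁.reg 4 rfl, h4]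
  rw [wp_seq]
  refine (search_spec (M := M) hs₂ q5 hc1 hcn q4 (by rw [b8]; exact hT)
    (by rw [b7, b8, b9]; exact hD) (by rw [b7, b8]; rw [a7, a8] at hY; exact hY)).agree.mono ?_
  rintro t₃ s₃ ⟨⟨ht₃, hres⟩, hag₃⟩
  have c7 : s₃.arr 7 = s.arr 7 := by rw [hag₃.arr 7 rfl, b7]
  have c8 : s₃.arr 8 = s.arr 8 := by rw [hag₃.arr 8 rfl, b8]
  have hs₃ : Ready node s₃ := hs₂.of_eq (hag₃.reg 0 rfl) (hag₃.arr 11 rfl) (hag₃.arr 2 rfl)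
    (hag₃.arr 7 rfl)
  have p5 : s₃.reg 5 = c := by rw [hag₃.reg 5 rfl, q5]
  have hn1 : 1 ≤ n := by omega
  -- By `c ≤ n` the four contributions of order `n + c`, `c n`, `c²` and `c` are all of order `n²`;
  -- `1 ≤ n` absorbs the lower terms.
  have htime : ∀ t : ℕ, t ≤ 60 * (c + 1) + 10 → t₁ + (t₂ + (t₃ + t)) ≤ 3000 * n ^ 2 := by
    intro t ht
    have e1 : n ≤ n ^ 2 := by nlinarith
    have e2 : c * (200 * (n + 1) + 9) ≤ n * (200 * (n + 1) + 9) := Nat.mul_le_mul_right _ hcn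
    have e3 : (c + 1) * (300 * (c + 1) + 100) ≤ (n + 1) * (300 * (n + 1) + 100) :=
      Nat.mul_le_mul (by omega) (by omega)
    have e4 : n * (200 * (n + 1) + 9) = 200 * n ^ 2 + 209 * n := by ring
    have e5 : (n + 1) * (300 * (n + 1) + 100) = 300 * n ^ 2 + 700 * n + 400 := by ring
    omega
  rw [wp_ite]
  simp only [Test.Holds, Expr.eval]
  constructor
  · intro hb
    obtain ⟨-, τ, hS⟩ : s₃.reg 4 = 1 ∧ ∃ τ, SearchAt M node c τ 0 s₃ := by
      rcases hres with h | ⟨h, -⟩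
      · exact h
      · omega
    refine (walk_spec (M := M) hs₃ p5 hc1 hcn hnode (by rw [c8]; exact hT) hS).agree.mono ?_
    rintro t₄ s₄ ⟨⟨ht₄, hT', hD'⟩, hag₄⟩
    refine ⟨htime _ (by simp only [Test.cost, Expr.cost]; omega), Or.inl ⟨?_, hT', ?_⟩⟩
    · rw [hag₄.reg 4 rfl, hb]
    · rw [hag₄.arr 9 rfl, ← c7]; exact hD'
  · intro hb
    rw [wp_skip]
    refine ⟨htime _ (by simp only [Test.cost, Expr.cost]; omega), Or.inr ?_⟩
    rcases hres with ⟨h, -⟩ | h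
    · exact absurd h hb
    · exact h

end

end Transversal

/-! ### The reduction to weighted matroid intersection -/

namespace UFLPMCC

variable {n k ℓ : ℕ} (I : UFLPMCC n k ℓ)

/-- The color of an element, counted from `1`. -/
def node (u : Fin n) : ℕ := (I.col u : ℕ) + 1

theorem one_le_node (u : Fin n) : 1 ≤ I.node u := Nat.succ_pos _

theorem col_eq_castAdd_iff {u : Fin n} {i : Fin ℓ} :
    I.col u = Fin.castAdd k i ↔ I.node u = i + 1 := by
  rw [Fin.ext_iff, node, Fin.val_castAdd]
  omega

theorem exists_col_eq_castAdd_iff {u : Fin n} :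
    (∃ i : Fin ℓ, I.col u = Fin.castAdd k i) ↔ I.node u < ℓ + 1 := by
  simp only [col_eq_castAdd_iff]
  have := I.one_le_node u
  constructor
  · rintro ⟨i, hi⟩
    have := i.2
    omega
  · exact fun h => ⟨⟨I.node u - 1, by omega⟩, by simp only; omega⟩

theorem castAdd_ne_natAdd (i : Fin ℓ) (j : Fin k) : Fin.castAdd k i ≠ Fin.natAdd ℓ j := by
  intro e
  have := congrArg Fin.val e
  simp only [Fin.val_castAdd, Fin.val_natAdd] at this
  have := i.2
  omega

theorem bijOn_node_iff {A : Finset (Fin n)} :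
    Set.BijOn I.node A (Finset.Ico 1 (ℓ + 1)) ↔
      (∀ u ∈ A, ∃ i : Fin ℓ, I.col u = Fin.castAdd k i) ∧
        ∀ i : Fin ℓ, ∃! u, u ∈ A ∧ I.col u = Fin.castAdd k i := by
  constructor
  · intro h
    refine ⟨fun u hu => ?_, fun i => ?_⟩
    · rw [exists_col_eq_castAdd_iff]
      exact (Finset.mem_Ico.1 (by simpa using h.mapsTo hu)).2
    · obtain ⟨u, hu, hi⟩ := h.surjOn (show (i : ℕ) + 1 ∈ (Finset.Ico 1 (ℓ + 1) : Set ℕ) by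
        have := i.2; simp)
      refine ⟨u, ⟨hu, I.col_eq_castAdd_iff.2 hi⟩, fun v hv => ?_⟩
      exact h.injOn hv.1 hu ((I.col_eq_castAdd_iff.1 hv.2).trans hi.symm)
  · rintro ⟨h₁, h₂⟩
    refine ⟨fun u hu => ?_, fun u hu v hv huv => ?_, fun g hg => ?_⟩
    · have := I.exists_col_eq_castAdd_iff.1 (h₁ u hu)
      simpa using ⟨I.one_le_node u, by omega⟩
    · obtain ⟨i, hi⟩ := h₁ u hu
      have hi' : I.col v = Fin.castAdd k i :=
        I.col_eq_castAdd_iff.2 (huv.symm.trans (I.col_eq_castAdd_iff.1 hi))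
      exact (h₂ i).unique ⟨hu, hi⟩ ⟨hv, hi'⟩
    · have hg' := Finset.mem_Ico.1 (Finset.mem_coe.1 hg)
      obtain ⟨u, ⟨hu, hui⟩, -⟩ := h₂ ⟨g - 1, by omega⟩
      refine ⟨u, hu, ?_⟩
      rw [I.col_eq_castAdd_iff.1 hui]
      simp only
      omega

theorem partitionMatroid_indep_iff {A : Finset (Fin n)} :
    I.partitionMatroid.Indep (A : Set (Fin n)) ↔
      (∀ u ∈ A, u ∈ I.facility.E ∧ ∃ i : Fin ℓ, I.col u = Fin.castAdd k i) ∧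
        Set.InjOn I.node A := by
  have hmem : ∀ (i : Fin ℓ) (u : Fin n),
      u ∈ I.facilityClass i ↔ u ∈ I.facility.E ∧ I.col u = Fin.castAdd k i := by
    intro i u
    simp [facilityClass]
  have hunif : ∀ i : Fin ℓ, (uniformMatroid (I.facilityClass i) 1).Indep
      ((A : Set (Fin n)) ∩ (uniformMatroid (I.facilityClass i) 1).E) ↔
        (A ∩ I.facilityClass i).card ≤ 1 := by
    intro i
    rw [uniformMatroid_ground, ← Finset.coe_inter, uniformMatroid_indep_iff]
    exact ⟨fun h => h.2, fun h => ⟨Finset.inter_subset_right, h⟩⟩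
  rw [partitionMatroid, Matroid.disjointSigma_indep_iff]
  rw [forall_congr' hunif]
  simp only [Finset.card_le_one, Finset.mem_inter, hmem, uniformMatroid_ground]
  constructor
  · rintro ⟨h₁, h₂⟩
    have h₃ : ∀ u ∈ A, ∃ i : Fin ℓ, u ∈ I.facility.E ∧ I.col u = Fin.castAdd k i := by
      intro u hu
      have := h₂ hu
      simp only [Set.mem_iUnion, Finset.mem_coe, hmem] at this
      exact this
    refine ⟨fun u hu => ?_, fun u hu v hv huv => ?_⟩
    · obtain ⟨i, hi, hi'⟩ := h₃ u hu
      exact ⟨hi, i, hi'⟩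
    · obtain ⟨i, hi⟩ := h₃ u hu
      obtain ⟨i', hi'⟩ := h₃ v hv
      have e : i = i' := by
        have h1 := I.col_eq_castAdd_iff.1 hi.2
        have h2 := I.col_eq_castAdd_iff.1 hi'.2
        exact Fin.ext (by omega)
      subst e
      exact h₁ i u ⟨hu, hi⟩ v ⟨hv, hi'⟩
  · rintro ⟨h₁, h₂⟩
    refine ⟨fun i u hu v hv => ?_, fun u hu => ?_⟩
    · exact h₂ hu.1 hv.1 ((I.col_eq_castAdd_iff.1 hu.2.2).trans
        (I.col_eq_castAdd_iff.1 hv.2.2).symm)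
    · obtain ⟨hE, i, hi⟩ := h₁ u hu
      simp only [Set.mem_iUnion, Finset.mem_coe, hmem]
      exact ⟨i, hE, hi⟩

/-- At most one element of each facility color and `ℓ` elements in all force exactly one of each
color. This turns the intersection problem into a transversal problem. -/
theorem commonIndep_iff {A : Finset (Fin n)} :
    I.CommonIndep A ↔ I.facility.Indep (A : Set (Fin n)) ∧
      Set.BijOn I.node A (Finset.Ico 1 (ℓ + 1)) := by
  classical
  rw [CommonIndep, partitionMatroid_indep_iff]
  constructor
  · rintro ⟨hcard, hA, h₁, h₂⟩
    refine ⟨hA, ?_⟩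
    have hsub : A.image I.node ⊆ Finset.Ico 1 (ℓ + 1) := by
      intro g hg
      obtain ⟨u, hu, rfl⟩ := Finset.mem_image.1 hg
      exact Finset.mem_Ico.2 ⟨I.one_le_node u, I.exists_col_eq_castAdd_iff.1 (h₁ u hu).2⟩
    have himg := Finset.eq_of_subset_of_card_le hsub
      (by rw [Finset.card_image_of_injOn h₂, hcard, Nat.card_Ico]; omega)
    rw [← himg, Finset.coe_image]
    exact h₂.bijOn_image
  · rintro ⟨hA, hbij⟩
    refine ⟨?_, hA, fun u hu => ⟨hA.subset_ground hu, (I.bijOn_node_iff.1 hbij).1 u hu⟩,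
      hbij.injOn⟩
    have himg : A.image I.node = Finset.Ico 1 (ℓ + 1) := by
      have := hbij.image_eq
      rw [← Finset.coe_image] at this
      exact_mod_cast this
    rw [← Finset.card_image_of_injOn hbij.injOn, himg, Nat.card_Ico]
    omega

/-- The client colors that are served from `u`. -/
def served (u : Fin n) : Finset (Fin k) :=
  Finset.univ.filter fun j => ∃ i : Fin ℓ, I.col u = Fin.castAdd k i ∧ Fin.natAdd ℓ j ∈ I.Z i

theorem mem_served {u : Fin n} {j : Fin k} :
    j ∈ I.served u ↔ ∃ i : Fin ℓ, I.col u = Fin.castAdd k i ∧ Fin.natAdd ℓ j ∈ I.Z i := by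
  simp [served]

theorem exists_of_mem_Z {i : Fin ℓ} {c : Fin (ℓ + k)} (h : c ∈ I.Z i) :
    ∃ j : Fin k, Fin.natAdd ℓ j = c := by
  have : c ∈ Finset.univ.biUnion I.Z := Finset.mem_biUnion.2 ⟨i, Finset.mem_univ _, h⟩
  rw [I.Z_union] at this
  obtain ⟨j, -, hj⟩ := Finset.mem_image.1 this
  exact ⟨j, hj⟩

theorem exists_mem_Z (j : Fin k) : ∃ i : Fin ℓ, Fin.natAdd ℓ j ∈ I.Z i := by
  have : Fin.natAdd ℓ j ∈ Finset.univ.biUnion I.Z := by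
    rw [I.Z_union]
    exact Finset.mem_image_of_mem _ (Finset.mem_univ _)
  obtain ⟨i, -, hi⟩ := Finset.mem_biUnion.1 this
  exact ⟨i, hi⟩

theorem eq_of_mem_Z {i i' : Fin ℓ} {c : Fin (ℓ + k)} (h : c ∈ I.Z i) (h' : c ∈ I.Z i') :
    i = i' := by
  by_contra hne
  exact Finset.disjoint_left.1 (I.Z_disjoint i i' hne) h h'

theorem weight_eq (u : Fin n) :
    I.weight u = -(I.cost u : ℤ) + ∑ j ∈ I.served u,
      (((I.V.filter fun v => I.col v = Fin.natAdd ℓ j).sup (I.profit u) : ℕ) : ℤ) := by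
  rw [weight]
  congr 1
  symm
  refine Finset.sum_bij (fun j _ => Fin.natAdd ℓ j) ?_ ?_ ?_ ?_
  · intro j hj
    rw [mem_served] at hj
    simpa using hj
  · intro j _ j' _ h
    exact Fin.natAdd_injective _ _ h
  · intro c hc
    simp only [Finset.mem_filter, Finset.mem_univ, true_and] at hc
    obtain ⟨i, hi, hc⟩ := hc
    obtain ⟨j, rfl⟩ := I.exists_of_mem_Z hc
    exact ⟨j, I.mem_served.2 ⟨i, hi, hc⟩, rfl⟩
  · exact fun _ _ => rfl

/-- `C` may also contain elements of facility colors, but `Zset u` contains only elements of client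
colors, so only the chosen clients `v j` count. -/
theorem sum_inter_Zset {C : Finset (Fin n)} {v : Fin k → Fin n} (hv : ∀ j, v j ∈ C)
    (hcol : ∀ j, I.col (v j) = Fin.natAdd ℓ j)
    (huniq : ∀ j, ∀ x ∈ C, I.col x = Fin.natAdd ℓ j → x = v j) (u : Fin n) :
    ∑ x ∈ C ∩ I.Zset u, (I.profit u x : ℤ) = ∑ j ∈ I.served u, (I.profit u (v j) : ℤ) := by
  symm
  refine Finset.sum_bij (fun j _ => v j) ?_ ?_ ?_ ?_
  · intro j hj
    obtain ⟨i, hi, hZ⟩ := I.mem_served.1 hj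
    simp only [Finset.mem_inter, Zset, Finset.mem_filter, Finset.mem_univ, true_and]
    exact ⟨hv j, i, hi, by rw [hcol]; exact hZ⟩
  · intro j _ j' _ h
    have : I.col (v j) = I.col (v j') := congrArg I.col h
    rw [hcol, hcol] at this
    exact Fin.natAdd_injective _ _ this
  · intro x hx
    simp only [Finset.mem_inter, Zset, Finset.mem_filter, Finset.mem_univ, true_and] at hx
    obtain ⟨hxC, i, hi, hZ⟩ := hx
    obtain ⟨j, hj⟩ := I.exists_of_mem_Z hZ
    exact ⟨j, I.mem_served.2 ⟨i, hi, by rw [hj]; exact hZ⟩, (huniq j x hxC hj.symm).symm⟩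
  · exact fun _ _ => rfl

theorem Feasible.exists_clients {I : UFLPMCC n k ℓ} {A C : Finset (Fin n)} (h : I.Feasible A C) :
    ∃ v : Fin k → Fin n, (∀ j, v j ∈ C) ∧ (∀ j, I.col (v j) = Fin.natAdd ℓ j) ∧
      ∀ j, ∀ x ∈ C, I.col x = Fin.natAdd ℓ j → x = v j := by
  choose v hv huniq using h.client_colors
  exact ⟨v, fun j => (hv j).1, fun j => (hv j).2, fun j x hx hc => huniq j x ⟨hx, hc⟩⟩

theorem Feasible.subset_V {I : UFLPMCC n k ℓ} {A C : Finset (Fin n)} (h : I.Feasible A C) :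
    C ⊆ I.V ∧ C.card ≤ I.r := (uniformMatroid_indep_iff _ _ _).1 h.client_indep

/-- The elements of `A` with facility colors. -/
def facilities (A : Finset (Fin n)) : Finset (Fin n) := A.filter fun u => I.node u < ℓ + 1

theorem mem_facilities {A : Finset (Fin n)} {u : Fin n} :
    u ∈ I.facilities A ↔ u ∈ A ∧ ∃ i : Fin ℓ, I.col u = Fin.castAdd k i := by
  rw [facilities, Finset.mem_filter, exists_col_eq_castAdd_iff]

/-- Feasibility fixes the number of elements of `A` for facility colors only. Elements of client
colors would violate independence in the partition matroid, hence the restriction. -/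
theorem Feasible.commonIndep_facilities {I : UFLPMCC n k ℓ} {A C : Finset (Fin n)}
    (h : I.Feasible A C) : I.CommonIndep (I.facilities A) := by
  rw [commonIndep_iff, bijOn_node_iff]
  refine ⟨h.facility_indep.subset (Finset.coe_subset.2 (Finset.filter_subset _ _)),
    fun u hu => (I.mem_facilities.1 hu).2, fun i => ?_⟩
  obtain ⟨u, ⟨hu, hi⟩, huniq⟩ := h.facility_colors i
  exact ⟨u, ⟨I.mem_facilities.2 ⟨hu, i, hi⟩, hi⟩,
    fun x hx => huniq x ⟨(I.mem_facilities.1 hx.1).1, hx.2⟩⟩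

theorem Feasible.servable {I : UFLPMCC n k ℓ} {A C : Finset (Fin n)} (h : I.Feasible A C) :
    I.Servable := by
  obtain ⟨v, hv, hcol, -⟩ := h.exists_clients
  refine ⟨?_, fun j => ⟨v j, h.subset_V.1 (hv j), hcol j⟩⟩
  have hinj : Function.Injective v := fun j j' e => Fin.natAdd_injective _ _
    ((hcol j).symm.trans ((congrArg I.col e).trans (hcol j')))
  calc k = (Finset.univ.image v).card := by
        rw [Finset.card_image_of_injective _ hinj, Finset.card_univ, Fintype.card_fin]
    _ ≤ C.card := Finset.card_le_card fun x hx => by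
        obtain ⟨j, -, rfl⟩ := Finset.mem_image.1 hx
        exact hv j
    _ ≤ I.r := h.subset_V.2

/-- A facility earns at most the maximum for each color it serves. An element of `A` with a client
color serves nobody and contributes `-cost ≤ 0`. -/
theorem Feasible.value_le {I : UFLPMCC n k ℓ} {A C : Finset (Fin n)} (h : I.Feasible A C) :
    I.value A C ≤ ∑ u ∈ I.facilities A, I.weight u := by
  obtain ⟨v, hv, hcol, huniq⟩ := h.exists_clients
  rw [value, facilities, Finset.sum_filter]
  refine Finset.sum_le_sum fun u _ => ?_
  rw [I.sum_inter_Zset hv hcol huniq]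
  split_ifs with hu
  · rw [weight_eq]
    gcongr with j hj
    exact Finset.le_sup (f := I.profit u)
      (Finset.mem_filter.2 ⟨h.subset_V.1 (hv j), hcol j⟩)
  · rw [← exists_col_eq_castAdd_iff] at hu
    have : I.served u = ∅ := by
      rw [Finset.eq_empty_iff_forall_notMem]
      intro j hj
      obtain ⟨i, hi, -⟩ := I.mem_served.1 hj
      exact hu ⟨i, hi⟩
    rw [this, Finset.sum_empty]
    omega

/-- `v j` is a client of color `j` of maximum profit for the elements of `A` that serve `j`. -/
structure IsBestClients (A : Finset (Fin n)) (v : Fin k → Fin n) : Prop where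
  mem : ∀ j, v j ∈ I.V
  col : ∀ j, I.col (v j) = Fin.natAdd ℓ j
  le : ∀ j, ∀ u ∈ A, j ∈ I.served u → ∀ x ∈ I.V, I.col x = Fin.natAdd ℓ j →
    I.profit u x ≤ I.profit u (v j)

/-- The color `j` lies in one part only, and `A` has one element of the corresponding facility
color; a maximizer for this element satisfies the condition for all `u`. -/
theorem CommonIndep.exists_isBestClients {I : UFLPMCC n k ℓ} {A : Finset (Fin n)}
    (hA : I.CommonIndep A) (hs : I.Servable) : ∃ v, I.IsBestClients A v := by
  have hbij := I.bijOn_node_iff.1 (I.commonIndep_iff.1 hA).2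
  have : ∀ j : Fin k, ∃ x : Fin n, x ∈ I.V ∧ I.col x = Fin.natAdd ℓ j ∧ ∀ u ∈ A,
      j ∈ I.served u → ∀ y ∈ I.V, I.col y = Fin.natAdd ℓ j → I.profit u y ≤ I.profit u x := by
    intro j
    obtain ⟨i, hi⟩ := I.exists_mem_Z j
    obtain ⟨u, -, huniq⟩ := hbij.2 i
    obtain ⟨z, hzV, hz⟩ := hs.2 j
    obtain ⟨x, hx, hmax⟩ := Finset.exists_max_image
      (I.V.filter fun y => I.col y = Fin.natAdd ℓ j) (I.profit u)
      ⟨z, Finset.mem_filter.2 ⟨hzV, hz⟩⟩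
    rw [Finset.mem_filter] at hx
    refine ⟨x, hx.1, hx.2, fun u' hu' hj y hy hcy => ?_⟩
    obtain ⟨i', hi', hZ⟩ := I.mem_served.1 hj
    rw [← I.eq_of_mem_Z hi hZ] at hi'
    rw [huniq u' ⟨hu', hi'⟩]
    exact hmax y (Finset.mem_filter.2 ⟨hy, hcy⟩)
  choose v h₁ h₂ h₃ using this
  exact ⟨v, h₁, h₂, h₃⟩

theorem CommonIndep.feasible {I : UFLPMCC n k ℓ} {A : Finset (Fin n)} (hA : I.CommonIndep A)
    (hr : k ≤ I.r) {v : Fin k → Fin n} (hv : I.IsBestClients A v) :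
    I.Feasible A (Finset.univ.image v) := by
  obtain ⟨hi, hbij⟩ := I.commonIndep_iff.1 hA
  obtain ⟨h₁, h₂⟩ := I.bijOn_node_iff.1 hbij
  refine ⟨?_, h₂, fun j => ?_, hi, ?_⟩
  · rw [Finset.disjoint_left]
    intro u hu huC
    obtain ⟨i, hi⟩ := h₁ u hu
    obtain ⟨j, -, rfl⟩ := Finset.mem_image.1 huC
    rw [hv.col] at hi
    exact castAdd_ne_natAdd i j hi.symm
  · refine ⟨v j, ⟨Finset.mem_image_of_mem _ (Finset.mem_univ _), hv.col j⟩, ?_⟩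
    rintro x ⟨hx, hc⟩
    obtain ⟨j', -, rfl⟩ := Finset.mem_image.1 hx
    rw [hv.col] at hc
    rw [Fin.natAdd_injective _ _ hc]
  · refine (uniformMatroid_indep_iff _ _ _).2 ⟨fun x hx => ?_, ?_⟩
    · obtain ⟨j, -, rfl⟩ := Finset.mem_image.1 hx
      exact hv.mem j
    · exact Finset.card_image_le.trans (by simpa using hr)

theorem IsBestClients.value_eq {I : UFLPMCC n k ℓ} {A : Finset (Fin n)} {v : Fin k → Fin n}
    (hv : I.IsBestClients A v) :
    I.value A (Finset.univ.image v) = ∑ u ∈ A, I.weight u := by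
  rw [value]
  refine Finset.sum_congr rfl fun u hu => ?_
  rw [I.sum_inter_Zset (fun j => Finset.mem_image_of_mem v (Finset.mem_univ j)) hv.col, weight_eq]
  · congr 1
    refine Finset.sum_congr rfl fun j hj => ?_
    congr 1
    refine le_antisymm (Finset.le_sup (f := I.profit u)
      (Finset.mem_filter.2 ⟨hv.mem j, hv.col j⟩)) (Finset.sup_le fun x hx => ?_)
    rw [Finset.mem_filter] at hx
    exact hv.le j u hu hj x hx.1 hx.2
  · intro j x hx hc
    obtain ⟨j', -, rfl⟩ := Finset.mem_image.1 hx
    rw [hv.col] at hc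
    rw [Fin.natAdd_injective _ _ hc]

theorem MaxWeightCommonIndep.optimal {I : UFLPMCC n k ℓ} {A : Finset (Fin n)}
    (hA : I.MaxWeightCommonIndep A) (hr : k ≤ I.r) {v : Fin k → Fin n}
    (hv : I.IsBestClients A v) : I.Optimal A (Finset.univ.image v) := by
  refine ⟨hA.1.feasible hr hv, fun A' C' h => ?_⟩
  rw [hv.value_eq]
  exact h.value_le.trans (hA.2 _ h.commonIndep_facilities)

theorem exists_feasible_iff :
    (∃ A C, I.Feasible A C) ↔ I.Servable ∧ ∃ A, I.CommonIndep A := by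
  constructor
  · rintro ⟨A, C, h⟩
    exact ⟨h.servable, _, h.commonIndep_facilities⟩
  · rintro ⟨hs, A, hA⟩
    obtain ⟨v, hv⟩ := hA.exists_isBestClients hs
    exact ⟨A, _, hA.feasible hs.1 hv⟩

/-- The color condition is needed because an optimal `A` can contain elements of client colors that
cost nothing. For the converse, any competitor `B` is completed by best clients to a feasible
solution of value `w(B)`. -/
theorem maxWeightCommonIndep_iff (hs : I.Servable) (A : Finset (Fin n)) :
    I.MaxWeightCommonIndep A ↔
      (∃ C, I.Optimal A C) ∧ ∀ u ∈ A, ∃ i : Fin ℓ, I.col u = Fin.castAdd k i := by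
  constructor
  · intro hA
    obtain ⟨v, hv⟩ := hA.1.exists_isBestClients hs
    exact ⟨⟨_, hA.optimal hs.1 hv⟩, (I.bijOn_node_iff.1 (I.commonIndep_iff.1 hA.1).2).1⟩
  · rintro ⟨⟨C, hC, hopt⟩, hcol⟩
    have hfac : I.facilities A = A := by
      ext u
      rw [mem_facilities]
      exact ⟨fun h => h.1, fun h => ⟨h, hcol u h⟩⟩
    refine ⟨hfac ▸ hC.commonIndep_facilities, fun B hB => ?_⟩
    obtain ⟨v, hv⟩ := hB.exists_isBestClients hs
    rw [← hv.value_eq]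
    refine (hopt _ _ (hB.feasible hs.1 hv)).trans ?_
    have := hC.value_le
    rwa [hfac] at this

end UFLPMCC

/-! ### Preprocessing -/

namespace UFLPMCC

open RAM Transversal

/-- Compare the client in register `8` with the best client of its color for the facility in
register `6`. -/
def tryClient : Prog :=
  .ite (.and (.eq (.get 4 (.var 8)) (.lit 1)) (.not (.lt (.get 2 (.var 8)) (.var 2))))
    (.seq (.assign 13 (.add (.get 11 (.var 6)) (.sub (.get 2 (.var 8)) (.var 2))))
    (.ite (.or (.lt (.get 12 (.var 13)) (.lit 0))
        (.lt (.get 0 (.add (.get 11 (.var 6)) (.get 12 (.var 13))))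
          (.get 0 (.add (.get 11 (.var 6)) (.var 8)))))
      (.store 12 (.var 13) (.var 8)) .skip))
    .skip

/-- The best clients of all colors for the facility in register `6`. -/
def clientRow : Prog :=
  .seq (.forLoop 7 (.lit 0) (.var 1)
    (.store 12 (.add (.get 11 (.var 6)) (.var 7)) (.lit (-1))))
  (.forLoop 8 (.lit 0) (.var 0) tryClient)

/-- The weight of the facility in register `6`. -/
def facilityWeight : Prog :=
  .seq (.store 7 (.var 6) (.sub (.lit 0) (.get 1 (.var 6))))
  (.forLoop 7 (.lit 0) (.var 1)
    (.ite (.eq (.get 3 (.var 7)) (.get 2 (.var 6)))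
      (.store 7 (.var 6) (.add (.get 7 (.var 6))
        (.get 0 (.add (.get 11 (.var 6)) (.get 12 (.add (.get 11 (.var 6)) (.var 7)))))))
      .skip))

/-- The best clients and the weights of all facilities. -/
def prepare : Prog := .forLoop 6 (.lit 0) (.var 0) (.seq clientRow facilityWeight)

/-- Register `4` becomes `1` if every client color occurs in the client matroid, and `0`
otherwise. -/
def checkClients : Prog :=
  .seq (.assign 4 (.lit 1))
    (.forLoop 7 (.lit 0) (.var 1)
      (.ite (.lt (.get 12 (.var 7)) (.lit 0)) (.assign 4 (.lit 0)) .skip))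

variable {O : (ℤ → ℤ) → Prop} {n k ℓ : ℕ} {I : UFLPMCC n k ℓ} {s : State}

theorem Loaded.of_eq {s' : State} (h : I.Loaded s) (hr : ∀ x ≤ 3, s'.reg x = s.reg x)
    (ha : ∀ a ≤ 4, s'.arr a = s.arr a) : I.Loaded s' where
  reg_n := by rw [hr 0 (by norm_num), h.reg_n]
  reg_k := by rw [hr 1 (by norm_num), h.reg_k]
  reg_ℓ := by rw [hr 2 (by norm_num), h.reg_ℓ]
  reg_r := by rw [hr 3 (by norm_num), h.reg_r]
  arr_profit := by rw [ha 0 (by norm_num)]; exact h.arr_profit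
  arr_cost := by rw [ha 1 (by norm_num)]; exact h.arr_cost
  arr_col := by rw [ha 2 (by norm_num)]; exact h.arr_col
  arr_part := by rw [ha 3 (by norm_num)]; exact h.arr_part
  arr_V := by rw [ha 4 (by norm_num)]; exact h.arr_V

/-- `P` does not change the input. -/
def KeepsInput (P : Prog) : Prop :=
  (∀ x ≤ 3, P.writesReg x = false) ∧ ∀ a ≤ 4, P.writesArr a = false

instance (P : Prog) : Decidable (KeepsInput P) := by unfold KeepsInput; infer_instance

theorem Loaded.agree {P : Prog} {s' : State} (h : I.Loaded s) (hag : Agree P s s')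
    (hP : KeepsInput P) : I.Loaded s' :=
  h.of_eq (fun x hx => hag.reg x (hP.1 x hx)) (fun a ha => hag.arr a (hP.2 a ha))

theorem Loaded.setArr (h : I.Loaded s) {a : ℕ} (ha : 4 < a) (i z : ℤ) :
    I.Loaded (s.setArr a i z) :=
  h.of_eq (fun _ _ => rfl) (fun b hb => State.setArr_arr_of_ne _ _ _ _ _ (by omega))

/-- Array `11` contains the multiples of `n`. -/
def Offsets (n : ℕ) (s : State) : Prop :=
  ∀ i : ℕ, i ≤ n → s.arr 11 (i : ℤ) = ((i * n : ℕ) : ℤ)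

/-- `v` is a client of color `j`. -/
def IsClient (I : UFLPMCC n k ℓ) (j : Fin k) (v : Fin n) : Prop :=
  v ∈ I.V ∧ I.col v = Fin.natAdd ℓ j

/-- Row `u` of array `12` contains the best clients for `u`. -/
def BestClientRow (I : UFLPMCC n k ℓ) (u : Fin n) (s : State) : Prop :=
  ∀ j : Fin k, IsArgmax (I.IsClient j) (fun z => s.arr 0 ((((u : ℕ) * n : ℕ) : ℤ) + z))
    (s.arr 12 ((((u : ℕ) * n : ℕ) : ℤ) + (j : ℕ)))

/-- `k ≤ n` allows client colors, counted from `0`, to be column indices in rows of length `n`. -/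
theorem tryClient_spec (hk : k ≤ n) (hL : I.Loaded s) (hoff : Offsets n s) {u : Fin n}
    (h6 : s.reg 6 = (u : ℕ)) {i : ℕ} (hi : i < n) (h8 : s.reg 8 = i)
    (hrow : ∀ j : Fin k, IsArgmax (fun v : Fin n => (v : ℕ) < i ∧ I.IsClient j v)
      (fun z => s.arr 0 ((((u : ℕ) * n : ℕ) : ℤ) + z))
      (s.arr 12 ((((u : ℕ) * n : ℕ) : ℤ) + (j : ℕ)))) :
    wp O tryClient (fun t s' => t ≤ 80 ∧
      (∀ j : Fin k, IsArgmax (fun v : Fin n => (v : ℕ) < i + 1 ∧ I.IsClient j v)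
        (fun z => s.arr 0 ((((u : ℕ) * n : ℕ) : ℤ) + z))
        (s'.arr 12 ((((u : ℕ) * n : ℕ) : ℤ) + (j : ℕ)))) ∧
      ∀ g h : ℕ, g ≠ u → h < n →
        s'.arr 12 (((g * n : ℕ) : ℤ) + h) = s.arr 12 (((g * n : ℕ) : ℤ) + h)) s := by
  classical
  set y : Fin n := ⟨i, hi⟩ with hy
  have hV := hL.arr_V y
  have hcol := hL.arr_col y
  have hoffu := hoff u u.2.le
  simp only [hy] at hV hcol
  rw [← hy] at hV hcol
  have hlt : ∀ z : Fin n, (z : ℕ) < i + 1 ↔ (z : ℕ) < i ∨ z = y := by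
    intro z
    rw [Fin.ext_iff]
    simp only [hy]
    omega
  have hskip : ∀ j : Fin k, ¬ I.IsClient j y →
      IsArgmax (fun v : Fin n => (v : ℕ) < i + 1 ∧ I.IsClient j v)
        (fun z => s.arr 0 ((((u : ℕ) * n : ℕ) : ℤ) + z))
        (s.arr 12 ((((u : ℕ) * n : ℕ) : ℤ) + (j : ℕ))) := by
    intro j hj
    refine (hrow j).congr fun z => ?_
    rw [hlt]
    constructor
    · exact fun hz => ⟨Or.inl hz.1, hz.2⟩
    · rintro ⟨hz | rfl, hz'⟩
      · exact ⟨hz, hz'⟩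
      · exact absurd hz' hj
  rw [tryClient, wp_ite]
  simp only [Test.Holds, Expr.eval, h8, hV, hcol, hL.reg_ℓ]
  constructor
  · rintro ⟨hb1, hb2⟩
    have hyV : y ∈ I.V := by
      by_contra hno
      rw [if_neg hno] at hb1
      omega
    obtain ⟨j, hj⟩ : ∃ j : Fin k, I.col y = Fin.natAdd ℓ j := by
      have h1 : ((I.col y : ℕ)) < ℓ + k := (I.col y).2
      refine ⟨⟨(I.col y : ℕ) - ℓ, by omega⟩, Fin.ext ?_⟩
      simp only [Fin.val_natAdd]
      omega
    have hjv : ((I.col y : ℕ) : ℤ) - ℓ = (j : ℕ) := by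
      rw [hj, Fin.val_natAdd]
      push_cast
      ring
    have hother : ∀ j' : Fin k, j' ≠ j → ¬ I.IsClient j' y := by
      intro j' hne hcl
      exact hne (Fin.natAdd_injective _ _ (hcl.2.symm.trans hj))
    have hnew : ∀ z : Fin n, ((z : ℕ) < i + 1 ∧ I.IsClient j z) ↔
        ((z : ℕ) < i ∧ I.IsClient j z) ∨ z = y := by
      intro z
      rw [hlt]
      constructor
      · rintro ⟨h1 | h1, h2⟩
        · exact Or.inl ⟨h1, h2⟩
        · exact Or.inr h1
      · rintro (h1 | rfl)
        · exact ⟨Or.inl h1.1, h1.2⟩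
        · exact ⟨Or.inr rfl, hyV, hj⟩
    rw [wp_seq, wp_assign, wp_ite]
    simp only [Test.Holds, Expr.eval, State.setReg_reg_same, State.setReg_arr, ne_eq,
      Nat.reduceEqDiff, not_false_eq_true, State.setReg_reg_of_ne, h8, h6, hoffu, hcol, hL.reg_ℓ,
      hjv]
    constructor
    · intro hb
      rw [wp_store]
      simp only [Expr.eval, State.setReg_reg_same, State.setReg_arr, State.setArr_arr_same, ne_eq,
        Nat.reduceEqDiff, not_false_eq_true, State.setReg_reg_of_ne, h8]
      refine ⟨by simp, fun j' => ?_, fun g h hne hh => ?_⟩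
      · by_cases hjj : j' = j
        · subst hjj
          rw [Function.update_self]
          exact (hrow j').insert_new hnew hb
        · rw [Function.update_of_ne (row_ne (by have := j'.2; omega) (by have := j.2; omega)
            (fun e => hjj (Fin.ext e.2)))]
          exact hskip j' (hother j' hjj)
      · rw [Function.update_of_ne (row_ne hh (by have := j.2; omega) (fun e => hne e.1))]
    · intro hb
      rw [wp_skip]
      refine ⟨by simp, fun j' => ?_, fun g h hne hh => rfl⟩
      by_cases hjj : j' = j
      · subst hjj
        exact (hrow j').insert_old hnew hb
      · exact hskip j' (hother j' hjj)
  · intro hb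
    rw [wp_skip]
    refine ⟨by simp, fun j => hskip j fun hcl => hb ⟨by rw [if_pos hcl.1], ?_⟩, fun _ _ _ _ => rfl⟩
    rw [hcl.2, Fin.val_natAdd]
    push_cast
    omega

theorem clientRow_spec (hk : k ≤ n) (hL : I.Loaded s) (hoff : Offsets n s) {u : Fin n}
    (h6 : s.reg 6 = (u : ℕ)) :
    wp O clientRow (fun t s' => t ≤ 200 * (n + 1) ∧ I.BestClientRow u s' ∧
      ∀ g h : ℕ, g ≠ u → h < n →
        s'.arr 12 (((g * n : ℕ) : ℤ) + h) = s.arr 12 (((g * n : ℕ) : ℤ) + h)) s := by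
  have hoffu := hoff u u.2.le
  rw [clientRow, wp_seq]
  refine (wp_forLoop 0 k (fun m s' =>
    (∀ j : ℕ, j < m → s'.arr 12 ((((u : ℕ) * n : ℕ) : ℤ) + j) = -1) ∧
      ∀ g h : ℕ, g ≠ u → h < n →
        s'.arr 12 (((g * n : ℕ) : ℤ) + h) = s.arr 12 (((g * n : ℕ) : ℤ) + h)) 10 rfl
    (by simp) (by omega) (fun s' h' => ?_) ?_ ?_).agree.mono ?_
  · rw [Expr.eval, h'.reg 1 rfl, hL.reg_k]
  · exact ⟨fun _ h => by omega, fun _ _ _ _ => by simp⟩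
  · rintro i s' _ hi hx hag ⟨hI1, hI2⟩
    have h6' : s'.reg 6 = (u : ℕ) := by rw [hag.reg 6 rfl, h6]
    rw [wp_store]
    simp only [Expr.eval, State.setReg_arr, State.setArr_arr_same, h6', hx, hag.arr 11 rfl, hoffu]
    refine ⟨by simp, fun j hj => ?_, fun g h hg hh => ?_⟩
    · by_cases hji : j = i
      · rw [hji, Function.update_self]
      · rw [Function.update_of_ne (by omega)]
        exact hI1 j (by omega)
    · rw [Function.update_of_ne (row_ne hh (by omega) (fun e => hg e.1))]
      exact hI2 g h hg hh
  rintro t₁ s₁ ⟨⟨ht₁, -, hI1, hI2⟩, hag⟩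
  have hL₁ : I.Loaded s₁ := hL.agree hag (by decide)
  have hoff₁ : Offsets n s₁ := by rw [Offsets, hag.arr 11 rfl]; exact hoff
  refine (wp_forLoop 0 n (fun m s' =>
      (∀ j : Fin k, IsArgmax (fun v : Fin n => (v : ℕ) < m ∧ I.IsClient j v)
        (fun z => s₁.arr 0 ((((u : ℕ) * n : ℕ) : ℤ) + z))
        (s'.arr 12 ((((u : ℕ) * n : ℕ) : ℤ) + (j : ℕ)))) ∧
      ∀ g h : ℕ, g ≠ u → h < n →
        s'.arr 12 (((g * n : ℕ) : ℤ) + h) = s.arr 12 (((g * n : ℕ) : ℤ) + h)) 80 rfl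
    (by simp) (by omega) (fun s' h' => ?_) ?_ ?_).agree.mono ?_
  · rw [Expr.eval, h'.reg 0 rfl, hL₁.reg_n]
  · refine ⟨fun j => ?_, fun g h hg hh => hI2 g h hg hh⟩
    simp only [State.setReg_arr]
    rw [hI1 j j.2]
    exact isArgmax_neg_one fun v hv => by omega
  · rintro i s' _ hi hx hag' ⟨hJ1, hJ2⟩
    have b0 : s'.arr 0 = s₁.arr 0 := hag'.arr 0 rfl
    refine (tryClient_spec hk (hL₁.agree hag' (by decide))
      (by rw [Offsets, hag'.arr 11 rfl]; exact hoff₁) (u := u)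
      (by rw [hag'.reg 6 rfl, hag.reg 6 rfl, h6]) hi hx (by rw [b0]; exact hJ1)).mono ?_
    rintro t s'' ⟨ht, hK1, hK2⟩
    rw [b0] at hK1
    exact ⟨ht, hK1, fun g h hg hh => (hK2 g h hg hh).trans (hJ2 g h hg hh)⟩
  · rintro t₂ s₂ ⟨⟨ht₂, -, hJ1, hJ2⟩, hag₂⟩
    refine ⟨?_, fun j => ?_, hJ2⟩
    · simp only [Expr.cost] at ht₁ ht₂ ⊢
      omega
    · rw [hag₂.arr 0 rfl]
      exact (hJ1 j).congr fun v => ⟨fun hv => hv.2, fun hv => ⟨v.2, hv⟩⟩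

theorem part_eq {j : Fin k} {i : Fin ℓ} (h : Fin.natAdd ℓ j ∈ I.Z i) : I.part j = i := by
  have hex : ∃ i, Fin.natAdd ℓ j ∈ I.Z i := ⟨i, h⟩
  rw [part, dif_pos hex, I.eq_of_mem_Z hex.choose_spec h]

/-- This justifies the test made by the program: parts are numbered like the facility colors, and a
client color, being at least `ℓ`, never equals the number of a part. -/
theorem part_eq_col_iff {j : Fin k} {u : Fin n} :
    I.part j = (I.col u : ℕ) ↔ j ∈ I.served u := by
  obtain ⟨i, hi⟩ := I.exists_mem_Z j
  rw [part_eq hi, mem_served]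
  constructor
  · exact fun h => ⟨i, Fin.ext (by rw [Fin.val_castAdd, h]), hi⟩
  · rintro ⟨i', h1, h2⟩
    rw [I.eq_of_mem_Z hi h2, h1, Fin.val_castAdd]

theorem BestClientRow.profit_eq {u : Fin n} (h : I.BestClientRow u s) (hL : I.Loaded s)
    (hs : I.Servable) (j : Fin k) :
    ∃ v : Fin n, s.arr 12 ((((u : ℕ) * n : ℕ) : ℤ) + (j : ℕ)) = ((v : ℕ) : ℤ) ∧
      I.IsClient j v ∧ ∀ x, I.IsClient j x → I.profit u x ≤ I.profit u v := by
  rcases h j with ⟨-, hno⟩ | ⟨v, hv, hcl, hmax⟩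
  · obtain ⟨x, hx⟩ := hs.2 j
    exact absurd hx (hno x)
  · refine ⟨v, hv, hcl, fun x hx => ?_⟩
    have h1 := hmax x hx
    have h2 := hL.arr_profit u x
    have h3 := hL.arr_profit u v
    push_cast at h1 h2 h3
    rw [h2, h3] at h1
    exact_mod_cast h1

/-- If a client color has no client, the cell read from array `12` is `-1` and the computed sum is
meaningless. So the weight is claimed only for servable instances, the running time always. -/
theorem facilityWeight_spec (hL : I.Loaded s) (hoff : Offsets n s) {u : Fin n}
    (h6 : s.reg 6 = (u : ℕ)) (hrow : I.BestClientRow u s) :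
    wp O facilityWeight (fun t s' => t ≤ 60 * (k + 1) ∧
      (I.Servable → s'.arr 7 ((u : ℕ) : ℤ) = I.weight u) ∧
      ∀ z : ℤ, z ≠ (u : ℕ) → s'.arr 7 z = s.arr 7 z) s := by
  have hoffu := hoff u u.2.le
  set G : Fin k → ℤ := fun j => s.arr 0 ((((u : ℕ) * n : ℕ) : ℤ) +
    s.arr 12 ((((u : ℕ) * n : ℕ) : ℤ) + (j : ℕ))) with hG
  rw [facilityWeight, wp_seq, wp_store]
  refine (wp_forLoop 0 k (fun m s' =>
    s'.arr 7 ((u : ℕ) : ℤ) = -(I.cost u : ℤ) +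
      ∑ j ∈ (I.served u).filter (fun j : Fin k => (j : ℕ) < m), G j ∧
    ∀ z : ℤ, z ≠ (u : ℕ) → s'.arr 7 z = s.arr 7 z) 40 rfl
    (by simp) (by omega) (fun s' h' => ?_) ?_ ?_).mono ?_
  · rw [Expr.eval, h'.reg 1 rfl]; simpa using hL.reg_k
  · simp only [Expr.eval, State.setReg_arr, State.setArr_arr_same, h6]
    refine ⟨?_, fun z hz => by rw [Function.update_of_ne hz]⟩
    rw [Function.update_self, hL.arr_cost]
    simp
  · rintro i s' _ hi hx hag ⟨hI1, hI2⟩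
    have b6 : s'.reg 6 = (u : ℕ) := by rw [hag.reg 6 rfl]; simpa using h6
    have b0 : s'.arr 0 = s.arr 0 := hag.arr 0 rfl
    have b2 : s'.arr 2 = s.arr 2 := hag.arr 2 rfl
    have b3 : s'.arr 3 = s.arr 3 := hag.arr 3 rfl
    have b11 : s'.arr 11 = s.arr 11 := hag.arr 11 rfl
    have b12 : s'.arr 12 = s.arr 12 := hag.arr 12 rfl
    set j : Fin k := ⟨i, hi⟩ with hj
    have hpart := hL.arr_part j
    have hcol := hL.arr_col u
    simp only [hj] at hpart
    rw [← hj] at hpart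
    have hiff : s.arr 3 (i : ℤ) = s.arr 2 ((u : ℕ) : ℤ) ↔ j ∈ I.served u := by
      rw [hpart, hcol, ← part_eq_col_iff]
      exact Nat.cast_inj
    have hmem : ∀ j' : Fin k, (j' : ℕ) < i + 1 ↔ (j' : ℕ) < i ∨ j' = j := by
      intro j'
      rw [Fin.ext_iff]
      simp only [hj]
      omega
    rw [wp_ite]
    simp only [Test.Holds, Expr.eval, hx, b6, b2, b3, hiff]
    constructor
    · intro hjs
      rw [wp_store]
      simp only [Expr.eval, State.setReg_arr, State.setArr_arr_same, hx, b6, b0, b11, b12, hoffu]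
      refine ⟨by simp, ?_, fun z hz => by rw [Function.update_of_ne hz]; exact hI2 z hz⟩
      have hins : (I.served u).filter (fun j' : Fin k => (j' : ℕ) < i + 1) =
          insert j ((I.served u).filter fun j' : Fin k => (j' : ℕ) < i) := by
        ext j'
        simp only [Finset.mem_filter, Finset.mem_insert, hmem]
        constructor
        · rintro ⟨h1, h2 | h2⟩
          · exact Or.inr ⟨h1, h2⟩
          · exact Or.inl h2
        · rintro (rfl | ⟨h1, h2⟩)
          · exact ⟨hjs, Or.inr rfl⟩
          · exact ⟨h1, Or.inl h2⟩
      rw [Function.update_self, hI1, hins, Finset.sum_insert (by simp [hj])]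
      simp only [hG, hj]
      ring
    · intro hjs
      rw [wp_skip]
      refine ⟨by simp, ?_, hI2⟩
      have hins : (I.served u).filter (fun j' : Fin k => (j' : ℕ) < i + 1) =
          (I.served u).filter fun j' : Fin k => (j' : ℕ) < i := by
        ext j'
        simp only [Finset.mem_filter, hmem]
        constructor
        · rintro ⟨h1, h2 | rfl⟩
          · exact ⟨h1, h2⟩
          · exact absurd h1 hjs
        · exact fun h => ⟨h.1, Or.inl h.2⟩
      rw [hins]
      exact hI1
  · rintro t s' ⟨ht, -, hI1, hI2⟩
    refine ⟨by simp only [Expr.cost] at ht ⊢; omega, fun hs => ?_, hI2⟩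
    rw [hI1, weight_eq]
    congr 1
    have hfil : (I.served u).filter (fun j : Fin k => (j : ℕ) < k) = I.served u :=
      Finset.filter_true_of_mem fun j _ => j.2
    rw [hfil]
    refine Finset.sum_congr rfl fun j _ => ?_
    obtain ⟨v, hv, hcl, hmax⟩ := hrow.profit_eq hL hs j
    have h3 := hL.arr_profit u v
    push_cast at h3
    simp only [hG, hv]
    push_cast
    rw [h3]
    congr 1
    refine le_antisymm (Finset.le_sup (f := I.profit u) (Finset.mem_filter.2 hcl))
      (Finset.sup_le fun x hx => hmax x (Finset.mem_filter.1 hx))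

theorem prepare_spec (hk : k ≤ n) (hL : I.Loaded s) (hoff : Offsets n s) :
    wp O prepare (fun t s' => t ≤ 400 * (n + 1) ^ 2 ∧ (∀ u, I.BestClientRow u s') ∧
      (I.Servable → ∀ u : Fin n, s'.arr 7 ((u : ℕ) : ℤ) = I.weight u)) s := by
  rw [prepare]
  refine (wp_forLoop 0 n (fun m s' => (∀ u : Fin n, (u : ℕ) < m → I.BestClientRow u s') ∧
      (I.Servable → ∀ u : Fin n, (u : ℕ) < m → s'.arr 7 ((u : ℕ) : ℤ) = I.weight u))
      (260 * (n + 1)) rfl (by simp) (by omega) (fun s' h' => ?_) ?_ ?_).mono ?_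
  · rw [Expr.eval, h'.reg 0 rfl, hL.reg_n]
  · exact ⟨fun _ h => by omega, fun _ _ h => by omega⟩
  · rintro i s' _ hi hx hag ⟨hI1, hI2⟩
    have hL' : I.Loaded s' := hL.agree hag (by decide)
    have hoff' : Offsets n s' := by rw [Offsets, hag.arr 11 rfl]; exact hoff
    rw [wp_seq]
    refine (clientRow_spec hk hL' hoff' (u := ⟨i, hi⟩) hx).agree.mono ?_
    rintro t₁ s₁ ⟨⟨ht₁, hR, hR'⟩, hag₁⟩
    have hL₁ : I.Loaded s₁ := hL'.agree hag₁ (by decide)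
    have hoff₁ : Offsets n s₁ := by rw [Offsets, hag₁.arr 11 rfl]; exact hoff'
    refine (facilityWeight_spec hL₁ hoff₁ (u := ⟨i, hi⟩) (by rw [hag₁.reg 6 rfl]; exact hx)
      hR).agree.mono ?_
    rintro t₂ s₂ ⟨⟨ht₂, hW, hW'⟩, hag₂⟩
    refine ⟨by omega, fun u hu => ?_, fun hs u hu => ?_⟩
    · intro j
      simp only [State.setReg_arr, hag₂.arr 0 rfl, hag₂.arr 12 rfl]
      by_cases hui : (u : ℕ) = i
      · have : u = ⟨i, hi⟩ := Fin.ext hui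
        rw [this]
        exact hR j
      · rw [hR' u j hui (by have := j.2; omega), hag₁.arr 0 rfl]
        exact hI1 u (by omega) j
    · simp only [State.setReg_arr]
      by_cases hui : (u : ℕ) = i
      · have : u = ⟨i, hi⟩ := Fin.ext hui
        rw [this]
        exact hW hs
      · rw [hW' _ (by simpa using hui), hag₁.arr 7 rfl]
        exact hI2 hs u (by omega)
  · rintro t s' ⟨ht, -, hI1, hI2⟩
    refine ⟨?_, fun u => hI1 u u.2, fun hs u => hI2 hs u u.2⟩
    simp only [Expr.cost, Nat.sub_zero] at ht
    have : n * (260 * (n + 1) + 1 + 8) = 260 * n ^ 2 + 269 * n := by ring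
    have : 400 * (n + 1) ^ 2 = 400 * n ^ 2 + 800 * n + 400 := by ring
    omega

theorem checkClients_spec (hk : k ≤ n) (hL : I.Loaded s) (hrow : ∀ u, I.BestClientRow u s)
    (hr : k ≤ I.r) :
    wp O checkClients (fun t s' => t ≤ 60 * (k + 1) ∧
      ((s'.reg 4 = 1 ∧ I.Servable) ∨ (s'.reg 4 = 0 ∧ ¬ I.Servable))) s := by
  -- Whether a color has a client does not depend on the facility, so row `0` decides.
  have hcell : ∀ j : Fin k, (¬ s.arr 12 ((j : ℕ) : ℤ) < 0 ↔ ∃ v, I.IsClient j v) := by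
    intro j
    have h := hrow ⟨0, by have := j.2; omega⟩ j
    simp only [Nat.zero_mul, Nat.cast_zero, zero_add] at h
    rcases h with ⟨h1, h2⟩ | ⟨v, h1, h2, -⟩
    · rw [h1]
      simp only [Int.reduceNeg, Int.reduceLT, not_true_eq_false, false_iff]
      rintro ⟨v, hv⟩
      exact h2 v hv
    · rw [h1]
      exact ⟨fun _ => ⟨v, h2⟩, fun _ => by omega⟩
  rw [checkClients, wp_seq, wp_assign]
  refine (wp_forLoop 0 k (fun m s' =>
    (s'.reg 4 = 1 ∧ ∀ j : Fin k, (j : ℕ) < m → ∃ v, I.IsClient j v) ∨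
    (s'.reg 4 = 0 ∧ ¬ I.Servable)) 20 rfl
    (by simp) (by omega) (fun s' h' => ?_) ?_ ?_).mono ?_
  · rw [Expr.eval, h'.reg 1 rfl]; simpa using hL.reg_k
  · exact Or.inl ⟨by simp, fun _ h => by omega⟩
  · intro i s' _ hi hx hag hI
    have b12 : s'.arr 12 = s.arr 12 := hag.arr 12 rfl
    rw [wp_ite]
    simp only [Test.Holds, Expr.eval, hx, b12]
    constructor
    · intro hb
      rw [wp_assign]
      refine ⟨by simp, Or.inr ⟨by simp, fun hs => ?_⟩⟩
      exact (hcell ⟨i, hi⟩).2 (hs.2 ⟨i, hi⟩) hb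
    · intro hb
      rw [wp_skip]
      refine ⟨by simp, ?_⟩
      rcases hI with ⟨h4, hI⟩ | ⟨h4, hI⟩
      · refine Or.inl ⟨by simpa using h4, fun j hj => ?_⟩
        by_cases hji : (j : ℕ) = i
        · rw [← hcell, hji]
          exact hb
        · exact hI j (by omega)
      · exact Or.inr ⟨by simpa using h4, hI⟩
  · rintro t s' ⟨ht, -, hI⟩
    refine ⟨by simp only [Expr.cost] at ht ⊢; omega, ?_⟩
    rcases hI with ⟨h4, hI⟩ | h
    · exact Or.inl ⟨h4, hr, fun j => hI j j.2⟩
    · exact Or.inr h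

end UFLPMCC

/-! ### The algorithm -/

namespace UFLPMCC

open RAM Transversal

/-- The empty transversal. -/
def initTransversal : Prog :=
  .seq (.store 7 (.lit (-1)) (.lit 0)) (.seq (.store 8 (.lit 0) (.lit (-1)))
    (.store 9 (.lit 0) (.lit 0)))

/-- Extend the transversal node by node. -/
def mainLoop : Prog :=
  .forLoop 5 (.lit 1) (.add (.var 2) (.lit 1)) (.ite (.eq (.var 4) (.lit 1)) phase .skip)

/-- Write the solution to the arrays `5` and `6`. -/
def output : Prog :=
  .seq buildInd
  (.seq (.forLoop 6 (.lit 0) (.var 0) (.store 6 (.var 6) (.lit 0)))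
  (.forLoop 7 (.lit 0) (.var 1)
    (.store 6 (.get 12 (.add (.get 11 (.get 8 (.add (.get 3 (.var 7)) (.lit 1)))) (.var 7)))
      (.lit 1))))

/-- The algorithm. -/
def solve : Prog :=
  .ite (.or (.lt (.var 0) (.var 2)) (.or (.lt (.var 0) (.var 1)) (.lt (.var 3) (.var 1))))
    (.assign 4 (.lit 0))
    (.seq offsets (.seq prepare (.seq checkClients (.seq initTransversal (.seq mainLoop
      (.ite (.eq (.var 4) (.lit 1)) output .skip))))))

variable {O : (ℤ → ℤ) → Prop} {n k ℓ : ℕ} {I : UFLPMCC n k ℓ} {s : State}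

theorem Loaded.ready (hL : I.Loaded s) (hoff : Offsets n s) (h7 : s.arr 7 (-1) = 0) :
    Ready I.node s :=
  ⟨hL.reg_n, hoff, fun u => by rw [hL.arr_col, node]; push_cast; ring, h7⟩

theorem bijOn_repSet {M : Matroid (Fin n)} {node : Fin n → ℕ} {c : ℕ} {rep : ℤ → ℤ}
    (hT : IsTransversal M node c rep) :
    Set.BijOn node (repSet n c rep) (Finset.Ico 1 c) := by
  refine ⟨fun u hu => ?_, fun u hu v hv huv => ?_, fun g hg => ?_⟩
  · have := hT.mem_repSet_iff.1 hu
    simpa using ⟨this.1, this.2.1⟩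
  · have h1 := (hT.mem_repSet_iff.1 hu).2.2
    have h2 := (hT.mem_repSet_iff.1 hv).2.2
    rw [huv] at h1
    exact Fin.ext (by omega)
  · have hg' := Finset.mem_Ico.1 (Finset.mem_coe.1 hg)
    obtain ⟨u, hu, hn⟩ := hT.exists_rep g hg'.1 hg'.2
    exact ⟨u, mem_repSet.2 ⟨g, hg'.1, hg'.2, hu⟩, hn⟩

/-- The elements of the first `c` colors in a common independent set would form an independent
transversal of `1, …, c`; so failure in any phase is final. -/
theorem not_commonIndep_of_noTransversal {c : ℕ} (hc : c ≤ ℓ)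
    (h : NoTransversal I.facility I.node c) (A : Finset (Fin n)) : ¬ I.CommonIndep A := by
  intro hA
  obtain ⟨hi, hbij⟩ := I.commonIndep_iff.1 hA
  refine h (A.filter fun u => I.node u < c + 1) 
    (hi.subset (Finset.coe_subset.2 (Finset.filter_subset _ _))) ⟨?_, ?_, ?_⟩
  · intro u hu
    rw [Finset.mem_coe, Finset.mem_filter] at hu
    exact Finset.mem_coe.2 (Finset.mem_Ico.2 ⟨I.one_le_node u, hu.2⟩)
  · exact hbij.injOn.mono (Finset.coe_subset.2 (Finset.filter_subset _ _))
  · intro g hg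
    have hg' := Finset.mem_Ico.1 (Finset.mem_coe.1 hg)
    obtain ⟨u, hu, rfl⟩ := hbij.surjOn (Finset.mem_coe.2 (Finset.mem_Ico.2
      (⟨hg'.1, by omega⟩ : 1 ≤ g ∧ g < ℓ + 1)))
    exact ⟨u, Finset.mem_coe.2 (Finset.mem_filter.2 ⟨hu, hg'.2⟩), rfl⟩

theorem CommonIndep.card_le {A : Finset (Fin n)} (h : I.CommonIndep A) : ℓ ≤ n := by
  rw [← h.1]
  simpa using Finset.card_le_univ A

theorem Servable.card_le (h : I.Servable) : k ≤ n := by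
  choose v hv using h.2
  have hinj : Function.Injective v := fun j j' e => Fin.natAdd_injective _ _
    ((hv j).2.symm.trans ((congrArg I.col e).trans (hv j').2))
  simpa using Fintype.card_le_of_injective v hinj

/-- If register `4` is `0` at the start, all rounds are skipped; the case is allowed so that `solve`
need not branch after `checkClients`. -/
theorem mainLoop_spec (hn : ℓ ≤ n) (hL : I.Loaded s) (hoff : Offsets n s) (h4 : s.reg 4 = 0 ∨
    s.reg 4 = 1) (h7 : s.arr 7 (-1) = 0) (h8 : s.arr 8 0 = -1) (h9 : s.arr 9 0 = 0) :
    wp (indepOracle I.facility) mainLoop (fun t s' => t ≤ ℓ * (3000 * n ^ 2 + 30) + 30 ∧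
      s'.reg 5 = (ℓ + 1 : ℕ) ∧
      ((s.reg 4 = 1 ∧ s'.reg 4 = 1 ∧ IsTransversal I.facility I.node (ℓ + 1) (s'.arr 8) ∧
        IsDual I.facility I.node (s'.arr 7) (ℓ + 1) (s'.arr 8) (s'.arr 9)) ∨
      (s'.reg 4 = 0 ∧ (s.reg 4 = 0 ∨ ∀ A, ¬ I.CommonIndep A)))) s := by
  rw [mainLoop]
  refine (wp_forLoop 1 (ℓ + 1) (fun m s' =>
      (s.reg 4 = 1 ∧ s'.reg 4 = 1 ∧ IsTransversal I.facility I.node m (s'.arr 8) ∧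
        IsDual I.facility I.node (s'.arr 7) m (s'.arr 8) (s'.arr 9)) ∨
      (s'.reg 4 = 0 ∧ (s.reg 4 = 0 ∨ ∀ A, ¬ I.CommonIndep A))) (3000 * n ^ 2 + 10) rfl
    (by simp) (by omega) (fun s' h' => ?_) ?_ ?_).mono ?_
  · simp [h'.reg 2 rfl, hL.reg_ℓ]
  · rcases h4 with h4 | h4
    · exact Or.inr ⟨by simpa using h4, Or.inl h4⟩
    -- For `m = 1` the transversal is empty, and the dual inequalities are vacuous because no
    -- element has a node below `1`.
    · refine Or.inl ⟨h4, by simpa using h4, ⟨h8, fun g h1 h2 => by omega, ?_⟩,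
        h9, fun y h hy => ?_⟩
      · have : repSet n 1 ((s.setReg 5 (1 : ℕ)).arr 8) = ∅ := by
          rw [Finset.eq_empty_iff_forall_notMem]
          intro u hu
          obtain ⟨g, h1, h2, -⟩ := mem_repSet.1 hu
          omega
        rw [this, Finset.coe_empty]
        exact I.facility.empty_indep
      · have := I.one_le_node y
        omega
  · rintro i s' hi1 hi hx hag hI
    rw [wp_ite]
    simp only [Test.Holds, Expr.eval]
    constructor
    · intro hb
      obtain ⟨k4, -, hT, hD⟩ : s.reg 4 = 1 ∧ s'.reg 4 = 1 ∧
          IsTransversal I.facility I.node i (s'.arr 8) ∧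
          IsDual I.facility I.node (s'.arr 7) i (s'.arr 8) (s'.arr 9) := by
        rcases hI with h | ⟨h, -⟩
        · exact h
        · omega
      refine (phase_spec ((hL.agree hag (by decide)).ready
        (by rw [Offsets, hag.arr 11 rfl]; exact hoff) (by rw [hag.arr 7 rfl]; exact h7)) hx hi1
        (by omega) hb I.one_le_node hT hD).agree.mono ?_
      rintro t s'' ⟨⟨ht, hres⟩, hag'⟩
      refine ⟨by simp only [Test.cost, Expr.cost]; omega, ?_⟩
      rcases hres with ⟨q4, qT, qD⟩ | ⟨q4, qN⟩
      · refine Or.inl ⟨k4, by simpa using q4, qT, ?_⟩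
        rw [State.setReg_arr, hag'.arr 7 rfl]
        exact qD
      · exact Or.inr ⟨by simpa using q4,
          Or.inr (not_commonIndep_of_noTransversal (by omega) qN)⟩
    · intro hb
      rw [wp_skip]
      refine ⟨by simp only [Test.cost, Expr.cost]; omega, ?_⟩
      rcases hI with ⟨-, h, -⟩ | ⟨h, h'⟩
      · exact absurd h hb
      · exact Or.inr ⟨by simpa using h, h'⟩
  · rintro t s' ⟨ht, h5, hI⟩
    refine ⟨?_, h5, hI⟩
    simp only [Expr.cost, Nat.add_sub_cancel] at ht
    have e1 : ℓ * (3000 * n ^ 2 + 10 + (1 + 1 + 1) + 8) = ℓ * (3000 * n ^ 2 + 21) := by ring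
    have e2 : ℓ * (3000 * n ^ 2 + 21) ≤ ℓ * (3000 * n ^ 2 + 30) :=
      Nat.mul_le_mul_left _ (by omega)
    omega

theorem output_spec (hL : I.Loaded s) (hoff : Offsets n s)
    (h4 : s.reg 4 = 1) (h5 : s.reg 5 = (ℓ + 1 : ℕ)) (h7 : s.arr 7 (-1) = 0)
    (hT : IsTransversal I.facility I.node (ℓ + 1) (s.arr 8))
    (hD : IsDual I.facility I.node (s.arr 7) (ℓ + 1) (s.arr 8) (s.arr 9))
    (hs : I.Servable) (hrow : ∀ u, I.BestClientRow u s)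
    (hw : ∀ u : Fin n, s.arr 7 ((u : ℕ) : ℤ) = I.weight u) :
    wp O output (fun t s' => t ≤ 200 * (n + k + ℓ + 1) ∧ I.Solved s') s := by
  classical
  set A : Finset (Fin n) := repSet n (ℓ + 1) (s.arr 8) with hA
  have hmax : I.MaxWeightCommonIndep A := by
    refine ⟨I.commonIndep_iff.2 ⟨hT.indep, bijOn_repSet hT⟩, fun B hB => ?_⟩
    obtain ⟨hBi, hBb⟩ := I.commonIndep_iff.1 hB
    have := hD.isMax hT h7 (by omega) hBi hBb
    simpa only [hw] using this
  -- A color in part `i` is served by the representative of node `i + 1`, since nodes are counted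
  -- from `1`; the output program looks it up in the same way.
  have hrep : ∀ j : Fin k, ∃ u : Fin n, s.arr 8 (s.arr 3 ((j : ℕ) : ℤ) + 1) = ((u : ℕ) : ℤ) ∧
      ∀ x ∈ A, j ∈ I.served x → x = u := by
    intro j
    obtain ⟨i, hi⟩ := I.exists_mem_Z j
    obtain ⟨u, hu, hn⟩ := hT.exists_rep (i + 1) (by omega) (by have := i.2; omega)
    refine ⟨u, ?_, fun x hx hj => ?_⟩
    · rw [hL.arr_part, part_eq hi, ← hu]
      push_cast
      rfl
    · have h1 := part_eq_col_iff.2 hj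
      rw [part_eq hi] at h1
      have h2 := (hT.mem_repSet_iff.1 hx).2.2
      have h3 : I.node x = i + 1 := by rw [node, h1]
      rw [h3, hu] at h2
      exact Fin.ext (by omega)
  choose f hf hfu using hrep
  choose v hv hvc hvm using fun j : Fin k => (hrow (f j)).profit_eq hL hs j
  have hbest : I.IsBestClients A v := by
    refine ⟨fun j => (hvc j).1, fun j => (hvc j).2, fun j u hu hj x hx hc => ?_⟩
    rw [hfu j u hu hj]
    exact hvm j x ⟨hx, hc⟩
  have hopt := hmax.optimal hs.1 hbest
  rw [output, wp_seq]
  refine (buildInd_spec (M := I.facility) (node := I.node) (c := ℓ + 1) hL.reg_n h5 (by omega)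
    hT).agree.mono ?_
  rintro t₁ s₁ ⟨⟨ht₁, hind⟩, hag₁⟩
  rw [wp_seq]
  have hL₁ : I.Loaded s₁ := hL.agree hag₁ (by decide)
  refine (wp_forLoop 0 n (fun m s' => ∀ u : Fin n, (u : ℕ) < m → s'.arr 6 ((u : ℕ) : ℤ) = 0) 10
    rfl (by simp) (by omega) (fun s' h' => ?_) ?_ ?_).agree.mono ?_
  · rw [Expr.eval, h'.reg 0 rfl, hL₁.reg_n]
  · exact fun _ h => by omega
  · rintro i s' _ hi hx hag hI
    rw [wp_store]
    refine ⟨by simp, fun u hu => ?_⟩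
    simp only [Expr.eval, State.setReg_arr, State.setArr_arr_same, hx]
    by_cases hui : (u : ℕ) = i
    · rw [hui, Function.update_self]
    · rw [Function.update_of_ne (by omega)]
      exact hI u (by omega)
  rintro t₂ s₂ ⟨⟨ht₂, -, hzero⟩, hag₂⟩
  have hL₂ : I.Loaded s₂ := hL₁.agree hag₂ (by decide)
  refine (wp_forLoop 0 k (fun m s' => ∀ u : Fin n, s'.arr 6 ((u : ℕ) : ℤ) =
    if ∃ j : Fin k, (j : ℕ) < m ∧ v j = u then 1 else 0) 20
    rfl (by simp) (by omega) (fun s' h' => ?_) ?_ ?_).agree.mono ?_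
  · rw [Expr.eval, h'.reg 1 rfl, hL₂.reg_k]
  · intro u
    simp [hzero u u.2]
  · rintro i s' _ hi hx hag hI
    have b3 : s'.arr 3 = s.arr 3 := by rw [hag.arr 3 rfl, hag₂.arr 3 rfl, hag₁.arr 3 rfl]
    have b8 : s'.arr 8 = s.arr 8 := by rw [hag.arr 8 rfl, hag₂.arr 8 rfl, hag₁.arr 8 rfl]
    have b11 : s'.arr 11 = s.arr 11 := by rw [hag.arr 11 rfl, hag₂.arr 11 rfl, hag₁.arr 11 rfl]
    have b12 : s'.arr 12 = s.arr 12 := by rw [hag.arr 12 rfl, hag₂.arr 12 rfl, hag₁.arr 12 rfl]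
    have h1 := hf ⟨i, hi⟩
    have h2 := hv ⟨i, hi⟩
    have h3 := hoff (f ⟨i, hi⟩) (f ⟨i, hi⟩).2.le
    simp only at h1 h2
    rw [wp_store]
    simp only [Expr.eval, State.setReg_arr, State.setArr_arr_same, hx, b3, b8, b11, b12, h1, h3,
      h2]
    refine ⟨by simp, fun u => ?_⟩
    by_cases hu : v ⟨i, hi⟩ = u
    · rw [hu, Function.update_self, if_pos ⟨⟨i, hi⟩, by simp, hu⟩]
    · rw [Function.update_of_ne (fun e => hu (Fin.ext (by exact_mod_cast e.symm))), hI u]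
      congr 1
      rw [eq_iff_iff]
      constructor
      · rintro ⟨j, h, h'⟩
        exact ⟨j, by omega, h'⟩
      · rintro ⟨j, h, h'⟩
        refine ⟨j, ?_, h'⟩
        have : (j : ℕ) ≠ i := by
          rintro rfl
          exact hu h'
        omega
  · rintro t₃ s₃ ⟨⟨ht₃, -, hC⟩, hag₃⟩
    refine ⟨by simp only [Expr.cost] at ht₁ ht₂ ht₃ ⊢; omega, Or.inl ⟨?_, ?_⟩⟩
    · rw [hag₃.reg 4 rfl, hag₂.reg 4 rfl, hag₁.reg 4 rfl, h4]
    · have e5 : decode n (s₃.arr 5) = A := by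
        ext u
        simp only [decode, Finset.mem_filter, Finset.mem_univ, true_and]
        rw [hag₃.arr 5 rfl, hag₂.arr 5 rfl, hind u]
        simp [hA]
      have e6 : decode n (s₃.arr 6) = Finset.univ.image v := by
        ext u
        simp only [decode, Finset.mem_filter, Finset.mem_univ, true_and, Finset.mem_image]
        rw [hC u]
        simp
      rw [e5, e6]
      exact hopt

theorem solve_spec (hL : I.Loaded s) :
    wp (indepOracle I.facility) solve
      (fun t s' => t ≤ 10000 * (ℓ * n ^ 2 + 1) ∧ I.Solved s') s := by
  rw [solve, wp_ite]
  simp only [Test.Holds, Expr.eval, hL.reg_n, hL.reg_k, hL.reg_ℓ, hL.reg_r, Nat.cast_lt]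
  constructor
  -- Each of `n < ℓ`, `n < k` and `r < k` excludes feasible solutions. Beyond this exit, loops over
  -- colors cost `O(n)`.
  · intro hb
    rw [wp_assign]
    refine ⟨by simp only [Test.cost, Expr.cost]; omega, Or.inr ⟨by simp, fun A C h => ?_⟩⟩
    have h1 := h.commonIndep_facilities.card_le
    have h2 := h.servable.card_le
    have h3 := h.servable.1
    omega
  · intro hb
    have hn : ℓ ≤ n := by omega
    have hk : k ≤ n := by omega
    have hr : k ≤ I.r := by omega
    -- Any element has a color. If `ℓ` were `0`, this would be a client color, and its part would
    -- have an index below `0`. Hence the `O(n²)` preprocessing fits into `O(ℓ n²)`.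
    have hℓ : n ≠ 0 → 1 ≤ ℓ := by
      intro hn0
      by_contra hcon
      have h1 := (I.col ⟨0, by omega⟩).2
      obtain ⟨i, -⟩ := I.exists_mem_Z ⟨0, by omega⟩
      have := i.2
      omega
    rw [wp_seq]
    refine (offsets_spec (n := n) hL.reg_n).agree.mono ?_
    rintro t₁ s₁ ⟨⟨ht₁, hoff₁⟩, hag₁⟩
    have hL₁ : I.Loaded s₁ := hL.agree hag₁ (by decide)
    rw [wp_seq]
    refine (prepare_spec hk hL₁ hoff₁).agree.mono ?_
    rintro t₂ s₂ ⟨⟨ht₂, hrow₂, hw₂⟩, hag₂⟩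
    have hL₂ : I.Loaded s₂ := hL₁.agree hag₂ (by decide)
    rw [wp_seq]
    refine (checkClients_spec hk hL₂ hrow₂ hr).agree.mono ?_
    rintro t₃ s₃ ⟨⟨ht₃, hserv⟩, hag₃⟩
    have hL₃ : I.Loaded s₃ := hL₂.agree hag₃ (by decide)
    rw [wp_seq, initTransversal, wp_seq, wp_store, wp_seq, wp_store, wp_store]
    simp only [Expr.eval]
    set s₄ := ((s₃.setArr 7 (-1) 0).setArr 8 0 (-1)).setArr 9 0 0 with hs₄
    have hL₄ : I.Loaded s₄ :=
      ((hL₃.setArr (by norm_num) _ _).setArr (by norm_num) _ _).setArr (by norm_num) _ _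
    have hoff₄ : Offsets n s₄ := by
      intro i hi
      simp only [hs₄, ne_eq, Nat.reduceEqDiff, not_false_eq_true, State.setArr_arr_of_ne]
      rw [hag₃.arr 11 rfl, hag₂.arr 11 rfl, hoff₁ i hi]
    have h4₄ : s₄.reg 4 = s₃.reg 4 := rfl
    have h7₄ : s₄.arr 7 (-1) = 0 := by simp [hs₄]
    have hw₄ : I.Servable → ∀ u : Fin n, s₄.arr 7 ((u : ℕ) : ℤ) = I.weight u := by
      intro hs u
      simp only [hs₄, ne_eq, Nat.reduceEqDiff, not_false_eq_true, State.setArr_arr_of_ne,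
        State.setArr_arr_same]
      rw [Function.update_of_ne (by omega), hag₃.arr 7 rfl, hw₂ hs u]
    rw [wp_seq]
    refine (mainLoop_spec hn hL₄ hoff₄ (by rw [h4₄]; exact hserv.symm.imp And.left And.left) h7₄
      (by simp [hs₄]) (by simp [hs₄])).agree.mono ?_
    rintro t₅ s₅ ⟨⟨ht₅, h5₅, hres⟩, hag₅⟩
    have hL₅ : I.Loaded s₅ := hL₄.agree hag₅ (by decide)
    have htime : ∀ t : ℕ, t ≤ 200 * (n + k + ℓ + 1) + 30 →
        20 + t₁ + t₂ + t₃ + t₅ + t ≤ 10000 * (ℓ * n ^ 2 + 1) := by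
      intro t ht
      rcases Nat.eq_zero_or_pos n with rfl | hpos
      · obtain rfl : ℓ = 0 := by omega
        simp only [Nat.zero_mul] at *
        omega
      · have e1 : n ≤ n ^ 2 := by nlinarith
        have e2 : 1 * n ^ 2 ≤ ℓ * n ^ 2 := Nat.mul_le_mul_right _ (hℓ (by omega))
        have e3 : 400 * (n + 1) ^ 2 = 400 * n ^ 2 + 800 * n + 400 := by ring
        have e4 : ℓ * (3000 * n ^ 2 + 30) = 3000 * (ℓ * n ^ 2) + 30 * ℓ := by ring
        omega
    rw [wp_ite]
    simp only [Test.Holds, Expr.eval]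
    constructor
    · intro h4₅
      obtain ⟨k4, -, hT, hD⟩ : s₄.reg 4 = 1 ∧ s₅.reg 4 = 1 ∧
          IsTransversal I.facility I.node (ℓ + 1) (s₅.arr 8) ∧
          IsDual I.facility I.node (s₅.arr 7) (ℓ + 1) (s₅.arr 8) (s₅.arr 9) := by
        rcases hres with h | ⟨h, -⟩
        · exact h
        · omega
      have hs : I.Servable := by
        rcases hserv with h | h
        · exact h.2
        · rw [h4₄] at k4
          omega
      refine (output_spec hL₅ (by rw [Offsets, hag₅.arr 11 rfl]; exact hoff₄) h4₅ h5₅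
        (by rw [hag₅.arr 7 rfl]; exact h7₄) hT hD hs ?_ ?_).mono ?_
      · intro u j
        have := hrow₂ u j
        rw [hag₅.arr 0 rfl, hag₅.arr 12 rfl]
        simp only [hs₄, ne_eq, Nat.reduceEqDiff, not_false_eq_true, State.setArr_arr_of_ne,
          OfNat.zero_ne_ofNat]
        rw [hag₃.arr 0 rfl, hag₃.arr 12 rfl]
        exact this
      · rw [hag₅.arr 7 rfl]
        exact hw₄ hs
      · rintro t₆ s₆ ⟨ht₆, hsol⟩
        refine ⟨?_, hsol⟩
        have := htime (t₆ + 20) (by omega)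
        simp only [Test.cost, Expr.cost]
        omega
    · intro h4₅
      rw [wp_skip]
      refine ⟨?_, Or.inr ?_⟩
      · have := htime 20 (by omega)
        simp only [Test.cost, Expr.cost]
        omega
      · rcases hres with ⟨-, h, -⟩ | ⟨h, h'⟩
        · exact absurd h h4₅
        · refine ⟨h, fun A C hAC => ?_⟩
          rcases h' with h' | h'
          · rw [h4₄] at h'
            rcases hserv with h'' | h''
            · omega
            · exact h''.2 hAC.servable
          · exact h' _ hAC.commonIndep_facilities

end UFLPMCC

theorem mainTheorem10 :
    -- one program solves all instances in `O(ℓ n ^ 2)` time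
    (∃ (P : RAM.Prog) (K : ℕ), ∀ (n k ℓ : ℕ) (I : UFLPMCC n k ℓ) (s : RAM.State), I.Loaded s →
      ∃ (t : ℕ) (s' : RAM.State), RAM.Exec (RAM.indepOracle I.facility) P s t s' ∧
        t ≤ K * (ℓ * n ^ 2 + 1) ∧ I.Solved s') ∧
    -- reduction to a maximum-weight common independent set of size `ℓ`
    (∀ (n k ℓ : ℕ) (I : UFLPMCC n k ℓ),
      ((∃ A C, I.Feasible A C) ↔ I.Servable ∧ ∃ A, I.CommonIndep A) ∧
      (I.Servable → ∀ A, I.MaxWeightCommonIndep A ↔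
        (∃ C, I.Optimal A C) ∧ ∀ u ∈ A, ∃ i : Fin ℓ, I.col u = Fin.castAdd k i)) :=
  ⟨⟨UFLPMCC.solve, 10000, fun _ _ _ _ _ hL => UFLPMCC.solve_spec hL⟩,
    fun _ _ _ I => ⟨I.exists_feasible_iff, I.maxWeightCommonIndep_iff⟩⟩
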